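/- Let $k$ be a field of characteristic zero. All vector spaces are $\mathbb Z$-graded over $k$, $V[n]^p=V^{n+p}$, the Koszul sign rule is used, $S(U)$ is the graded symmetric algebra, and $\hbar$ is a formal variable of degree $2$. *$L_\infty$-algebras.* An $L_\infty$-algebra is a graded vector space $\mathfrak g$ with a coderivation $D$ of degree $1$ of the coalgebra $S(\mathfrak g[1])$ (with the shuffle coproduct) such that $D^2=0$ and $D(1)=0$. An $L_\infty$-morphism $\mathfrak g\to\mathfrak g'$ is a morphism $\Phi:S(\mathfrak g[1])\to S(\mathfrak g'[1])$ of counital graded coalgebras with $\Phi D=D'\Phi$ and $\Phi(1)=1$. The brackets $l_n:S^n(\mathfrak g[1])\to\mathfrak g[1]$ are the components of the projection of $D$ to $\mathfrak g[1]$, and $D_n$ is the extension of $l_n$ to a coderivation. *$BV_\infty$-algebras.* A $BV_\infty$-algebra that is free as a graded commutative algebra is an algebra $S(U)$ with a linear map $\Delta=\frac1\hbar\sum_{n\ge1}\hbar^n\Delta_n:S(U)\to S(U)[[\hbar]]$ of degree $1$ such that $\Delta_n$ is a differential operator of order $\le n$, $\Delta^2=0$ and $\Delta(1)=0$. It is pure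 if for every $n\ge1$ the operator $\Delta_n$ maps $S^n(U)$ to $U$ and $S^{<n}(U)$ to $0$. For a linear map $\varphi:S(U)\to S(U')[[\hbar]]$ of degree $0$ with $\varphi(1)=0$, put $\exp(\varphi)(1)=1$ and, for $x_1,\dots,x_m\in U$, $m\ge1$, $$\exp(\varphi)(x_1\cdots x_m)=\sum_{j=1}^m\frac1{j!}\sum_{i_1+\dots+i_j=m,\ i_r\ge1}\frac1{i_1!\cdots i_j!}\sum_{\sigma\in S_m}\pm\,\varphi(x_{\sigma(1)}\cdots x_{\sigma(i_1)})\cdots\varphi(x_{\sigma(m-i_j+1)}\cdots x_{\sigma(m)})$$ with Koszul signs. For $\Phi$ of degree $0$ with $\Phi(1)=1$, $\log(\Phi)$ is given by the same formula with $\Phi$ for $\varphi$, with $(-1)^{j-1}/j$ instead of $1/j!$, and with $\log(\Phi)(1)=0$. Both are extended $k[[\hbar]]$-linearly and continuously where needed. A $BV_\infty$-morphism $(S(U),\Delta)\to(S(U'),\Delta')$ is a linear map $\varphi=\frac1\hbar\sum_{n\ge1}\hbar^n\varphi_n:S(U)\to S(U')[[\hbar]]$ of degree $0$ with $\varphi(1)=0$,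 $\exp(\varphi)\Delta=\Delta'\exp(\varphi)$, and $\varphi_n$ a differential operator of order $\le n$ over the algebra morphism $S(U)\to S(U')$ induced by $0:U\to S(U')$, i.e. $\varphi_n$ vanishes on $S^{>n}(U)$. It is pure if $\varphi_n$ maps $S^n(U)$ to $U'$ and all other $S^j(U)$ to $0$, for every $n\ge 1$. **Theorem.** 1. The $BV_\infty$-algebras that are free as graded commutative algebras form a category under pure $BV_\infty$-morphisms, with composition $\psi\diamond\varphi=\log(\exp(\psi)\circ\exp(\varphi))$ and identities $\varphi=\varphi_1=\mathrm{id}_U$. 2. For an $L_\infty$-algebra $\mathfrak g$, the operator $\Delta=\frac1\hbar\sum_{n\ge1}\hbar^nD_n$ (with $D_n$ transported along the double suspension $S(\mathfrak g[1])\cong S(\mathfrak g[-1])$) is a $BV_\infty$ operator on $S(\mathfrak g[-1])$. For an $L_\infty$-morphism $\Phi:S(\mathfrak g[1])\to S(\mathfrak g'[1])$, let $\varphi_n$ be the restriction to $S^n$ of the projection of $\Phi$ to $\mathfrak g'[1]$, transported in the same way and extended by $0$ to the other symmetric powers. Then $\mathfrak g\mapsto (S(\mathfrak g[-1]),\Delta)$,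 $\Phi\mapsto\frac1\hbar\sum_{n\ge1}\hbar^n\varphi_n$, is a functor from the category of $L_\infty$-algebras with $L_\infty$-morphisms to the category in 1. 3. This functor takes values in pure $BV_\infty$-algebras and is an equivalence from the category of $L_\infty$-algebras to the full subcategory of pure $BV_\infty$-algebras of the category in 1. 4. A weak inverse is the functor that takes a pure $BV_\infty$-algebra $(S(U),\Delta)$ to $U[1]$ with the $L_\infty$-structure whose brackets are the derived brackets $l_n(x_1,\dots,x_n)=[[\dots[\Delta_n,L_{x_1}],\dots],L_{x_n}]1$, $x_i\in U$, $n\ge 1$ (where $L_x$ is multiplication by $x$ and the brackets are graded commutators), and a pure $BV_\infty$-morphism $\varphi$ to the $L_\infty$-morphism whose projection to cogenerators has the components $\varphi_n:S^n(U)\to U'$, $n\ge 1$. -/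

import Mathlib

open CategoryTheory
open scoped TensorProduct PowerSeries Polynomial

universe u v

noncomputable section

namespace HomotopyBV

/-! ### Graded vector spaces -/

/-- A `ℤ`-graded vector space over `k`: a vector space that is the internal direct sum of its
homogeneous components `grading p`. -/
structure GradedSpace (k : Type u) [Field k] where
  carrier : Type v
  [addCommGroup : AddCommGroup carrier]
  [module : Module k carrier]
  grading : ℤ → Submodule k carrier
  isInternal : DirectSum.IsInternal grading

attribute [instance] GradedSpace.addCommGroup GradedSpace.module

/-- The Koszul sign `(-1)^(i * j)`. -/
def koszul (i j : ℤ) : ℤˣ := (i * j).negOnePow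

variable {k : Type u} [Field k]

namespace GradedSpace

/-- The translation `U[n]`, with `U[n]^p = U^(n + p)`. -/
def shift (U : GradedSpace.{u, v} k) (n : ℤ) : GradedSpace.{u, v} k where
  carrier := U.carrier
  grading p := U.grading (n + p)
  isInternal := by
    have h := (DirectSum.isInternal_submodule_iff_iSupIndep_and_iSup_eq_top _).1 U.isInternal
    refine (DirectSum.isInternal_submodule_iff_iSupIndep_and_iSup_eq_top _).2
      ⟨h.1.comp (add_right_injective n), ?_⟩
    rw [← h.2]
    exact (add_left_surjective n).iSup_comp (g := U.grading)

/-- The identity of `U`, viewed as a linear map `U → U[n]` (of degree `-n`). -/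
def susp (U : GradedSpace.{u, v} k) (n : ℤ) : U.carrier ≃ₗ[k] (U.shift n).carrier :=
  LinearEquiv.refl k U.carrier

theorem susp_mem (U : GradedSpace.{u, v} k) {n p q : ℤ} {x : U.carrier}
    (hx : x ∈ U.grading q) (h : q = n + p) : U.susp n x ∈ (U.shift n).grading p := by
  subst h
  exact hx

theorem susp_symm_mem (U : GradedSpace.{u, v} k) {n p : ℤ} {x : (U.shift n).carrier}
    (hx : x ∈ (U.shift n).grading p) : (U.susp n).symm x ∈ U.grading (n + p) := hx

/-- The linear map out of `U` given by its restrictions to the homogeneous components. -/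
def fromComponents (U : GradedSpace.{u, v} k) {M : Type*} [AddCommGroup M] [Module k M]
    (f : ∀ i : ℤ, U.grading i →ₗ[k] M) : U.carrier →ₗ[k] M :=
  (DirectSum.toModule k ℤ M f).comp
    (LinearEquiv.ofBijective (DirectSum.coeLinearMap U.grading) U.isInternal).symm.toLinearMap

theorem fromComponents_apply (U : GradedSpace.{u, v} k) {M : Type*} [AddCommGroup M]
    [Module k M] (f : ∀ i : ℤ, U.grading i →ₗ[k] M) {i : ℤ} {x : U.carrier}
    (hx : x ∈ U.grading i) : U.fromComponents f x = f i ⟨x, hx⟩ := by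
  have h : (LinearEquiv.ofBijective (DirectSum.coeLinearMap U.grading) U.isInternal).symm x
      = DirectSum.lof k ℤ (fun i => U.grading i) i ⟨x, hx⟩ := by
    rw [LinearEquiv.symm_apply_eq]
    exact (DirectSum.coeLinearMap_lof U.grading i ⟨x, hx⟩).symm
  simp [fromComponents, h]

/-- The sign operator on `U`: `x ↦ (-1)^|x| x`. -/
def sign (U : GradedSpace.{u, v} k) : U.carrier →ₗ[k] U.carrier :=
  U.fromComponents fun i => i.negOnePow • (U.grading i).subtype

theorem sign_apply (U : GradedSpace.{u, v} k) {i : ℤ} {x : U.carrier}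
    (hx : x ∈ U.grading i) : U.sign x = i.negOnePow • x := by
  simp [sign, U.fromComponents_apply _ hx]

end GradedSpace

/-! ### The free graded commutative algebra `S(U)` -/

/-- The relations `x y = (-1)^(|x| |y|) y x` for homogeneous `x, y` in `U`. -/
inductive GSymRel (U : GradedSpace.{u, v} k) :
    TensorAlgebra k U.carrier → TensorAlgebra k U.carrier → Prop
  | comm {i j : ℤ} {x y : U.carrier} (hx : x ∈ U.grading i) (hy : y ∈ U.grading j) :
      GSymRel U (TensorAlgebra.ι k x * TensorAlgebra.ι k y)
        (koszul i j • (TensorAlgebra.ι k y * TensorAlgebra.ι k x))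

/-- The graded symmetric algebra `S(U)`, the free graded commutative algebra on `U`. -/
def GSym (U : GradedSpace.{u, v} k) : Type (max u v) := RingQuot (GSymRel U)

namespace GSym

instance (U : GradedSpace.{u, v} k) : Ring (GSym U) := inferInstanceAs (Ring (RingQuot _))

instance (U : GradedSpace.{u, v} k) : Algebra k (GSym U) :=
  inferInstanceAs (Algebra k (RingQuot _))

section

variable (U : GradedSpace.{u, v} k)

/-- The inclusion `U = S^1(U) ⊆ S(U)`. -/
def ι : U.carrier →ₗ[k] GSym U :=
  (RingQuot.mkAlgHom k (GSymRel U)).toLinearMap.comp (TensorAlgebra.ι k)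

variable {U}

theorem ι_comm {i j : ℤ} {x y : U.carrier} (hx : x ∈ U.grading i) (hy : y ∈ U.grading j) :
    ι U x * ι U y = koszul i j • (ι U y * ι U x) := by
  have h := RingQuot.mkAlgHom_rel k (GSymRel.comm hx hy)
  rw [map_mul, Units.smul_def, map_zsmul, map_mul, ← Units.smul_def] at h
  exact h

/-- The universal property of `S(U)`. -/
def lift {A : Type*} [Ring A] [Algebra k A] (f : U.carrier →ₗ[k] A)
    (hf : ∀ (i j : ℤ) (x y : U.carrier), x ∈ U.grading i → y ∈ U.grading j →
      f x * f y = koszul i j • (f y * f x)) : GSym U →ₐ[k] A :=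
  RingQuot.liftAlgHom k ⟨TensorAlgebra.lift k f, by
    rintro _ _ ⟨hx, hy⟩
    simp only [map_mul, Units.smul_def, map_zsmul, TensorAlgebra.lift_ι_apply]
    simpa only [Units.smul_def] using hf _ _ _ _ hx hy⟩

@[simp]
theorem lift_ι {A : Type*} [Ring A] [Algebra k A] (f : U.carrier →ₗ[k] A)
    (hf : ∀ (i j : ℤ) (x y : U.carrier), x ∈ U.grading i → y ∈ U.grading j →
      f x * f y = koszul i j • (f y * f x)) (x : U.carrier) : lift f hf (ι U x) = f x := by
  change RingQuot.liftAlgHom k _ (RingQuot.mkAlgHom k (GSymRel U) (TensorAlgebra.ι k x)) = _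
  rw [RingQuot.liftAlgHom_mkAlgHom_apply, TensorAlgebra.lift_ι_apply]

theorem algHom_ext {A : Type*} [Ring A] [Algebra k A] {f g : GSym U →ₐ[k] A}
    (h : ∀ x, f (ι U x) = g (ι U x)) : f = g := by
  refine RingQuot.ringQuot_ext' k _ _ ?_
  exact TensorAlgebra.hom_ext (LinearMap.ext fun x => h x)

variable (U)

/-- The component of degree `p` of `S(U)`: it is spanned by the products `x₁ ⋯ xₘ` of homogeneous
elements of `U` with `|x₁| + ⋯ + |xₘ| = p`. -/
def deg (p : ℤ) : Submodule k (GSym U) :=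
  Submodule.span k {a | ∃ (m : ℕ) (x : Fin m → U.carrier) (d : Fin m → ℤ),
    (∀ i, x i ∈ U.grading (d i)) ∧ ∑ i, d i = p ∧
      a = (List.ofFn fun i => ι U (x i)).prod}

/-- The symmetric power `S^n(U) ⊆ S(U)`. -/
def symPow (n : ℕ) : Submodule k (GSym U) := LinearMap.range (ι U) ^ n

/-- The algebra morphism `S(U) → S(U)[t]` with `x ↦ t x` for `x` in `U`; the coefficient of `t^n`
is the component in `S^n(U)`. -/
def weight : GSym U →ₐ[k] (GSym U)[X] :=
  lift ((Polynomial.monomial (R := GSym U) 1).restrictScalars k ∘ₗ ι U) (by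
    intro i j x y hx hy
    simp [Polynomial.monomial_mul_monomial, ι_comm hx hy, Units.smul_def,
      Polynomial.smul_monomial])

/-- The projection of `S(U)` onto `S^n(U)`. -/
def proj (n : ℕ) : GSym U →ₗ[k] GSym U :=
  (Polynomial.lcoeff (GSym U) n).restrictScalars k ∘ₗ (weight U).toLinearMap

/-- The counit `ε : S(U) → k`, the algebra morphism that vanishes on `U`. -/
def counit : GSym U →ₐ[k] k := lift 0 (by simp)

/-- The sign operator `a ↦ (-1)^|a| a` on `S(U)`. -/
def sign : GSym U →ₐ[k] GSym U :=
  lift (ι U ∘ₗ U.sign) (by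
    intro i j x y hx hy
    simp only [LinearMap.comp_apply, U.sign_apply hx, U.sign_apply hy, Units.smul_def, map_zsmul,
      smul_mul_smul_comm, ι_comm hx hy, smul_smul]
    congr 1
    ring)

/-- `a ↦ (-1)^(i |a|) a` on `S(U)`. -/
def signPow (i : ℤ) : GSym U →ₐ[k] GSym U := if Even i then AlgHom.id k _ else sign U

/-- Left multiplication by `x ⊗ 1 + 1 ⊗ x`, for `x` in `U`, on the graded tensor product of `S(U)`
with itself: `a ⊗ b ↦ x a ⊗ b + (-1)^(|x| |a|) a ⊗ x b`. -/
def insertion : U.carrier →ₗ[k] Module.End k (GSym U ⊗[k] GSym U) :=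
  U.fromComponents fun i =>
    (((TensorProduct.mapBilinear (.id k) (GSym U) (GSym U) (GSym U) (GSym U)).flip LinearMap.id +
      TensorProduct.mapBilinear (.id k) (GSym U) (GSym U) (GSym U) (GSym U)
        (signPow U i).toLinearMap) ∘ₗ LinearMap.mul k (GSym U)) ∘ₗ ι U ∘ₗ (U.grading i).subtype

variable {U}

theorem insertion_tmul {i : ℤ} {x : U.carrier} (hx : x ∈ U.grading i) (a b : GSym U) :
    insertion U x (a ⊗ₜ b) = (ι U x * a) ⊗ₜ b + signPow U i a ⊗ₜ (ι U x * b) := by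
  simp [insertion, U.fromComponents_apply _ hx]

theorem signPow_ι (i : ℤ) {j : ℤ} {y : U.carrier} (hy : y ∈ U.grading j) :
    signPow U i (ι U y) = koszul i j • ι U y := by
  unfold signPow koszul
  split_ifs with h
  · simp [Int.negOnePow_even _ (h.mul_right j)]
  · have hi : i * j = j + (i - 1) * j := by ring
    have he : Even ((i - 1) * j) := by
      refine Even.mul_right ?_ j
      rw [Int.not_even_iff_odd] at h
      exact h.sub_odd odd_one
    rw [hi, Int.negOnePow_add, Int.negOnePow_even _ he, mul_one]
    simp [sign, U.sign_apply hy, Units.smul_def]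

theorem signPow_comm (i j : ℤ) (a : GSym U) :
    signPow U i (signPow U j a) = signPow U j (signPow U i a) := by
  unfold signPow
  split_ifs <;> rfl

theorem koszul_symm (i j : ℤ) : koszul j i = koszul i j := by
  rw [koszul, koszul, mul_comm]

variable (U)

/-- The operator by which an element of `S(U)` acts through the coproduct. -/
def insertionHom : GSym U →ₐ[k] Module.End k (GSym U ⊗[k] GSym U) :=
  lift (insertion U) (by
    intro i j x y hx hy
    refine TensorProduct.ext' fun a b => ?_
    simp only [Module.End.mul_apply, insertion_tmul hx, insertion_tmul hy, map_add, map_mul,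
      LinearMap.smul_apply, signPow_ι i hy, signPow_ι j hx, koszul_symm, smul_add]
    rw [← mul_assoc, ← mul_assoc, ← mul_assoc, ← mul_assoc, ι_comm hx hy, signPow_comm i j]
    rcases Int.units_eq_one_or (koszul i j) with h | h <;>
      simp only [h, one_smul, Units.neg_smul, neg_mul, TensorProduct.neg_tmul,
        TensorProduct.tmul_neg, neg_neg] <;> abel)

/-- The shuffle coproduct `δ : S(U) → S(U) ⊗ S(U)`: the algebra morphism to the graded tensor
product with `x ↦ x ⊗ 1 + 1 ⊗ x` for `x` in `U`. -/
def comul : GSym U →ₗ[k] GSym U ⊗[k] GSym U :=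
  LinearMap.applyₗ (1 ⊗ₜ 1) ∘ₗ (insertionHom U).toLinearMap

variable {U}

theorem comul_one : comul U 1 = 1 ⊗ₜ 1 := by
  simp [comul]

/-- The factor `x` of `x a` goes to the left or to the right in each term of `δ a`, in the latter
case past the left tensor factor; iterating this gives the shuffle formula. -/
theorem comul_ι_mul (x : U.carrier) (a : GSym U) :
    comul U (ι U x * a) = insertion U x (comul U a) := by
  simp [comul, insertionHom]

end

/-- A linear map `U → U'` that shifts degrees by even numbers induces an algebra morphism
`S(U) → S(U')`, because the signs only depend on the parity of the degrees. -/
def regrade {U U' : GradedSpace.{u, v} k} (f : U.carrier →ₗ[k] U'.carrier)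
    (hf : ∀ (i : ℤ) (x : U.carrier), x ∈ U.grading i →
      ∃ j, Even (i - j) ∧ f x ∈ U'.grading j) : GSym U →ₐ[k] GSym U' :=
  lift (ι U' ∘ₗ f) (by
    intro i j x y hx hy
    obtain ⟨i', hi, hx'⟩ := hf i x hx
    obtain ⟨j', hj, hy'⟩ := hf j y hy
    have h : koszul i j = koszul i' j' := by
      have he : i * j = i' * j' + ((i - i') * j + i' * (j - j')) := by ring
      rw [koszul, he, Int.negOnePow_add,
        Int.negOnePow_even _ ((hi.mul_right j).add (hj.mul_left i')), mul_one, koszul]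
    simpa [h] using ι_comm hx' hy')

/-- The double suspension `S(𝔤[1]) → S(𝔤[-1])`. -/
def toMinus (𝔤 : GradedSpace.{u, v} k) : GSym (𝔤.shift 1) →ₐ[k] GSym (𝔤.shift (-1)) :=
  regrade ((𝔤.susp (-1)).toLinearMap ∘ₗ (𝔤.susp 1).symm.toLinearMap) fun i _ hx =>
    ⟨i + 2, ⟨-1, by ring⟩, 𝔤.susp_mem (𝔤.susp_symm_mem hx) (by ring)⟩

/-- The inverse `S(𝔤[-1]) → S(𝔤[1])` of the double suspension. -/
def toPlus (𝔤 : GradedSpace.{u, v} k) : GSym (𝔤.shift (-1)) →ₐ[k] GSym (𝔤.shift 1) :=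
  regrade ((𝔤.susp 1).toLinearMap ∘ₗ (𝔤.susp (-1)).symm.toLinearMap) fun i _ hx =>
    ⟨i - 2, ⟨1, by ring⟩, 𝔤.susp_mem (𝔤.susp_symm_mem hx) (by ring)⟩

/-- The double suspension `S((U[1])[1]) = S(U[2]) → S(U)`. -/
def ofShiftTwo (U : GradedSpace.{u, v} k) : GSym ((U.shift 1).shift 1) →ₐ[k] GSym U :=
  regrade ((U.susp 1).symm.toLinearMap ∘ₗ ((U.shift 1).susp 1).symm.toLinearMap) fun i _ hx =>
    ⟨1 + (1 + i), ⟨-1, by ring⟩, U.susp_symm_mem ((U.shift 1).susp_symm_mem hx)⟩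

theorem toMinus_toPlus (𝔤 : GradedSpace.{u, v} k) (a : GSym (𝔤.shift (-1))) :
    toMinus 𝔤 (toPlus 𝔤 a) = a := by
  have h : (toMinus 𝔤).comp (toPlus 𝔤) = AlgHom.id k _ :=
    algHom_ext fun x => by simp [toMinus, toPlus, regrade]
  exact DFunLike.congr_fun h a

theorem toPlus_toMinus (𝔤 : GradedSpace.{u, v} k) (a : GSym (𝔤.shift 1)) :
    toPlus 𝔤 (toMinus 𝔤 a) = a := by
  have h : (toPlus 𝔤).comp (toMinus 𝔤) = AlgHom.id k _ :=
    algHom_ext fun x => by simp [toMinus, toPlus, regrade]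
  exact DFunLike.congr_fun h a

end GSym

/-- `f` is homogeneous of degree `d`. -/
def HasDegree {A B : Type*} [AddCommGroup A] [Module k A] [AddCommGroup B] [Module k B]
    (𝒜 : ℤ → Submodule k A) (ℬ : ℤ → Submodule k B) (d : ℤ) (f : A →ₗ[k] B) : Prop :=
  ∀ (p : ℤ) (a : A), a ∈ 𝒜 p → f a ∈ ℬ (p + d)

/-! ### `L∞`-algebras -/

/-- An `L∞`-algebra structure on a graded vector space `𝔤`: a coderivation of degree one of the
coalgebra `S(𝔤[1])` which squares to zero and vanishes on `1`. -/
structure LInftyStr (𝔤 : GradedSpace.{u, v} k) where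
  D : GSym (𝔤.shift 1) →ₗ[k] GSym (𝔤.shift 1)
  degree : HasDegree (GSym.deg (𝔤.shift 1)) (GSym.deg (𝔤.shift 1)) 1 D
  /-- `δ D = (D ⊗ 1 + 1 ⊗ D) δ`, with `(1 ⊗ D) (a ⊗ b) = (-1)^|a| a ⊗ D b`. -/
  coderivation : GSym.comul (𝔤.shift 1) ∘ₗ D =
    (TensorProduct.map D LinearMap.id +
      TensorProduct.map (GSym.sign (𝔤.shift 1)).toLinearMap D) ∘ₗ GSym.comul (𝔤.shift 1)
  square : D ∘ₗ D = 0
  map_one : D 1 = 0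

/-- An `L∞`-algebra. -/
structure LInfty (k : Type u) [Field k] where
  space : GradedSpace.{u, v} k
  str : LInftyStr space

namespace LInfty

/-- The coalgebra `S(𝔤[1])`. -/
abbrev Coalg (𝔤 : LInfty.{u, v} k) : Type (max u v) := GSym (𝔤.space.shift 1)

/-- An `L∞`-morphism `𝔤 → 𝔥`: a morphism of (counital) graded coalgebras `S(𝔤[1]) → S(𝔥[1])` that
commutes with the codifferentials and maps `1` to `1`. -/
@[ext]
structure Hom (𝔤 𝔥 : LInfty.{u, v} k) where
  toLin : 𝔤.Coalg →ₗ[k] 𝔥.Coalg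
  degree : HasDegree (GSym.deg (𝔤.space.shift 1)) (GSym.deg (𝔥.space.shift 1)) 0 toLin
  comul : GSym.comul (𝔥.space.shift 1) ∘ₗ toLin =
    TensorProduct.map toLin toLin ∘ₗ GSym.comul (𝔤.space.shift 1)
  counit : (GSym.counit (𝔥.space.shift 1)).toLinearMap ∘ₗ toLin =
    (GSym.counit (𝔤.space.shift 1)).toLinearMap
  map_one : toLin 1 = 1
  comm : toLin ∘ₗ 𝔤.str.D = 𝔥.str.D ∘ₗ toLin

/-- The identity `L∞`-morphism. -/
def Hom.id (𝔤 : LInfty.{u, v} k) : Hom 𝔤 𝔤 where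
  toLin := LinearMap.id
  degree p a ha := by simpa using ha
  comul := by simp
  counit := by simp
  map_one := rfl
  comm := by simp

/-- The composition of `L∞`-morphisms, which is the composition of coalgebra morphisms. -/
def Hom.comp {𝔤 𝔥 𝔨 : LInfty.{u, v} k} (Φ : Hom 𝔤 𝔥) (Ψ : Hom 𝔥 𝔨) : Hom 𝔤 𝔨 where
  toLin := Ψ.toLin ∘ₗ Φ.toLin
  degree p a ha := by
    have h := Ψ.degree _ _ (Φ.degree p a ha)
    rwa [add_zero] at h
  comul := by
    rw [← LinearMap.comp_assoc, Ψ.comul, LinearMap.comp_assoc, Φ.comul, ← LinearMap.comp_assoc,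
      TensorProduct.map_comp]
  counit := by rw [← LinearMap.comp_assoc, Ψ.counit, Φ.counit]
  map_one := by rw [LinearMap.comp_apply, Φ.map_one, Ψ.map_one]
  comm := by
    rw [LinearMap.comp_assoc, Φ.comm, ← LinearMap.comp_assoc, Ψ.comm, LinearMap.comp_assoc]

/-- The category of `L∞`-algebras and `L∞`-morphisms. -/
instance : Category (LInfty.{u, v} k) where
  Hom := Hom
  id := Hom.id
  comp := Hom.comp

end LInfty

/-! ### Differential operators -/

section DiffOp

variable {A B : Type*} [Ring A] [Algebra k A] [Ring B] [Algebra k B]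

/-- For an algebra morphism `f : A → B`, a linear map `D : A → B` of degree `d` and `a` in `A` of
degree `i`, the graded commutator `[D, L_a] : b ↦ D (a b) - (-1)^(d i) f(a) D(b)`. -/
def comm (f : A →ₐ[k] B) (d : ℤ) (D : A →ₗ[k] B) (i : ℤ) (a : A) : A →ₗ[k] B :=
  D ∘ₗ LinearMap.mulLeft k a - koszul d i • (LinearMap.mulLeft k (f a) ∘ₗ D)

/-- The iterated commutator `[…[[D, L_{a₁}], L_{a₂}], …, L_{aₙ}]`, for `D` of degree `d` and a list
of elements `aⱼ`, each preceded by its degree. -/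
def iterComm (f : A →ₐ[k] B) : ℤ → (A →ₗ[k] B) → List (ℤ × A) → (A →ₗ[k] B)
  | _, D, [] => D
  | d, D, (i, a) :: l => iterComm f (d + i) (comm f d D i a) l

/-- `D`, of degree `d`, is a differential operator of order `≤ n` over `f : A → B`. -/
def IsDiffOp (𝒜 : ℤ → Submodule k A) (f : A →ₐ[k] B) (d : ℤ) (n : ℕ) (D : A →ₗ[k] B) : Prop :=
  ∀ l : List (ℤ × A), l.length = n + 1 → (∀ e ∈ l, e.2 ∈ 𝒜 e.1) → iterComm f d D l = 0

end DiffOp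

/-! ### Formal power series in `ħ`

The variable `ħ`, of degree two, is the variable of Mathlib's `A⟦X⟧`. -/

section PowerSeries

variable {A B : Type*} [Ring A] [Algebra k A] [Ring B] [Algebra k B]

/-- The coefficient of `ħ^m` of a linear map `f : A → B[[ħ]]`. If
`f = ħ⁻¹ (ħ f₁ + ħ² f₂ + ⋯)`, then `hcoeff f m = f_{m+1}`. -/
def hcoeff (f : A →ₗ[k] B⟦X⟧) (m : ℕ) : A →ₗ[k] B :=
  (PowerSeries.coeff (R := B) m).restrictScalars k ∘ₗ f

/-- The linear map `A → B[[ħ]]` with given coefficients. -/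
def hmk (f : ℕ → A →ₗ[k] B) : A →ₗ[k] B⟦X⟧ where
  toFun a := PowerSeries.mk fun m => f m a
  map_add' a b := by ext m; simp
  map_smul' c a := by ext m; simp

/-- The continuous `k[[ħ]]`-linear extension `A[[ħ]] → B[[ħ]]` of a linear map `A → B[[ħ]]`. -/
def hExt (f : A →ₗ[k] B⟦X⟧) : A⟦X⟧ →ₗ[k] B⟦X⟧ where
  toFun a := PowerSeries.mk fun n =>
    ∑ p ∈ Finset.HasAntidiagonal.antidiagonal n, hcoeff f p.1 (PowerSeries.coeff p.2 a)
  map_add' a b := by ext m; simp [Finset.sum_add_distrib]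
  map_smul' c a := by ext m; simp [Finset.smul_sum]

end PowerSeries

/-! ### `BV∞`-algebras -/

/-- A `BV∞` operator `Δ = ħ⁻¹ (ħ Δ₁ + ħ² Δ₂ + ⋯)` on a graded algebra `A`: a linear map
`Δ : A → A[[ħ]]` of degree one (so that `Δ_{m+1}` has degree `1 - 2 m`) such that `Δₙ` is a
differential operator of order `≤ n`, `Δ² = 0` and `Δ(1) = 0`. -/
structure IsBVOperator {A : Type*} [Ring A] [Algebra k A] (𝒜 : ℤ → Submodule k A)
    (Δ : A →ₗ[k] A⟦X⟧) : Prop where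
  degree : ∀ m : ℕ, HasDegree 𝒜 𝒜 (1 - 2 * m) (hcoeff Δ m)
  order : ∀ m : ℕ, IsDiffOp 𝒜 (AlgHom.id k A) (1 - 2 * m) (m + 1) (hcoeff Δ m)
  square : hExt Δ ∘ₗ Δ = 0
  map_one : Δ 1 = 0

/-- A `BV∞`-algebra `(S(U), Δ)` which is free as a graded commutative algebra. -/
structure FreeBV (k : Type u) [Field k] where
  space : GradedSpace.{u, v} k
  op : GSym space →ₗ[k] (GSym space)⟦X⟧
  isBV : IsBVOperator (GSym.deg space) op

namespace FreeBV

/-- The underlying algebra `S(U)`. -/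
abbrev Alg (V : FreeBV.{u, v} k) : Type (max u v) := GSym V.space

/-- The `BV∞`-algebra `(S(U), Δ)` is pure: `Δₙ` maps `S^n(U)` to `U` and `S^m(U)` to `0` for
`m < n`, for all `n ≥ 1`. -/
def IsPure (V : FreeBV.{u, v} k) : Prop :=
  ∀ m : ℕ,
    (∀ a ∈ GSym.symPow V.space (m + 1), hcoeff V.op m a ∈ LinearMap.range (GSym.ι V.space)) ∧
    ∀ j < m + 1, ∀ a ∈ GSym.symPow V.space j, hcoeff V.op m a = 0

end FreeBV

/-! ### Exponential, logarithm and morphisms -/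

section Convolution

variable {U : GradedSpace.{u, v} k} {B : Type*} [Ring B] [Algebra k B]

/-- The convolution of `f, g : S(U) → B` of degree zero: `a ↦ ∑ f(a') g(a'')`, where
`δ a = ∑ a' ⊗ a''`. -/
def conv (f g : GSym U →ₗ[k] B) : GSym U →ₗ[k] B :=
  LinearMap.mul' k B ∘ₗ TensorProduct.map f g ∘ₗ GSym.comul U

/-- The convolution powers of `f`. -/
def convPow (f : GSym U →ₗ[k] B) : ℕ → (GSym U →ₗ[k] B)
  | 0 => Algebra.linearMap k B ∘ₗ (GSym.counit U).toLinearMap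
  | n + 1 => conv (convPow f n) f

/-- The linear map out of `S(U)` given by its values on the symmetric powers. -/
def ofWeights (f : ℕ → GSym U →ₗ[k] B) : GSym U →ₗ[k] B :=
  Polynomial.lsum f ∘ₗ (GSym.weight U).toLinearMap

/-- The exponential of `φ : S(U) → B` of degree zero with `φ(1) = 0`. On `x₁ ⋯ xₘ` with `xᵢ` in `U`
it is the sum over `k ≤ m` of `1 / k!` times the sum, over all ways to distribute the factors of
`x₁ ⋯ xₘ` to an ordered sequence of `k` nonempty blocks, of the products of the values of `φ` on the
blocks, with the Koszul signs. A distribution into blocks of sizes `i₁, …, iₖ` corresponds to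
`i₁! ⋯ iₖ!` permutations of the factors. The value at `1` is `1`. -/
def expMap (φ : GSym U →ₗ[k] B) : GSym U →ₗ[k] B :=
  ofWeights fun m => ∑ j ∈ Finset.range (m + 1), ((j.factorial : k)⁻¹) • convPow φ j

/-- The logarithm of `Φ : S(U) → B` of degree zero with `Φ(1) = 1`: as in the exponential, with
`(-1)^(k-1) / k` instead of `1 / k!`, and with the value `0` at `1`. Here `convPow Φ 0` has the
value `1` at `1` and vanishes on `S^m(U)` for `m ≥ 1`, so that its subtraction from `Φ` restricts
the sums to nonempty blocks. -/
def logMap (Φ : GSym U →ₗ[k] B) : GSym U →ₗ[k] B :=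
  ofWeights fun m => ∑ j ∈ Finset.range m,
    ((-1 : k) ^ j * ((j + 1 : ℕ) : k)⁻¹) • convPow (Φ - convPow Φ 0) (j + 1)

/-- The extension `μ (l ⊗ 1) δ` of `l : S(U) → U` to a coderivation of `S(U)`. -/
def coderivationExt (l : GSym U →ₗ[k] GSym U) : GSym U →ₗ[k] GSym U :=
  conv l LinearMap.id

end Convolution

/-- A `BV∞`-morphism from `(S(U), Δ)` to `(S(U'), Δ')`: a linear map `φ : S(U) → S(U')[[ħ]]`,
`φ = ħ⁻¹ (ħ φ₁ + ħ² φ₂ + ⋯)`, of degree zero (so that `φ_{m+1}` has degree `-2 m`), with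
`φ(1) = 0`, `exp(φ) Δ = Δ' exp(φ)`, and such that `φₙ` is a differential operator of order `≤ n` over
the algebra morphism `S(U) → S(U')` that is induced by the zero map `U → S(U')`. -/
structure IsBVMorphism (V W : FreeBV.{u, v} k) (φ : V.Alg →ₗ[k] W.Alg⟦X⟧) : Prop where
  degree : ∀ m : ℕ, HasDegree (GSym.deg V.space) (GSym.deg W.space) (-(2 * m)) (hcoeff φ m)
  map_one : φ 1 = 0
  comm : hExt (expMap φ) ∘ₗ V.op = hExt W.op ∘ₗ expMap φ
  order : ∀ m : ℕ, IsDiffOp (GSym.deg V.space)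
    (GSym.lift (0 : V.space.carrier →ₗ[k] W.Alg) (by simp)) (-(2 * m)) (m + 1) (hcoeff φ m)

/-- A pure `BV∞`-morphism: `φₙ` maps `S^n(U)` to `U'` and all other symmetric powers to `0`. -/
structure IsPureBVMorphism (V W : FreeBV.{u, v} k) (φ : V.Alg →ₗ[k] W.Alg⟦X⟧) : Prop
    extends IsBVMorphism V W φ where
  map_symPow : ∀ m : ℕ, ∀ a ∈ GSym.symPow V.space (m + 1),
    hcoeff φ m a ∈ LinearMap.range (GSym.ι W.space)
  map_symPow_of_ne : ∀ m j : ℕ, j ≠ m + 1 → ∀ a ∈ GSym.symPow V.space j, hcoeff φ m a = 0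

namespace FreeBV

/-- A pure `BV∞`-morphism. -/
@[ext]
structure Hom (V W : FreeBV.{u, v} k) where
  toLin : V.Alg →ₗ[k] W.Alg⟦X⟧
  isPure : IsPureBVMorphism V W toLin

/-- The composition `ψ ◇ φ = log (exp ψ ∘ exp φ)`. -/
def diamond {U U' U'' : GradedSpace.{u, v} k} (ψ : GSym U' →ₗ[k] (GSym U'')⟦X⟧)
    (φ : GSym U →ₗ[k] (GSym U')⟦X⟧) : GSym U →ₗ[k] (GSym U'')⟦X⟧ :=
  logMap (hExt (expMap ψ) ∘ₗ expMap φ)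

/-- The map `φ = φ₁ = id_U`: the projection `S(U) → U`. -/
def idMap (U : GradedSpace.{u, v} k) : GSym U →ₗ[k] (GSym U)⟦X⟧ :=
  hmk fun m => if m = 0 then GSym.proj U 1 else 0

end FreeBV

/-- The statement that the `BV∞`-algebras which are free as graded commutative algebras form a
category under the pure `BV∞`-morphisms, with the composition `ψ ◇ φ` and the identities `id_U`. -/
structure PureBVFormCategory (k : Type u) [Field k] : Prop where
  id_mem : ∀ V : FreeBV.{u, v} k, IsPureBVMorphism V V (FreeBV.idMap V.space)
  comp_mem : ∀ {V W Z : FreeBV.{u, v} k} (φ : FreeBV.Hom V W) (ψ : FreeBV.Hom W Z),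
    IsPureBVMorphism V Z (FreeBV.diamond ψ.toLin φ.toLin)
  id_comp : ∀ {V W : FreeBV.{u, v} k} (φ : FreeBV.Hom V W),
    FreeBV.diamond φ.toLin (FreeBV.idMap V.space) = φ.toLin
  comp_id : ∀ {V W : FreeBV.{u, v} k} (φ : FreeBV.Hom V W),
    FreeBV.diamond (FreeBV.idMap W.space) φ.toLin = φ.toLin
  assoc : ∀ {V W Z T : FreeBV.{u, v} k} (φ : FreeBV.Hom V W) (ψ : FreeBV.Hom W Z)
    (χ : FreeBV.Hom Z T),
    FreeBV.diamond χ.toLin (FreeBV.diamond ψ.toLin φ.toLin) =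
      FreeBV.diamond (FreeBV.diamond χ.toLin ψ.toLin) φ.toLin

/-- The category of `BV∞`-algebras that are free as graded commutative algebras, with the pure
`BV∞`-morphisms. -/
abbrev PureBVFormCategory.category (h : PureBVFormCategory.{u, v} k) :
    Category (FreeBV.{u, v} k) where
  Hom := FreeBV.Hom
  id V := ⟨FreeBV.idMap V.space, h.id_mem V⟩
  comp φ ψ := ⟨FreeBV.diamond ψ.toLin φ.toLin, h.comp_mem φ ψ⟩
  id_comp φ := FreeBV.Hom.ext (h.id_comp φ)
  comp_id φ := FreeBV.Hom.ext (h.comp_id φ)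
  assoc φ ψ χ := FreeBV.Hom.ext (h.assoc φ ψ χ)

/-! ### From `L∞`-algebras to `BV∞`-algebras -/

namespace LInfty

/-- The component `Dₙ` of the codifferential `D`: the extension as a coderivation of the component
`lₙ : S^n(𝔤[1]) → 𝔤[1]` of the projection of `D` to `𝔤[1]`. -/
def component (𝔤 : LInfty.{u, v} k) (n : ℕ) : 𝔤.Coalg →ₗ[k] 𝔤.Coalg :=
  coderivationExt (GSym.proj _ 1 ∘ₗ 𝔤.str.D ∘ₗ GSym.proj _ n)

/-- The Braun–Lazarev operator `Δ = ħ⁻¹ (ħ D₁ + ħ² D₂ + ⋯)` on `S(𝔤[-1])`. -/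
def bvOp (𝔤 : LInfty.{u, v} k) :
    GSym (𝔤.space.shift (-1)) →ₗ[k] (GSym (𝔤.space.shift (-1)))⟦X⟧ :=
  hmk fun m => (GSym.toMinus 𝔤.space).toLinearMap ∘ₗ 𝔤.component (m + 1) ∘ₗ
    (GSym.toPlus 𝔤.space).toLinearMap

/-- The map `φ_ħ = ħ⁻¹ (ħ φ₁ + ħ² φ₂ + ⋯)` of an `L∞`-morphism `Φ : S(𝔤[1]) → S(𝔥[1])`, where
`φₙ : S^n(𝔤[1]) → 𝔥[1]` is the component of the projection of `Φ` to `𝔥[1]`. -/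
def bvMap {𝔤 𝔥 : LInfty.{u, v} k} (Φ : 𝔤 ⟶ 𝔥) :
    GSym (𝔤.space.shift (-1)) →ₗ[k] (GSym (𝔥.space.shift (-1)))⟦X⟧ :=
  hmk fun m => (GSym.toMinus 𝔥.space).toLinearMap ∘ₗ
    (GSym.proj _ 1 ∘ₗ Hom.toLin Φ ∘ₗ GSym.proj _ (m + 1)) ∘ₗ
    (GSym.toPlus 𝔤.space).toLinearMap

end LInfty

/-- The statement that `𝔤 ↦ (S(𝔤[-1]), Δ)` and `Φ ↦ φ_ħ` define a functor from `L∞`-algebras with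
`L∞`-morphisms to free `BV∞`-algebras with pure `BV∞`-morphisms. -/
structure BVIsFunctorial (k : Type u) [Field k] : Prop where
  isBV : ∀ 𝔤 : LInfty.{u, v} k, IsBVOperator (GSym.deg (𝔤.space.shift (-1))) 𝔤.bvOp
  isPure_map : ∀ {𝔤 𝔥 : LInfty.{u, v} k} (Φ : 𝔤 ⟶ 𝔥),
    IsPureBVMorphism ⟨_, 𝔤.bvOp, isBV 𝔤⟩ ⟨_, 𝔥.bvOp, isBV 𝔥⟩ (LInfty.bvMap Φ)
  map_id : ∀ 𝔤 : LInfty.{u, v} k,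
    LInfty.bvMap (𝟙 𝔤) = FreeBV.idMap (𝔤.space.shift (-1))
  map_comp : ∀ {𝔤 𝔥 𝔨 : LInfty.{u, v} k} (Φ : 𝔤 ⟶ 𝔥) (Ψ : 𝔥 ⟶ 𝔨),
    LInfty.bvMap (Φ ≫ Ψ) = FreeBV.diamond (LInfty.bvMap Ψ) (LInfty.bvMap Φ)

/-- The functor `𝔤 ↦ (S(𝔤[-1]), Δ)`, `Φ ↦ φ_ħ`. -/
abbrev BVIsFunctorial.functor (h : BVIsFunctorial.{u, v} k) (hcat : PureBVFormCategory.{u, v} k) :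
    letI := hcat.category
    LInfty.{u, v} k ⥤ FreeBV.{u, v} k :=
  letI := hcat.category
  { obj := fun 𝔤 => ⟨𝔤.space.shift (-1), 𝔤.bvOp, h.isBV 𝔤⟩
    map := fun Φ => ⟨LInfty.bvMap Φ, h.isPure_map Φ⟩
    map_id := fun 𝔤 => FreeBV.Hom.ext (h.map_id 𝔤)
    map_comp := fun Φ Ψ => FreeBV.Hom.ext (h.map_comp Φ Ψ) }

/-! ### From pure `BV∞`-algebras to `L∞`-algebras -/

/-- The brackets `lₙ` of the `L∞`-structure `L` on `U[1]` are the restrictions to `U` of the derived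
brackets `[…[[Δₙ, L_{x₁}], L_{x₂}], …, L_{xₙ}] 1` of the `BV∞`-algebra `(S(U), Δ)`, for all
`n ≥ 1`. -/
def IsDerived (V : FreeBV.{u, v} k) (L : LInftyStr (V.space.shift 1)) : Prop :=
  ∀ (m : ℕ) (x : Fin (m + 1) → V.space.carrier) (d : Fin (m + 1) → ℤ),
    (∀ i, x i ∈ V.space.grading (d i)) →
    GSym.ofShiftTwo V.space (GSym.proj _ 1 (L.D (List.ofFn fun i =>
        GSym.ι _ ((V.space.shift 1).susp 1 (V.space.susp 1 (x i)))).prod)) =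
      iterComm (AlgHom.id k V.Alg) (1 - 2 * m) (hcoeff V.op m)
        (List.ofFn fun i => (d i, GSym.ι V.space (x i))) 1

/-- The `L∞`-morphism `Φ` is the one whose projection to cogenerators has the components
`φₙ : S^n(U) → U'`, for `n ≥ 1`. -/
def IsInducedBy {V W : FreeBV.{u, v} k} {L : LInftyStr (V.space.shift 1)}
    {M : LInftyStr (W.space.shift 1)} (φ : FreeBV.Hom V W)
    (Φ : LInfty.Hom ⟨V.space.shift 1, L⟩ ⟨W.space.shift 1, M⟩) : Prop :=
  ∀ (m : ℕ), ∀ a ∈ GSym.symPow ((V.space.shift 1).shift 1) (m + 1),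
    GSym.ofShiftTwo W.space (GSym.proj _ 1 (Φ.toLin a)) =
      hcoeff φ.toLin m (GSym.ofShiftTwo V.space a)

end HomotopyBV

end

open HomotopyBV

noncomputable section

namespace HomotopyBV

/-! ### Signs -/

/-! The bookkeeping of the powers of `ħ` is a change of gauge. For a linear map `T : S(U) → S(U')`
that does not raise the weight, `twist T` multiplies the component `S^n(U) → S^j(U')` by `ħ^(n-j)`;
formally this is conjugation by `ħ^weight`. Weights add under products and coproducts, so `twist` is
compatible with composition (`hExt_twist_comp_twist`) and with convolution (`conv_twist`), hence
with `expMap` (`expMap_twist`). It is injective on maps that do not raise the weight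
(`twist_injective`). Since `ħ` has degree two, the twist has degree `d` exactly when `T` has degree
`d` with `U` regraded as `U[2]` (`shiftedDeg`). This is where the passage between `𝔤[1]` and `𝔤[-1]`
comes from.

A pure morphism is the twist of one map `f : S(U) → U'`, because the components `φₙ` live on
different symmetric powers. So its exponential is the twist of `expMap f`, the unique coalgebra
morphism with projection `f` to the cogenerators (`IsCogen.isCoalgHom_expMap`, `IsCoalgHom.ext`).
With `logMap_expMap`, the composition `◇` becomes the composition of coalgebra morphisms
(`diamond_twist`), and the category axioms follow.

A differential operator of order `≤ n` is determined by its values on `S^j(U)` with `j ≤ n`. Purity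
leaves only the component `S^n(U) → U` of `Δₙ`, so `Δₙ` is the extension of this component as a
coderivation, and `Δ` is the twist of a single coderivation `D`; by injectivity `Δ² = 0` means `D² =
0`. Pure `BV∞`-algebras are thus codifferentials on `S(U)`, and their pure morphisms are the
coalgebra morphisms that commute with them. Up to the even regradings `S(𝔤[1]) ≅ S(𝔤[-1])` and
`S(U[2]) ≅ S(U)`, which do not affect signs, these are `L∞`-algebras and `L∞`-morphisms. The derived
brackets recover the components of `D` because a commutator with `L_x` turns the extension of `l`
into the extension of `a ↦ l(x a)` (`comm_conv_id`). -/

theorem koszul_add_left (i j l : ℤ) : koszul (i + j) l = koszul i l * koszul j l := by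
  rw [koszul, add_mul, Int.negOnePow_add, koszul, koszul]

theorem koszul_add_right (i j l : ℤ) : koszul i (j + l) = koszul i j * koszul i l := by
  rw [koszul, mul_add, Int.negOnePow_add, koszul, koszul]

@[simp]
theorem koszul_zero_left (i : ℤ) : koszul 0 i = 1 := by simp [koszul]

@[simp]
theorem koszul_zero_right (i : ℤ) : koszul i 0 = 1 := by simp [koszul]

theorem koszul_of_even_left {i : ℤ} (h : Even i) (j : ℤ) : koszul i j = 1 :=
  Int.negOnePow_even _ (h.mul_right j)

theorem koszul_of_odd_left {i : ℤ} (h : Odd i) (j : ℤ) : koszul i j = j.negOnePow := by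
  obtain ⟨m, rfl⟩ := h
  rw [koszul_add_left, koszul_of_even_left (even_two_mul m), koszul, one_mul, one_mul]

section Units

variable {k : Type u} [Field k] {M N : Type*} [AddCommGroup M] [Module k M] [AddCommGroup N]
  [Module k N]

theorem map_units_smul (f : M →ₗ[k] N) (e : ℤˣ) (x : M) : f (e • x) = e • f x := by
  rw [Units.smul_def, map_zsmul, ← Units.smul_def]

theorem Submodule.units_smul_mem (P : Submodule k M) (e : ℤˣ) {x : M} (hx : x ∈ P) :
    e • x ∈ P := by
  rw [Units.smul_def]
  exact zsmul_mem hx _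

end Units

variable {k : Type u} [Field k]

theorem GradedSpace.induction_homogeneous (U : GradedSpace.{u, v} k) {P : U.carrier → Prop}
    (x : U.carrier) (hom : ∀ i, ∀ y ∈ U.grading i, P y) (zero : P 0)
    (add : ∀ y z, P y → P z → P (y + z)) : P x := by
  have h := (DirectSum.isInternal_submodule_iff_iSupIndep_and_iSup_eq_top _).1 U.isInternal
  have hx : x ∈ ⨆ i, U.grading i := by rw [h.2]; trivial
  exact Submodule.iSup_induction _ (motive := P) hx hom zero add

namespace GSym

/-! ### Monomials -/

/-- The products of `n` homogeneous elements of `U` with degrees of sum `p`. -/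
inductive IsMonomial (U : GradedSpace.{u, v} k) : ℕ → ℤ → GSym U → Prop
  | one : IsMonomial U 0 0 1
  | cons {n : ℕ} {i p : ℤ} {x : U.carrier} {a : GSym U} (hx : x ∈ U.grading i)
      (ha : IsMonomial U n p a) : IsMonomial U (n + 1) (i + p) (ι U x * a)

section

variable {U : GradedSpace.{u, v} k}

theorem IsMonomial.ι {i : ℤ} {x : U.carrier} (hx : x ∈ U.grading i) :
    IsMonomial U 1 i (ι U x) := by
  simpa using IsMonomial.cons hx IsMonomial.one

theorem IsMonomial.mul {m n : ℕ} {p q : ℤ} {a b : GSym U} (ha : IsMonomial U m p a)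
    (hb : IsMonomial U n q b) : IsMonomial U (m + n) (p + q) (a * b) := by
  induction ha with
  | one => simpa using hb
  | cons hx _ ih =>
    rw [mul_assoc, add_right_comm, add_assoc (_ : ℤ)]
    exact .cons hx ih

/-- The span contains `1` and is stable under left multiplication by `U`, hence by the image of the
whole tensor algebra, which is all of `S(U)`. -/
theorem span_isMonomial : Submodule.span k {a | ∃ n p, IsMonomial U n p a} = ⊤ := by
  set W := Submodule.span k {a | ∃ n p, IsMonomial U n p a} with hW
  have hι : ∀ x, ∀ w ∈ W, ι U x * w ∈ W := by
    intro x w hw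
    induction x using U.induction_homogeneous with
    | hom i y hy =>
      induction hw using Submodule.span_induction with
      | mem a ha =>
        obtain ⟨n, p, ha⟩ := ha
        exact Submodule.subset_span ⟨_, _, .cons hy ha⟩
      | zero => simp
      | add a b _ _ ha hb => rw [mul_add]; exact W.add_mem ha hb
      | smul c a _ ha => rw [mul_smul_comm]; exact W.smul_mem c ha
    | zero => simp
    | add y z hy hz => rw [map_add, add_mul]; exact W.add_mem hy hz
  let π : TensorAlgebra k U.carrier →ₐ[k] GSym U := RingQuot.mkAlgHom k (GSymRel U)
  have key : ∀ t, ∀ w ∈ W, π t * w ∈ W := by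
    intro t
    induction t using TensorAlgebra.induction with
    | algebraMap r =>
      intro w hw
      rw [AlgHom.commutes, ← Algebra.smul_def]
      exact W.smul_mem r hw
    | ι x => exact hι x
    | mul a b ha hb =>
      intro w hw
      rw [map_mul, mul_assoc]
      exact ha _ (hb w hw)
    | add a b ha hb =>
      intro w hw
      rw [map_add, add_mul]
      exact W.add_mem (ha w hw) (hb w hw)
  rw [eq_top_iff]
  rintro a -
  obtain ⟨t, rfl⟩ := RingQuot.mkAlgHom_surjective k (GSymRel U) a
  have h := key t 1 (Submodule.subset_span ⟨0, 0, .one⟩)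
  rw [mul_one] at h
  exact h

theorem induction_monomial {P : GSym U → Prop} (a : GSym U)
    (mono : ∀ n p b, IsMonomial U n p b → P b) (zero : P 0)
    (add : ∀ b c, P b → P c → P (b + c)) (smul : ∀ (r : k) b, P b → P (r • b)) : P a := by
  have ha : a ∈ Submodule.span k {a | ∃ n p, IsMonomial U n p a} := by
    rw [span_isMonomial]; trivial
  induction ha using Submodule.span_induction with
  | mem a ha => obtain ⟨n, p, ha⟩ := ha; exact mono n p a ha
  | zero => exact zero
  | add a b _ _ ha hb => exact add a b ha hb
  | smul c a _ ha => exact smul c a ha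

theorem linearMap_ext {M : Type*} [AddCommGroup M] [Module k M] {f g : GSym U →ₗ[k] M}
    (h : ∀ n p a, IsMonomial U n p a → f a = g a) : f = g := by
  ext a
  induction a using induction_monomial with
  | mono n p b hb => exact h n p b hb
  | zero => simp
  | add b c hb hc => simp [hb, hc]
  | smul r b hb => simp [hb]

theorem weight_of_isMonomial {n : ℕ} {p : ℤ} {a : GSym U} (ha : IsMonomial U n p a) :
    weight U a = Polynomial.monomial n a := by
  induction ha with
  | one => simp [Polynomial.monomial_zero_left]
  | cons hx _ ih =>
    rw [map_mul, ih]
    simp [weight, Polynomial.monomial_mul_monomial, add_comm 1]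

theorem proj_of_isMonomial {n : ℕ} {p : ℤ} {a : GSym U} (ha : IsMonomial U n p a) (j : ℕ) :
    proj U j a = if j = n then a else 0 := by
  simp [proj, weight_of_isMonomial ha, Polynomial.coeff_monomial, eq_comm]

theorem ofWeights_of_isMonomial {B : Type*} [Ring B] [Algebra k B] (f : ℕ → GSym U →ₗ[k] B)
    {n : ℕ} {p : ℤ} {a : GSym U} (ha : IsMonomial U n p a) : ofWeights f a = f n a := by
  simp [ofWeights, weight_of_isMonomial ha, Polynomial.sum_monomial_index]

theorem sign_of_isMonomial {n : ℕ} {p : ℤ} {a : GSym U} (ha : IsMonomial U n p a) :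
    sign U a = p.negOnePow • a := by
  induction ha with
  | one => simp
  | cons hx _ ih =>
    rw [map_mul, ih, Int.negOnePow_add, sign, lift_ι, LinearMap.comp_apply, U.sign_apply hx,
      map_units_smul, smul_mul_assoc, mul_smul_comm, smul_smul]

theorem signPow_of_isMonomial (i : ℤ) {n : ℕ} {p : ℤ} {a : GSym U} (ha : IsMonomial U n p a) :
    signPow U i a = koszul i p • a := by
  unfold signPow
  split_ifs with h
  · simp [koszul_of_even_left h]
  · rw [koszul_of_odd_left (Int.not_even_iff_odd.1 h), sign_of_isMonomial ha]

theorem counit_of_isMonomial {n : ℕ} {p : ℤ} {a : GSym U} (ha : IsMonomial U (n + 1) p a) :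
    counit U a = 0 := by
  cases ha
  simp [counit]

@[simp]
theorem signPow_signPow (i : ℤ) (a : GSym U) : signPow U i (signPow U i a) = a := by
  induction a using induction_monomial with
  | mono n p b hb =>
    rcases Int.units_eq_one_or (koszul i p) with h | h <;>
      simp [signPow_of_isMonomial i hb, h]
  | zero => simp
  | add b c hb hc => simp [hb, hc]
  | smul r b hb => simp [hb]

theorem signPow_add (i j : ℤ) (a : GSym U) :
    signPow U (i + j) a = signPow U i (signPow U j a) := by
  induction a using induction_monomial with
  | mono n p b hb =>
    simp only [signPow_of_isMonomial _ hb, koszul_add_left, mul_smul, Units.smul_def, map_zsmul]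
    rw [smul_comm]
  | zero => simp
  | add b c hb hc => simp [hb, hc]
  | smul r b hb => simp [hb]

@[simp]
theorem signPow_zero (a : GSym U) : signPow U 0 a = a := by simp [signPow]

theorem isMonomial_prod_ofFn {n : ℕ} {x : Fin n → U.carrier} {d : Fin n → ℤ}
    (hx : ∀ i, x i ∈ U.grading (d i)) :
    IsMonomial U n (∑ i, d i) (List.ofFn fun i => ι U (x i)).prod := by
  induction n with
  | zero => simpa using IsMonomial.one
  | succ n ih =>
    rw [Fin.sum_univ_succ, List.ofFn_succ, List.prod_cons]
    exact .cons (hx 0) (ih fun i => hx i.succ)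

theorem deg_eq_span (p : ℤ) :
    deg U p = Submodule.span k {a | ∃ n, IsMonomial U n p a} := by
  unfold deg
  congr 1
  ext a
  constructor
  · rintro ⟨m, x, d, hx, rfl, rfl⟩
    exact ⟨m, isMonomial_prod_ofFn hx⟩
  · rintro ⟨n, ha⟩
    refine ⟨n, ?_⟩
    induction ha with
    | one => exact ⟨Fin.elim0, Fin.elim0, fun i => i.elim0, by simp, by simp⟩
    | @cons n i p x a hx _ ih =>
      obtain ⟨y, d, hy, rfl, rfl⟩ := ih
      refine ⟨Fin.cons x y, Fin.cons i d, fun j => ?_, by simp [Fin.sum_univ_succ],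
        by simp [List.ofFn_succ]⟩
      refine Fin.cases ?_ (fun j => ?_) j
      · simpa using hx
      · simpa using hy j

theorem IsMonomial.mem_deg {n : ℕ} {p : ℤ} {a : GSym U} (ha : IsMonomial U n p a) :
    a ∈ deg U p := by
  rw [deg_eq_span]
  exact Submodule.subset_span ⟨n, ha⟩

theorem symPow_eq_span (n : ℕ) :
    symPow U n = Submodule.span k {a | ∃ p, IsMonomial U n p a} := by
  apply le_antisymm
  · induction n with
    | zero =>
      rw [symPow, pow_zero, Submodule.one_eq_span]
      exact Submodule.span_mono (by rintro _ rfl; exact ⟨0, .one⟩)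
    | succ n ih =>
      rw [symPow, pow_succ']
      refine Submodule.mul_le.2 ?_
      rintro _ ⟨x, rfl⟩ b hb
      replace hb := ih hb
      clear ih
      induction x using U.induction_homogeneous with
      | hom i y hy =>
        induction hb using Submodule.span_induction with
        | mem a ha =>
          obtain ⟨p, ha⟩ := ha
          exact Submodule.subset_span ⟨_, .cons hy ha⟩
        | zero => simp
        | add a b _ _ ha hb => rw [mul_add]; exact Submodule.add_mem _ ha hb
        | smul c a _ ha => rw [mul_smul_comm]; exact Submodule.smul_mem _ c ha
      | zero => simp
      | add y z hy hz => rw [map_add, add_mul]; exact Submodule.add_mem _ hy hz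
  · refine Submodule.span_le.2 ?_
    rintro a ⟨p, ha⟩
    induction ha with
    | one => exact Submodule.one_le.1 (by simp [symPow])
    | cons hx _ ih =>
      rw [SetLike.mem_coe, symPow, pow_succ']
      exact Submodule.mul_mem_mul ⟨_, rfl⟩ ih

theorem IsMonomial.mem_symPow {n : ℕ} {p : ℤ} {a : GSym U} (ha : IsMonomial U n p a) :
    a ∈ symPow U n := by
  rw [symPow_eq_span]
  exact Submodule.subset_span ⟨p, ha⟩

theorem symPow_one : symPow U 1 = LinearMap.range (GSym.ι U) := pow_one _

theorem proj_of_mem_symPow {n : ℕ} {a : GSym U} (ha : a ∈ symPow U n) (j : ℕ) :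
    proj U j a = if j = n then a else 0 := by
  rw [symPow_eq_span] at ha
  induction ha using Submodule.span_induction with
  | mem a ha => obtain ⟨p, ha⟩ := ha; exact proj_of_isMonomial ha j
  | zero => simp
  | add a b _ _ ha hb => rw [map_add, ha, hb]; split_ifs <;> simp
  | smul c a _ ha => rw [map_smul, ha]; split_ifs <;> simp

theorem proj_mem_symPow (j : ℕ) (a : GSym U) : proj U j a ∈ symPow U j := by
  induction a using induction_monomial with
  | mono n p b hb =>
    rw [proj_of_isMonomial hb]
    split_ifs with h
    · exact h ▸ hb.mem_symPow
    · exact zero_mem _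
  | zero => simp
  | add b c hb hc => rw [map_add]; exact add_mem hb hc
  | smul r b hb => rw [map_smul]; exact Submodule.smul_mem _ r hb

theorem proj_proj (i j : ℕ) (a : GSym U) :
    proj U i (proj U j a) = if i = j then proj U j a else 0 :=
  proj_of_mem_symPow (proj_mem_symPow j a) i

theorem exists_sum_proj (a : GSym U) :
    ∃ N, ∀ M ≥ N, a = ∑ j ∈ Finset.range M, proj U j a := by
  induction a using induction_monomial with
  | mono n p b hb =>
    refine ⟨n + 1, fun M hM => ?_⟩
    simp [proj_of_isMonomial hb, Finset.sum_ite_eq', Nat.lt_of_succ_le hM]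
  | zero => exact ⟨0, by simp⟩
  | add b c hb hc =>
    obtain ⟨N, hN⟩ := hb
    obtain ⟨N', hN'⟩ := hc
    refine ⟨max N N', fun M hM => ?_⟩
    simp only [map_add, Finset.sum_add_distrib]
    rw [← hN M (le_trans (le_max_left _ _) hM), ← hN' M (le_trans (le_max_right _ _) hM)]
  | smul r b hb =>
    obtain ⟨N, hN⟩ := hb
    refine ⟨N, fun M hM => ?_⟩
    simp only [map_smul]
    rw [← Finset.smul_sum, ← hN M hM]

theorem eq_of_proj_eq {a b : GSym U} (h : ∀ j, proj U j a = proj U j b) : a = b := by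
  obtain ⟨N, hN⟩ := exists_sum_proj a
  obtain ⟨N', hN'⟩ := exists_sum_proj b
  rw [hN _ (le_max_left N N'), hN' _ (le_max_right N N')]
  exact Finset.sum_congr rfl fun j _ => h j

theorem proj_zero_apply (a : GSym U) : proj U 0 a = algebraMap k _ (counit U a) := by
  induction a using induction_monomial with
  | mono n p b hb =>
    rw [proj_of_isMonomial hb]
    cases n with
    | zero => cases hb; simp
    | succ n => simp [counit_of_isMonomial hb]
  | zero => simp
  | add b c hb hc => simp [hb, hc]
  | smul r b hb => rw [map_smul, map_smul, hb, smul_eq_mul, map_mul, Algebra.smul_def]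

theorem mul_mem_symPow {m n : ℕ} {a b : GSym U} (ha : a ∈ symPow U m) (hb : b ∈ symPow U n) :
    a * b ∈ symPow U (m + n) := by
  rw [symPow, pow_add]
  exact Submodule.mul_mem_mul ha hb

/-- Moving a homogeneous element of `U` past an element of `S(U)`. -/
theorem ι_mul_comm {i : ℤ} {x : U.carrier} (hx : x ∈ U.grading i) (a : GSym U) :
    ι U x * a = signPow U i a * ι U x := by
  induction a using induction_monomial with
  | mono n p b hb =>
    induction hb with
    | one => simp
    | cons hy _ ih =>
      rw [map_mul, signPow_ι i hy, ← mul_assoc, ι_comm hx hy, mul_assoc (_ • _), ← ih,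
        smul_mul_assoc, smul_mul_assoc, mul_assoc]
  | zero => simp
  | add b c hb hc => simp [hb, hc, mul_add, add_mul]
  | smul r b hb => simp [hb]

end

/-! ### Convolution with respect to a bilinear map -/

section Convolution

variable {U U' : GradedSpace.{u, v} k}
variable {M N P : Type*} [AddCommGroup M] [Module k M] [AddCommGroup N] [Module k N]
  [AddCommGroup P] [Module k P]

/-- The map `a ↦ ∑ β(f(a'), g(a''))`, where `δ a = ∑ a' ⊗ a''`. -/
def gconv (β : M →ₗ[k] N →ₗ[k] P) (f : GSym U →ₗ[k] M) (g : GSym U →ₗ[k] N) :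
    GSym U →ₗ[k] P :=
  TensorProduct.lift (β.compl₁₂ f g) ∘ₗ comul U

/-- The map `a ↦ f(x a)`. -/
def compMul (f : GSym U →ₗ[k] M) (x : U.carrier) : GSym U →ₗ[k] M :=
  f ∘ₗ LinearMap.mulLeft k (ι U x)

@[simp]
theorem compMul_apply (f : GSym U →ₗ[k] M) (x : U.carrier) (a : GSym U) :
    compMul f x a = f (ι U x * a) := rfl

/-- The map `a ↦ f((-1)^(i |a|) a)`. -/
def compSign (f : GSym U →ₗ[k] M) (i : ℤ) : GSym U →ₗ[k] M :=
  f ∘ₗ (signPow U i).toLinearMap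

@[simp]
theorem compSign_apply (f : GSym U →ₗ[k] M) (i : ℤ) (a : GSym U) :
    compSign f i a = f (signPow U i a) := rfl

@[simp]
theorem gconv_one (β : M →ₗ[k] N →ₗ[k] P) (f : GSym U →ₗ[k] M) (g : GSym U →ₗ[k] N) :
    gconv β f g 1 = β (f 1) (g 1) := by
  simp [gconv, comul_one]

/-- The Leibniz rule on which the inductions over monomials rest: the first factor goes to one of
the two arguments, past the left block in the second case. Thus `compMul · x` acts as a graded
derivation of convolution. -/
theorem gconv_ι_mul (β : M →ₗ[k] N →ₗ[k] P) (f : GSym U →ₗ[k] M) (g : GSym U →ₗ[k] N) {i : ℤ}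
    {x : U.carrier} (hx : x ∈ U.grading i) (a : GSym U) :
    gconv β f g (ι U x * a) =
      gconv β (compMul f x) g a + gconv β (compSign f i) (compMul g x) a := by
  simp only [gconv, LinearMap.comp_apply, comul_ι_mul]
  induction comul U a using TensorProduct.induction_on with
  | zero => simp
  | tmul b c => simp [insertion_tmul hx]
  | add s t hs ht => simp only [map_add, hs, ht]; abel

theorem units_smul_tmul (e : ℤˣ) (m : M) (n : N) : (e • m) ⊗ₜ[k] n = e • m ⊗ₜ[k] n := by
  rcases Int.units_eq_one_or e with rfl | rfl <;> simp [TensorProduct.neg_tmul]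

/-- The coproduct preserves weight and degree. This is the form in which Sweedler notation is used:
a statement about `∑ a' ⊗ a''` is checked on tensors of monomials whose weights and degrees add up.
-/
theorem comul_mem_span {n : ℕ} {p : ℤ} {a : GSym U} (ha : IsMonomial U n p a) :
    comul U a ∈ Submodule.span k {t | ∃ n₁ n₂ p₁ p₂ b c, n₁ + n₂ = n ∧ p₁ + p₂ = p ∧
      IsMonomial U n₁ p₁ b ∧ IsMonomial U n₂ p₂ c ∧ t = b ⊗ₜ[k] c} := by
  induction ha with
  | one =>
    rw [comul_one]
    exact Submodule.subset_span ⟨0, 0, 0, 0, 1, 1, rfl, rfl, .one, .one, rfl⟩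
  | @cons n i p x a hx _ ih =>
    rw [comul_ι_mul]
    generalize comul U a = t at ih ⊢
    induction ih using Submodule.span_induction with
    | mem t ht =>
      obtain ⟨n₁, n₂, p₁, p₂, b, c, rfl, rfl, hb, hc, rfl⟩ := ht
      rw [insertion_tmul hx, signPow_of_isMonomial i hb, units_smul_tmul]
      refine add_mem ?_ (Submodule.units_smul_mem _ _ ?_)
      · exact Submodule.subset_span ⟨n₁ + 1, n₂, i + p₁, p₂, _, _, by omega, by omega,
          .cons hx hb, hc, rfl⟩
      · exact Submodule.subset_span ⟨n₁, n₂ + 1, p₁, i + p₂, _, _, by omega, by omega,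
          hb, .cons hx hc, rfl⟩
    | zero => simp
    | add s t _ _ hs ht => rw [map_add]; exact add_mem hs ht
    | smul r t _ ht => rw [map_smul]; exact Submodule.smul_mem _ r ht

theorem gconv_mem {β : M →ₗ[k] N →ₗ[k] P} {f : GSym U →ₗ[k] M} {g : GSym U →ₗ[k] N}
    (Q : Submodule k P) {n : ℕ} {p : ℤ} {a : GSym U} (ha : IsMonomial U n p a)
    (h : ∀ n₁ n₂ p₁ p₂ b c, n₁ + n₂ = n → p₁ + p₂ = p → IsMonomial U n₁ p₁ b →
      IsMonomial U n₂ p₂ c → β (f b) (g c) ∈ Q) : gconv β f g a ∈ Q := by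
  have key := comul_mem_span ha
  rw [gconv, LinearMap.comp_apply]
  generalize comul U a = t at key ⊢
  induction key using Submodule.span_induction with
  | mem t ht =>
    obtain ⟨n₁, n₂, p₁, p₂, b, c, hn, hp, hb, hc, rfl⟩ := ht
    simpa using h n₁ n₂ p₁ p₂ b c hn hp hb hc
  | zero => simp
  | add s t _ _ hs ht => rw [map_add]; exact add_mem hs ht
  | smul r t _ ht => rw [map_smul]; exact Submodule.smul_mem _ r ht

/-- The comparison principle for convolutions. The bounds on the weights allow inductive hypotheses
that only hold in low weight. -/
theorem gconv_congr_map {M' N' P' : Type*} [AddCommGroup M'] [Module k M'] [AddCommGroup N']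
    [Module k N'] [AddCommGroup P'] [Module k P'] {β : M →ₗ[k] N →ₗ[k] P} {f : GSym U →ₗ[k] M}
    {g : GSym U →ₗ[k] N} {β' : M' →ₗ[k] N' →ₗ[k] P'} {f' : GSym U →ₗ[k] M'} {g' : GSym U →ₗ[k] N'}
    (T : P' →ₗ[k] P) {n : ℕ} {p : ℤ} {a : GSym U} (ha : IsMonomial U n p a)
    (h : ∀ n₁ n₂ p₁ p₂ b c, n₁ + n₂ = n → p₁ + p₂ = p → IsMonomial U n₁ p₁ b →
      IsMonomial U n₂ p₂ c → β (f b) (g c) = T (β' (f' b) (g' c))) :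
    gconv β f g a = T (gconv β' f' g' a) := by
  have key := comul_mem_span ha
  simp only [gconv, LinearMap.comp_apply]
  generalize comul U a = t at key ⊢
  induction key using Submodule.span_induction with
  | mem t ht =>
    obtain ⟨n₁, n₂, p₁, p₂, b, c, hn, hp, hb, hc, rfl⟩ := ht
    simpa using h n₁ n₂ p₁ p₂ b c hn hp hb hc
  | zero => simp
  | add s t _ _ hs ht => simp [hs, ht]
  | smul r t _ ht => simp [ht]

theorem gconv_congr {β : M →ₗ[k] N →ₗ[k] P} {f f' : GSym U →ₗ[k] M} {g g' : GSym U →ₗ[k] N}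
    {n : ℕ} {p : ℤ} {a : GSym U} (ha : IsMonomial U n p a)
    (h : ∀ n₁ n₂ p₁ p₂ b c, n₁ + n₂ = n → p₁ + p₂ = p → IsMonomial U n₁ p₁ b →
      IsMonomial U n₂ p₂ c → β (f b) (g c) = β (f' b) (g' c)) :
    gconv β f g a = gconv β f' g' a :=
  gconv_congr_map LinearMap.id ha h

theorem gconv_add_left (β : M →ₗ[k] N →ₗ[k] P) (f f' : GSym U →ₗ[k] M) (g : GSym U →ₗ[k] N)
    (a : GSym U) : gconv β (f + f') g a = gconv β f g a + gconv β f' g a := by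
  simp only [gconv, LinearMap.comp_apply]
  induction comul U a using TensorProduct.induction_on with
  | zero => simp
  | tmul b c => simp
  | add s t hs ht => rw [map_add, hs, ht, map_add, map_add]; abel

theorem gconv_add_right (β : M →ₗ[k] N →ₗ[k] P) (f : GSym U →ₗ[k] M) (g g' : GSym U →ₗ[k] N)
    (a : GSym U) : gconv β f (g + g') a = gconv β f g a + gconv β f g' a := by
  simp only [gconv, LinearMap.comp_apply]
  induction comul U a using TensorProduct.induction_on with
  | zero => simp
  | tmul b c => simp
  | add s t hs ht => rw [map_add, hs, ht, map_add, map_add]; abel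

theorem gconv_smul_left (β : M →ₗ[k] N →ₗ[k] P) (r : k) (f : GSym U →ₗ[k] M)
    (g : GSym U →ₗ[k] N) (a : GSym U) : gconv β (r • f) g a = r • gconv β f g a := by
  simp only [gconv, LinearMap.comp_apply]
  induction comul U a using TensorProduct.induction_on with
  | zero => simp
  | tmul b c => simp
  | add s t hs ht => rw [map_add, hs, ht, map_add, smul_add]

theorem gconv_smul_right (β : M →ₗ[k] N →ₗ[k] P) (r : k) (f : GSym U →ₗ[k] M)
    (g : GSym U →ₗ[k] N) (a : GSym U) : gconv β f (r • g) a = r • gconv β f g a := by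
  simp only [gconv, LinearMap.comp_apply]
  induction comul U a using TensorProduct.induction_on with
  | zero => simp
  | tmul b c => simp
  | add s t hs ht => rw [map_add, hs, ht, map_add, smul_add]

theorem gconv_units_smul_left (β : M →ₗ[k] N →ₗ[k] P) (e : ℤˣ) (f : GSym U →ₗ[k] M)
    (g : GSym U →ₗ[k] N) (a : GSym U) : gconv β (e • f) g a = e • gconv β f g a := by
  rcases Int.units_eq_one_or e with rfl | rfl
  · simp
  · simpa using gconv_smul_left β (-1) f g a

theorem gconv_units_smul_right (β : M →ₗ[k] N →ₗ[k] P) (e : ℤˣ) (f : GSym U →ₗ[k] M)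
    (g : GSym U →ₗ[k] N) (a : GSym U) : gconv β f (e • g) a = e • gconv β f g a := by
  rcases Int.units_eq_one_or e with rfl | rfl
  · simp
  · simpa using gconv_smul_right β (-1) f g a

@[simp]
theorem gconv_zero_left (β : M →ₗ[k] N →ₗ[k] P) (g : GSym U →ₗ[k] N) :
    gconv β (0 : GSym U →ₗ[k] M) g = 0 := by
  ext a
  simpa using gconv_smul_left β 0 0 g a

@[simp]
theorem gconv_zero_right (β : M →ₗ[k] N →ₗ[k] P) (f : GSym U →ₗ[k] M) :
    gconv β f (0 : GSym U →ₗ[k] N) = 0 := by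
  ext a
  simpa using gconv_smul_right β 0 f 0 a

theorem gconv_signPow (β : M →ₗ[k] N →ₗ[k] P) (f : GSym U →ₗ[k] M) (g : GSym U →ₗ[k] N) (i : ℤ)
    (a : GSym U) :
    gconv β f g (signPow U i a) = gconv β (compSign f i) (compSign g i) a := by
  induction a using induction_monomial with
  | mono n p a ha =>
    have h : gconv β (compSign f i) (compSign g i) a =
        (koszul i p • LinearMap.id : P →ₗ[k] P) (gconv β f g a) := by
      refine gconv_congr_map _ ha ?_
      rintro n₁ n₂ p₁ p₂ b c - rfl hb hc
      simp only [compSign_apply, signPow_of_isMonomial i hb, signPow_of_isMonomial i hc,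
        map_units_smul, LinearMap.smul_apply, LinearMap.id_apply, koszul_add_right, mul_smul]
    rw [h, signPow_of_isMonomial i ha, map_units_smul]
    rfl
  | zero => simp
  | add b c hb hc => simp only [map_add, hb, hc]
  | smul r b hb => simp only [map_smul, hb]

/-- Associativity of convolution. -/
theorem gconv_assoc {L Q R : Type*} [AddCommGroup L] [Module k L] [AddCommGroup Q] [Module k Q]
    [AddCommGroup R] [Module k R] {β₁ : M →ₗ[k] N →ₗ[k] P} {β₂ : P →ₗ[k] L →ₗ[k] Q}
    {β₃ : M →ₗ[k] R →ₗ[k] Q} {β₄ : N →ₗ[k] L →ₗ[k] R}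
    (h : ∀ x y z, β₂ (β₁ x y) z = β₃ x (β₄ y z)) (f : GSym U →ₗ[k] M) (g : GSym U →ₗ[k] N)
    (e : GSym U →ₗ[k] L) : gconv β₂ (gconv β₁ f g) e = gconv β₃ f (gconv β₄ g e) := by
  refine linearMap_ext fun n p a ha => ?_
  -- The Leibniz rule replaces the three maps by their `compMul` and `compSign`, so the induction
  -- has to be over all of them at once.
  induction ha generalizing f g e with
  | one => simp [h]
  | @cons n i p x a hx _ ih =>
    have h₁ : compMul (gconv β₁ f g) x =
        gconv β₁ (compMul f x) g + gconv β₁ (compSign f i) (compMul g x) :=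
      LinearMap.ext fun b => gconv_ι_mul β₁ f g hx b
    have h₂ : compMul (gconv β₄ g e) x =
        gconv β₄ (compMul g x) e + gconv β₄ (compSign g i) (compMul e x) :=
      LinearMap.ext fun b => gconv_ι_mul β₄ g e hx b
    have h₃ : compSign (gconv β₁ f g) i = gconv β₁ (compSign f i) (compSign g i) :=
      LinearMap.ext fun b => gconv_signPow β₁ f g i b
    rw [gconv_ι_mul _ _ _ hx, gconv_ι_mul _ _ _ hx, h₁, h₂, h₃, gconv_add_left, gconv_add_right,
      ih, ih, ih, add_assoc]

end Convolution

/-! ### The convolution algebra: unit, parity and graded commutativity. -/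

section Algebra

variable {U U' : GradedSpace.{u, v} k} {B : Type*} [Ring B] [Algebra k B]

theorem conv_eq_gconv (f g : GSym U →ₗ[k] B) : conv f g = gconv (LinearMap.mul k B) f g := by
  rw [conv, gconv, ← LinearMap.comp_assoc]
  congr 1
  ext b c
  simp

theorem conv_assoc (f g h : GSym U →ₗ[k] B) : conv (conv f g) h = conv f (conv g h) := by
  simp only [conv_eq_gconv]
  exact gconv_assoc (fun x y z => mul_assoc x y z) f g h

/-- The unit of the convolution product. -/
theorem convPow_zero_apply (f : GSym U →ₗ[k] B) (a : GSym U) :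
    convPow f 0 a = algebraMap k B (counit U a) := rfl

theorem convPow_zero_conv (f g : GSym U →ₗ[k] B) : conv (convPow f 0) g = g := by
  refine linearMap_ext fun n p a ha => ?_
  rw [conv_eq_gconv]
  induction ha generalizing g with
  | one => simp [convPow_zero_apply]
  | @cons n i p x a hx _ ih =>
    have h₁ : compMul (convPow f 0) x = 0 := by
      ext b; simp [convPow_zero_apply, counit]
    -- The counit only sees weight zero, where all signs are trivial.
    have h₂ : compSign (convPow f 0) i = convPow f 0 := by
      refine linearMap_ext fun n p b hb => ?_
      simp only [compSign_apply, signPow_of_isMonomial i hb, convPow_zero_apply, map_units_smul]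
      cases hb <;> simp [counit]
    rw [gconv_ι_mul _ _ _ hx, h₁, h₂, ih]
    simp

theorem conv_convPow_zero (f g : GSym U →ₗ[k] B) : conv g (convPow f 0) = g := by
  refine linearMap_ext fun n p a ha => ?_
  rw [conv_eq_gconv]
  induction ha generalizing g with
  | one => simp [convPow_zero_apply]
  | @cons n i p x a hx _ ih =>
    have h₁ : compMul (convPow f 0) x = 0 := by
      ext b; simp [convPow_zero_apply, counit]
    rw [gconv_ι_mul _ _ _ hx, h₁, ih]
    simp

/-- A linear map `f : S(U) → S(U')` has the parity of `e`. -/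
def HasParity (e : ℤ) (f : GSym U →ₗ[k] GSym U') : Prop :=
  ∀ j a, signPow U' j (f a) = koszul e j • f (signPow U j a)

theorem HasParity.id : HasParity 0 (LinearMap.id : GSym U →ₗ[k] GSym U) := by
  intro j a; simp

theorem HasParity.compMul {e : ℤ} {f : GSym U →ₗ[k] GSym U'} (hf : HasParity e f) {i : ℤ}
    {x : U.carrier} (hx : x ∈ U.grading i) : HasParity (e + i) (compMul f x) := by
  intro j a
  rw [compMul_apply, hf, map_mul, signPow_ι j hx, smul_mul_assoc, map_units_smul, koszul_add_left,
    mul_smul, koszul_symm i j, compMul_apply]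

theorem HasParity.compSign {e : ℤ} {f : GSym U →ₗ[k] GSym U'} (hf : HasParity e f) (i : ℤ) :
    HasParity e (compSign f i) := by
  intro j a
  rw [compSign_apply, hf, compSign_apply, signPow_comm]

theorem HasParity.conv {d e : ℤ} {f g : GSym U →ₗ[k] GSym U'} (hf : HasParity d f)
    (hg : HasParity e g) : HasParity (d + e) (conv f g) := by
  intro j a
  rw [conv_eq_gconv, gconv_signPow]
  induction a using induction_monomial with
  | mono n p a ha =>
    have h := gconv_congr_map (β' := LinearMap.mul k (GSym U')) (f' := f) (g' := g)
      (β := LinearMap.mul k (GSym U')) (f := koszul d j • GSym.compSign f j)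
      (g := koszul e j • GSym.compSign g j)
      (T := (signPow U' j).toLinearMap) ha (by
        intro _ _ _ _ b c _ _ _ _
        have h₁ := hf j b
        have h₂ := hg j c
        simp only [LinearMap.smul_apply, compSign_apply, LinearMap.mul_apply',
          AlgHom.toLinearMap_apply, map_mul, h₁, h₂])
    rw [gconv_units_smul_left, gconv_units_smul_right] at h
    rw [koszul_add_left, mul_smul]
    exact h.symm
  | zero => simp
  | add b c hb hc => simp only [map_add, hb, hc, smul_add]
  | smul r b hb => simp only [map_smul, hb]; rw [smul_comm]

/-- Elements of `S(U)` commute up to the Koszul sign. -/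
theorem mul_comm_of_sign {p q : ℤ} {a b : GSym U} (ha : ∀ j, signPow U j a = koszul p j • a)
    (hb : ∀ j, signPow U j b = koszul q j • b) : a * b = koszul p q • (b * a) := by
  -- Only the parity of `b` is known, so `b` is moved past the generators in a monomial `c` one at a
  -- time.
  have key : ∀ c : GSym U, c * b = b * signPow U q c := by
    intro c
    induction c using induction_monomial with
    | mono n i c hc =>
      induction hc with
      | one => simp
      | @cons n i p x a hx _ ih =>
        rw [mul_assoc, ih, ← mul_assoc, ι_mul_comm hx, hb, map_mul, signPow_ι _ hx,
          smul_mul_assoc, smul_mul_assoc, smul_mul_assoc, mul_smul_comm, mul_assoc]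
    | zero => simp
    | add b c hb hc => simp [hb, hc, mul_add, add_mul]
    | smul r b hb => simp [hb]
  rw [key, ha, mul_smul_comm]

/-- Graded commutativity of convolution. -/
theorem conv_comm {p q : ℤ} {f g : GSym U →ₗ[k] GSym U'} (hf : HasParity p f)
    (hg : HasParity q g) :
    conv (compSign f q) g = koszul p q • conv (compSign g p) f := by
  refine linearMap_ext fun n r a ha => ?_
  simp only [conv_eq_gconv, LinearMap.smul_apply]
  -- Removing a generator of degree `i` changes the parity of one of the two maps by `i`.
  induction ha generalizing f g p q with
  | one =>
    simp only [gconv_one, compSign_apply, map_one, LinearMap.mul_apply']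
    exact mul_comm_of_sign (fun j => by simpa using hf j 1) (fun j => by simpa using hg j 1)
  | @cons n i r x a hx _ ih =>
    have h : ∀ (f : GSym U →ₗ[k] GSym U') (q : ℤ),
        compMul (compSign f q) x = koszul q i • compSign (compMul f x) q := by
      intro f q
      ext b
      rw [compMul_apply, compSign_apply, map_mul, signPow_ι q hx, smul_mul_assoc, map_units_smul]
      rfl
    have h' : ∀ (f : GSym U →ₗ[k] GSym U') (q : ℤ),
        compSign (compSign f q) i = compSign f (q + i) := by
      intro f q
      ext b
      simp [signPow_add]
    rw [gconv_ι_mul _ _ _ hx, gconv_ι_mul _ _ _ hx, h, h, h', h', gconv_units_smul_left,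
      gconv_units_smul_left, ih (hf.compMul hx) hg, ih hf (hg.compMul hx), koszul_add_left,
      koszul_add_right, koszul_symm q i]
    rcases Int.units_eq_one_or (koszul p q) with h₁ | h₁ <;>
    rcases Int.units_eq_one_or (koszul q i) with h₂ | h₂ <;>
    rcases Int.units_eq_one_or (koszul p i) with h₃ | h₃ <;>
    simp [h₁, h₂, h₃, add_comm]

end Algebra

/-! ### Exponential and logarithm -/

section ExpLog

variable {U : GradedSpace.{u, v} k} {B : Type*} [Ring B] [Algebra k B]

theorem conv_add_left (f f' g : GSym U →ₗ[k] B) : conv (f + f') g = conv f g + conv f' g := by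
  ext a; simp only [conv_eq_gconv, gconv_add_left, LinearMap.add_apply]

theorem conv_add_right (f g g' : GSym U →ₗ[k] B) : conv f (g + g') = conv f g + conv f g' := by
  ext a; simp only [conv_eq_gconv, gconv_add_right, LinearMap.add_apply]

theorem conv_smul_left (r : k) (f g : GSym U →ₗ[k] B) : conv (r • f) g = r • conv f g := by
  ext a; simp only [conv_eq_gconv, gconv_smul_left, LinearMap.smul_apply]

theorem conv_smul_right (r : k) (f g : GSym U →ₗ[k] B) : conv f (r • g) = r • conv f g := by
  ext a; simp only [conv_eq_gconv, gconv_smul_right, LinearMap.smul_apply]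

theorem convPow_one (f : GSym U →ₗ[k] B) : convPow f 1 = f := convPow_zero_conv f f

theorem convPow_add (f : GSym U →ₗ[k] B) (i j : ℕ) :
    convPow f (i + j) = conv (convPow f i) (convPow f j) := by
  induction j with
  | zero => exact (conv_convPow_zero f _).symm
  | succ j ih => rw [← add_assoc, convPow, ih, conv_assoc, convPow]

/-- There is no way to distribute `n` factors to more than `n` nonempty blocks, and `f` kills the
empty block. -/
theorem convPow_apply_eq_zero {f : GSym U →ₗ[k] B} (hf : f 1 = 0) {j n : ℕ} {p : ℤ} {a : GSym U}
    (ha : IsMonomial U n p a) (h : n < j) : convPow f j a = 0 := by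
  induction j generalizing n p a with
  | zero => omega
  | succ j ih =>
    rw [convPow, conv_eq_gconv, ← Submodule.mem_bot k]
    refine gconv_mem _ ha ?_
    rintro n₁ n₂ p₁ p₂ b c hn - hb hc
    rw [Submodule.mem_bot]
    cases n₂ with
    | zero => cases hc; simp [hf]
    | succ m => simp [ih hb (by omega)]

theorem convPow_congr {f g : GSym U →ₗ[k] B} {n : ℕ}
    (h : ∀ m ≤ n, ∀ p a, IsMonomial U m p a → f a = g a) (j : ℕ) {p : ℤ} {a : GSym U}
    (ha : IsMonomial U n p a) : convPow f j a = convPow g j a := by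
  induction j generalizing n p a with
  | zero => rfl
  | succ j ih =>
    rw [convPow, convPow, conv_eq_gconv, conv_eq_gconv]
    refine gconv_congr ha ?_
    rintro n₁ n₂ p₁ p₂ b c hn - hb hc
    rw [ih (fun m hm => h m (by omega)) hb, h n₂ (by omega) _ _ hc]

/-- The cut-off in the exponential may be raised freely, as the added convolution powers vanish. One
truncated series therefore serves all weights up to a bound. -/
theorem expMap_of_isMonomial {f : GSym U →ₗ[k] B} (hf : f 1 = 0) {n N : ℕ} {p : ℤ} {a : GSym U}
    (ha : IsMonomial U n p a) (h : n ≤ N) :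
    expMap f a = ∑ j ∈ Finset.range (N + 1), (j.factorial : k)⁻¹ • convPow f j a := by
  rw [expMap, ofWeights_of_isMonomial _ ha, LinearMap.sum_apply]
  simp only [LinearMap.smul_apply]
  refine Finset.sum_subset (Finset.range_mono (by omega)) fun j _ hj => ?_
  rw [convPow_apply_eq_zero hf ha (by simpa using hj), smul_zero]

theorem expMap_one {f : GSym U →ₗ[k] B} : expMap f 1 = 1 := by
  rw [expMap, ofWeights_of_isMonomial _ .one]
  simp [convPow_zero_apply]

/-- The value of a polynomial at `f` in the convolution algebra. -/
def convEval (f : GSym U →ₗ[k] B) : k[X] →ₗ[k] GSym U →ₗ[k] B :=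
  Polynomial.lsum fun j => LinearMap.toSpanSingleton k _ (convPow f j)

@[simp]
theorem convEval_monomial (f : GSym U →ₗ[k] B) (j : ℕ) (c : k) :
    convEval f (Polynomial.monomial j c) = c • convPow f j := by
  simp [convEval, Polynomial.sum_monomial_index]

/-- Powers of a single `f` commute in the convolution algebra, so identities between truncated power
series can be proved in `k[X]` and evaluated at `f`. -/
theorem convEval_mul (f : GSym U →ₗ[k] B) (P Q : k[X]) :
    convEval f (P * Q) = conv (convEval f P) (convEval f Q) := by
  induction P using Polynomial.induction_on' with
  | add P P' h h' => rw [add_mul, map_add, map_add, h, h', conv_add_left]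
  | monomial i c =>
    induction Q using Polynomial.induction_on' with
    | add Q Q' h h' => rw [mul_add, map_add, map_add, h, h', conv_add_right]
    | monomial j d =>
      rw [Polynomial.monomial_mul_monomial, convEval_monomial, convEval_monomial,
        convEval_monomial, conv_smul_left, conv_smul_right, convPow_add, smul_smul]

theorem convEval_one (f : GSym U →ₗ[k] B) : convEval f 1 = convPow f 0 := by
  simpa using convEval_monomial f 0 1

theorem convPow_convEval (f : GSym U →ₗ[k] B) (P : k[X]) (j : ℕ) :
    convPow (convEval f P) j = convEval f (P ^ j) := by
  induction j with
  | zero => rw [pow_zero, convEval_one]; rfl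
  | succ j ih => rw [convPow, ih, pow_succ, convEval_mul]

theorem convEval_apply_eq_zero {f : GSym U →ₗ[k] B} (hf : f 1 = 0) {P : k[X]} {n : ℕ} {p : ℤ}
    {a : GSym U} (ha : IsMonomial U n p a) (hP : Polynomial.X ^ (n + 1) ∣ P) :
    convEval f P a = 0 := by
  rw [convEval, Polynomial.lsum_apply, Polynomial.sum_def, LinearMap.sum_apply]
  refine Finset.sum_eq_zero fun j _ => ?_
  by_cases hj : j < n + 1
  · simp [Polynomial.X_pow_dvd_iff.1 hP j hj]
  · simp [convPow_apply_eq_zero hf ha (by omega : n < j)]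

/-- The exponential series up to order `m`. -/
def truncExp (k : Type u) [Field k] (m : ℕ) : k[X] :=
  ∑ j ∈ Finset.range (m + 1), Polynomial.monomial j (j.factorial : k)⁻¹

theorem X_dvd_one_sub_truncExp (m : ℕ) : Polynomial.X ∣ 1 - truncExp k m := by
  rw [Polynomial.X_dvd_iff]
  simp [truncExp, Polynomial.coeff_monomial]

theorem derivative_truncExp [CharZero k] (m : ℕ) :
    Polynomial.derivative (truncExp k m) =
      truncExp k m - Polynomial.monomial m (m.factorial : k)⁻¹ := by
  rw [truncExp, Finset.sum_range_succ, add_sub_cancel_right, ← Finset.sum_range_succ,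
    Polynomial.derivative_sum, Finset.sum_range_succ']
  simp only [Polynomial.derivative_monomial, Nat.cast_zero, mul_zero, Polynomial.monomial_zero_right,
    add_zero, Nat.add_sub_cancel]
  refine Finset.sum_congr rfl fun j _ => ?_
  congr 1
  rw [Nat.factorial_succ]
  push_cast
  have h₁ : (j.factorial : k) ≠ 0 := by exact_mod_cast j.factorial_ne_zero
  have h₂ : (j : k) + 1 ≠ 0 := by exact_mod_cast j.succ_ne_zero
  field_simp

/-- `log (exp t) = t` up to order `m`. -/
theorem log_truncExp [CharZero k] (m : ℕ) :
    (Polynomial.X : k[X]) ^ (m + 1) ∣ (∑ j ∈ Finset.range m, ((-1 : k) ^ j * ((j + 1 : ℕ) : k)⁻¹) •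
      (truncExp k m - 1) ^ (j + 1)) - Polynomial.X := by
  obtain ⟨q, hq⟩ := X_dvd_one_sub_truncExp (k := k) m
  set e := truncExp k m with he
  set P := (∑ j ∈ Finset.range m, ((-1 : k) ^ j * ((j + 1 : ℕ) : k)⁻¹) • (e - 1) ^ (j + 1)) with hP
  -- Differentiation turns the logarithm into a geometric sum: `P' = (∑ (1 - e)^j) e'`, where `e' =
  -- e - X^m / m!` and `(∑ (1 - e)^j) e = 1 - (1 - e)^m`. As `X` divides `1 - e`, the difference `P'
  -- - 1` is divisible by `X^m`.
  have hd : Polynomial.derivative (P - Polynomial.X) =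
      Polynomial.X ^ m * (-q ^ m - (∑ j ∈ Finset.range m, (1 - e) ^ j) *
        Polynomial.C (m.factorial : k)⁻¹) := by
    have h₁ : Polynomial.derivative P =
        (∑ j ∈ Finset.range m, (1 - e) ^ j) * Polynomial.derivative e := by
      rw [hP, Polynomial.derivative_sum, Finset.sum_mul]
      refine Finset.sum_congr rfl fun j _ => ?_
      rw [Polynomial.derivative_smul, Polynomial.derivative_pow_succ, Polynomial.derivative_sub,
        Polynomial.derivative_one, sub_zero, ← smul_mul_assoc, Polynomial.smul_eq_C_mul]
      congr 1
      have h₂ : (j : k) + 1 ≠ 0 := by exact_mod_cast j.succ_ne_zero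
      have h₃ : (1 - e) ^ j = (-1) ^ j * (e - 1) ^ j := by rw [← mul_pow]; ring
      have h₄ : Polynomial.C ((-1 : k) ^ j * ((j + 1 : ℕ) : k)⁻¹) * Polynomial.C ((j : k) + 1) =
          (-1) ^ j := by
        rw [← Polynomial.C_mul]
        push_cast
        rw [mul_assoc, inv_mul_cancel₀ h₂]
        simp
      rw [← mul_assoc, h₄, h₃]
    have h₅ := geom_sum_mul_neg (1 - e) m
    rw [sub_sub_cancel] at h₅
    rw [Polynomial.derivative_sub, Polynomial.derivative_X, h₁, derivative_truncExp, ← he, mul_sub,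
      h₅, hq, mul_pow, ← Polynomial.C_mul_X_pow_eq_monomial]
    ring
  rw [Polynomial.X_pow_dvd_iff]
  rintro (_ | d) hdm
  · rw [Polynomial.coeff_zero_eq_eval_zero]
    have h : (e - 1).eval 0 = 0 := by
      rw [← neg_sub, hq]; simp
    simp [hP, Polynomial.eval_finsetSum, h]
  -- Integration: in characteristic zero the vanishing of the coefficient of `X^d` in the
  -- derivative, for `d < m`, gives that of `X^(d+1)`.
  · have h := congrArg (fun r => Polynomial.coeff r d) hd
    simp only [Polynomial.coeff_derivative, Polynomial.coeff_X_pow_mul'] at h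
    rw [if_neg (by omega)] at h
    have h₂ : (d : k) + 1 ≠ 0 := by exact_mod_cast d.succ_ne_zero
    exact (mul_eq_zero.1 h).resolve_right h₂

/-- On weight `m` both series are polynomials in `f` under convolution, and multiples of `X^(m+1)`
evaluate to zero there, so the claim is `log_truncExp`. -/
theorem logMap_expMap [CharZero k] {f : GSym U →ₗ[k] B} (hf : f 1 = 0) :
    logMap (expMap f) = f := by
  refine linearMap_ext fun m p a ha => ?_
  have h : ∀ m' ≤ m, ∀ p b, IsMonomial U m' p b →
      (expMap f - convPow (expMap f) 0) b = convEval f (truncExp k m - 1) b := by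
    intro m' hm' p b hb
    rw [LinearMap.sub_apply, map_sub, LinearMap.sub_apply, convEval_one,
      expMap_of_isMonomial hf hb hm', truncExp, map_sum, LinearMap.sum_apply]
    simp [convPow_zero_apply]
  rw [logMap, ofWeights_of_isMonomial _ ha, LinearMap.sum_apply]
  have h₁ : ∀ j, convPow (expMap f - convPow (expMap f) 0) (j + 1) a =
      convEval f ((truncExp k m - 1) ^ (j + 1)) a := fun j => by
    rw [convPow_congr h (j + 1) ha, convPow_convEval]
  simp only [LinearMap.smul_apply, h₁]
  have h₂ := convEval_apply_eq_zero hf ha (log_truncExp (k := k) m)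
  rw [map_sub, LinearMap.sub_apply, map_sum, LinearMap.sum_apply, sub_eq_zero] at h₂
  simp only [map_smul, LinearMap.smul_apply] at h₂
  rw [h₂, ← Polynomial.monomial_one_one_eq_X, convEval_monomial, one_smul, convPow_one]

end ExpLog

/-! ### Coalgebra morphisms and coderivations -/

section Coalgebra

variable {U U' U'' : GradedSpace.{u, v} k}

theorem comul_mul (a b : GSym U) : comul U (a * b) = insertionHom U a (comul U b) := by
  simp [comul]

theorem insertionHom_ι (x : U.carrier) : insertionHom U (ι U x) = insertion U x := by
  simp [insertionHom]

/-- `insertion` is defined through homogeneous components, while the values of a map of given parity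
are only known to be even or odd. The even and odd parts `(y ± σ y) / 2`, with `σ` the sign
operator, give a formula linear in `y`; this needs `2` to be invertible. -/
theorem insertion_tmul_of_sign [CharZero k] {e : ℤ} {y : U.carrier}
    (hy : ∀ j, signPow U j (ι U y) = koszul e j • ι U y) (b c : GSym U) :
    insertion U y (b ⊗ₜ c) = (ι U y * b) ⊗ₜ c + signPow U e b ⊗ₜ (ι U y * c) := by
  have h2 : (2 : k) ≠ 0 := two_ne_zero
  have key : (2 : k) • insertion U y (b ⊗ₜ c) = (2 : k) • (ι U y * b) ⊗ₜ[k] c +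
      b ⊗ₜ[k] ((ι U y + signPow U 1 (ι U y)) * c) +
      signPow U 1 b ⊗ₜ[k] ((ι U y - signPow U 1 (ι U y)) * c) := by
    clear hy
    induction y using U.induction_homogeneous with
    | hom i y hy =>
      rw [insertion_tmul hy, signPow_ι 1 hy]
      rcases Int.even_or_odd i with hi | hi
      · rw [koszul_symm, koszul_of_even_left hi]
        simp [signPow, hi, two_smul, TensorProduct.tmul_add, add_mul]
      · rw [koszul_symm, koszul_of_odd_left hi]
        simp [signPow, Int.not_even_iff_odd.2 hi, two_smul, TensorProduct.tmul_add, add_mul]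
    | zero => simp
    | add y z hy hz =>
      simp only [map_add, LinearMap.add_apply, smul_add, hy, hz, add_mul, sub_mul,
        TensorProduct.add_tmul, TensorProduct.tmul_add, TensorProduct.tmul_sub]
      abel
  have h : (2 : k) • insertion U y (b ⊗ₜ c) =
      (2 : k) • ((ι U y * b) ⊗ₜ[k] c + signPow U e b ⊗ₜ[k] (ι U y * c)) := by
    rw [key, hy 1]
    rcases Int.even_or_odd e with hi | hi
    · rw [koszul_of_even_left hi]
      simp [signPow, hi, two_smul, TensorProduct.tmul_add, add_mul, add_assoc]
    · rw [koszul_of_odd_left hi]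
      simp [signPow, Int.not_even_iff_odd.2 hi, two_smul, TensorProduct.tmul_add, add_mul,
        add_assoc]
  exact smul_right_injective _ h2 h

theorem compSign_compSign {M : Type*} [AddCommGroup M] [Module k M] (f : GSym U →ₗ[k] M)
    (i j : ℤ) : compSign (compSign f i) j = compSign f (i + j) := by
  ext a; simp [signPow_add]

theorem compSign_self_add_self {M : Type*} [AddCommGroup M] [Module k M] (f : GSym U →ₗ[k] M)
    (i j : ℤ) : compSign f (i + (j + i)) = compSign f j := by
  ext a; simp [signPow_add, signPow_comm i j]

@[simp]
theorem compSign_zero {M : Type*} [AddCommGroup M] [Module k M] (f : GSym U →ₗ[k] M) :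
    compSign f 0 = f := by
  ext a; simp

theorem compMul_compSign {M : Type*} [AddCommGroup M] [Module k M] (f : GSym U →ₗ[k] M) (j : ℤ)
    {i : ℤ} {x : U.carrier} (hx : x ∈ U.grading i) :
    compMul (compSign f j) x = koszul j i • compSign (compMul f x) j := by
  ext b
  rw [compMul_apply, compSign_apply, map_mul, signPow_ι j hx, smul_mul_assoc, map_units_smul]
  rfl

theorem compMul_gconv {M N P : Type*} [AddCommGroup M] [Module k M] [AddCommGroup N] [Module k N]
    [AddCommGroup P] [Module k P] (β : M →ₗ[k] N →ₗ[k] P) (f : GSym U →ₗ[k] M)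
    (g : GSym U →ₗ[k] N) {i : ℤ} {x : U.carrier} (hx : x ∈ U.grading i) :
    compMul (gconv β f g) x =
      gconv β (compMul f x) g + gconv β (compSign f i) (compMul g x) :=
  LinearMap.ext fun a => gconv_ι_mul β f g hx a

theorem compSign_gconv {M N P : Type*} [AddCommGroup M] [Module k M] [AddCommGroup N] [Module k N]
    [AddCommGroup P] [Module k P] (β : M →ₗ[k] N →ₗ[k] P) (f : GSym U →ₗ[k] M)
    (g : GSym U →ₗ[k] N) (i : ℤ) :
    compSign (gconv β f g) i = gconv β (compSign f i) (compSign g i) :=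
  LinearMap.ext fun a => gconv_signPow β f g i a

theorem map_comp_comul {M N : Type*} [AddCommGroup M] [Module k M] [AddCommGroup N] [Module k N]
    (f : GSym U →ₗ[k] M) (g : GSym U →ₗ[k] N) :
    TensorProduct.map f g ∘ₗ comul U = gconv (TensorProduct.mk k M N) f g := by
  rw [gconv]
  congr 1

/-- The diagonal action of `g`, with values in `U'`, on the tensor product of two maps. -/
theorem gconv_insertionHom [CharZero k] {e p : ℤ} {g h : GSym U →ₗ[k] GSym U'}
    (hg : HasParity e g) (hgι : ∀ a, g a ∈ LinearMap.range (ι U')) (hh : HasParity p h)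
    (r : GSym U →ₗ[k] GSym U') :
    gconv (insertionHom U').toLinearMap g (gconv (TensorProduct.mk k _ _) h r) =
      gconv (TensorProduct.mk k _ _) (conv g h) r +
        koszul e p • gconv (TensorProduct.mk k _ _) (compSign h e) (conv (compSign g p) r) := by
  refine linearMap_ext fun n q a ha => ?_
  rw [LinearMap.add_apply, LinearMap.smul_apply]
  simp only [conv_eq_gconv]
  -- Each application of the Leibniz rule modifies one of the three maps and may shift the parities
  -- of `g` and `h`.
  induction ha generalizing g h r e p with
  | one =>
    simp only [gconv_one, AlgHom.toLinearMap_apply, TensorProduct.mk_apply, LinearMap.mul_apply',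
      compSign_apply, map_one]
    obtain ⟨y, hy⟩ := hgι 1
    have hs : ∀ j, signPow U' j (g 1) = koszul e j • g 1 := fun j => by
      rw [hg, map_one (signPow U j)]
    have h1 : signPow U' e (h 1) = koszul p e • h 1 := by rw [hh, map_one (signPow U e)]
    rw [← hy] at hs ⊢
    -- The element `g 1` of `U'` need not be homogeneous; only its parity is available.
    rw [insertionHom_ι, insertion_tmul_of_sign hs, h1, units_smul_tmul, koszul_symm]
  | @cons n i q x a hx _ ih =>
    have hg' : ∀ a, compMul g x a ∈ LinearMap.range (ι U') := fun a => hgι _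
    have hg'' : ∀ a, compSign g i a ∈ LinearMap.range (ι U') := fun a => hgι _
    simp only [gconv_ι_mul _ _ _ hx, compMul_gconv _ _ _ hx, compSign_gconv, gconv_add_left,
      gconv_add_right]
    rw [ih (hg.compMul hx) hg' hh, ih (hg.compSign i) hg'' (hh.compMul hx),
      ih (hg.compSign i) hg'' (hh.compSign i)]
    simp only [compSign_compSign, compSign_self_add_self, compMul_compSign _ _ hx,
      gconv_units_smul_left, koszul_add_left, koszul_add_right, smul_add,
      smul_smul, koszul_symm p i, add_comm i e, add_comm i p]
    have hu : gconv (LinearMap.mul k (GSym U')) (koszul p i • compSign (compMul g x) p) r =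
        koszul p i • gconv (LinearMap.mul k (GSym U')) (compSign (compMul g x) p) r :=
      LinearMap.ext fun a => gconv_units_smul_left _ _ _ _ a
    rw [hu, gconv_units_smul_right, smul_smul]
    abel

/-- A morphism of counital coalgebras `S(U) → S(U')` with `F(1) = 1`. -/
structure IsCoalgHom (F : GSym U →ₗ[k] GSym U') : Prop where
  comul : GSym.comul U' ∘ₗ F = TensorProduct.map F F ∘ₗ GSym.comul U
  counit : (GSym.counit U').toLinearMap ∘ₗ F = (GSym.counit U).toLinearMap
  map_one : F 1 = 1

theorem IsCoalgHom.comp {F : GSym U →ₗ[k] GSym U'} {G : GSym U' →ₗ[k] GSym U''}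
    (hG : IsCoalgHom G) (hF : IsCoalgHom F) : IsCoalgHom (G ∘ₗ F) where
  comul := by
    rw [← LinearMap.comp_assoc, hG.comul, LinearMap.comp_assoc, hF.comul, ← LinearMap.comp_assoc,
      TensorProduct.map_comp]
  counit := by rw [← LinearMap.comp_assoc, hG.counit, hF.counit]
  map_one := by rw [LinearMap.comp_apply, hF.map_one, hG.map_one]

theorem IsCoalgHom.id : IsCoalgHom (LinearMap.id : GSym U →ₗ[k] GSym U) where
  comul := by simp
  counit := by simp
  map_one := rfl

/-- A coderivation of `S(U)` of odd degree that vanishes on `1`. -/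
structure IsOddCoder (D : GSym U →ₗ[k] GSym U) : Prop where
  coderivation : GSym.comul U ∘ₗ D =
    (TensorProduct.map D LinearMap.id + TensorProduct.map (sign U).toLinearMap D) ∘ₗ GSym.comul U
  map_one : D 1 = 0

/-- A map into the cogenerators `U'` with the parity of `e` that vanishes on `1`. -/
structure IsCogen (e : ℤ) (f : GSym U →ₗ[k] GSym U') : Prop where
  mem_range : ∀ a, f a ∈ LinearMap.range (ι U')
  parity : HasParity e f
  map_one : f 1 = 0

/-- Multiplicativity of the coproduct, `δ(g(a') h(a'')) = g(a') · δ(h(a''))`. It reduces both the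
coderivation and the coalgebra morphism property to `gconv_insertionHom`. -/
theorem comul_comp_conv (g h : GSym U →ₗ[k] GSym U') :
    comul U' ∘ₗ conv g h = gconv (insertionHom U').toLinearMap g (comul U' ∘ₗ h) :=
  linearMap_ext fun n p a ha => by
    rw [conv_eq_gconv]
    exact (gconv_congr_map (comul U') ha fun _ _ _ _ b c _ _ _ _ => (comul_mul _ _).symm).symm

/-- This is `gconv_insertionHom` for `g = l` and both other maps the identity: an element of `U'` is
primitive, so it enters either the left or the right tensor factor. -/
theorem IsCogen.isOddCoder [CharZero k] {l : GSym U →ₗ[k] GSym U} (hl : IsCogen 1 l) :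
    IsOddCoder (conv l LinearMap.id) where
  coderivation := by
    have h := gconv_insertionHom hl.parity hl.mem_range HasParity.id LinearMap.id
    have hs : compSign LinearMap.id 1 = (sign U).toLinearMap := by
      ext a; simp [signPow]
    rw [compSign_zero, koszul_zero_right, one_smul, hs, ← map_comp_comul, ← map_comp_comul,
      ← map_comp_comul, TensorProduct.map_id, LinearMap.id_comp] at h
    rw [comul_comp_conv, LinearMap.comp_id, h, LinearMap.add_comp]
  map_one := by
    rw [conv_eq_gconv, gconv_one, hl.map_one]
    simp

theorem HasParity.convPow {f : GSym U →ₗ[k] GSym U'} (hf : HasParity 0 f) (j : ℕ) :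
    HasParity 0 (convPow f j) := by
  induction j with
  | zero =>
    intro j a
    rw [convPow_zero_apply, convPow_zero_apply, AlgHom.commutes, koszul_zero_left, one_smul]
    induction a using induction_monomial with
    | mono n p a ha =>
      rw [signPow_of_isMonomial j ha]
      cases ha with
      | one => simp
      | cons hx ha =>
        have h := map_units_smul (counit U).toLinearMap
        simp only [AlgHom.toLinearMap_apply] at h
        rw [h, map_mul]
        simp [counit]
    | zero => simp
    | add b c hb hc => simp [hb, hc]
    | smul r b hb => simp only [map_smul, smul_eq_mul, map_mul, hb]
  | succ j ih =>
    have h := ih.conv hf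
    rw [zero_add] at h
    exact h

/-- The power rule for the derivation `compMul · x`. The map `f` is even, so graded commutativity
moves its derivative to the front of every term without a sign. -/
theorem convPow_ι_mul {f : GSym U →ₗ[k] GSym U'} (hf : HasParity 0 f) {i : ℤ} {x : U.carrier}
    (hx : x ∈ U.grading i) (j : ℕ) (a : GSym U) :
    convPow f (j + 1) (ι U x * a) = (j + 1 : k) • conv (compMul f x) (convPow f j) a := by
  induction j generalizing a with
  | zero => rw [convPow_one, conv_convPow_zero]; simp
  | succ j ih =>
    have h : compMul (convPow f (j + 1)) x = (j + 1 : k) • conv (compMul f x) (convPow f j) :=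
      LinearMap.ext ih
    have hc := conv_comm (hf.convPow (j + 1)) (hf.compMul hx)
    rw [koszul_zero_left, one_smul, compSign_zero, zero_add] at hc
    rw [convPow, conv_eq_gconv, gconv_ι_mul _ _ _ hx, ← conv_eq_gconv, ← conv_eq_gconv, hc, h,
      conv_smul_left, conv_assoc, ← convPow, LinearMap.smul_apply]
    push_cast
    rw [add_smul ((j : k) + 1), one_smul]

/-- The differential equation `∂ exp(f) = ∂f * exp(f)`, with `∂ = compMul · x`. Together with the
value `1` at `1` it determines the exponential by induction on the weight. -/
theorem expMap_ι_mul [CharZero k] {f : GSym U →ₗ[k] GSym U'} (hf : IsCogen 0 f) {i : ℤ}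
    {x : U.carrier} (hx : x ∈ U.grading i) :
    compMul (expMap f) x = conv (compMul f x) (expMap f) := by
  refine linearMap_ext fun n p a ha => ?_
  have h : conv (compMul f x) (expMap f) a = conv (compMul f x)
      (∑ j ∈ Finset.range (n + 1), (j.factorial : k)⁻¹ • convPow f j) a := by
    rw [conv_eq_gconv, conv_eq_gconv]
    refine gconv_congr ha ?_
    rintro n₁ n₂ p₁ p₂ b c hn - hb hc
    rw [expMap_of_isMonomial hf.map_one hc (by omega : n₂ ≤ n), LinearMap.sum_apply]
    rfl
  have h' : ∀ s : Finset ℕ, conv (compMul f x) (∑ j ∈ s, (j.factorial : k)⁻¹ • convPow f j) =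
      ∑ j ∈ s, (j.factorial : k)⁻¹ • conv (compMul f x) (convPow f j) := by
    intro s
    induction s using Finset.cons_induction with
    | empty => ext b; simp [conv_eq_gconv]
    | cons j s hj ih => rw [Finset.sum_cons, Finset.sum_cons, conv_add_right, conv_smul_right, ih]
  rw [h, h', compMul_apply, expMap_of_isMonomial hf.map_one (.cons hx ha) le_rfl,
    Finset.sum_range_succ', LinearMap.sum_apply]
  have h0 : convPow f 0 (ι U x * a) = 0 := by simp [convPow_zero_apply, counit]
  rw [h0, smul_zero, add_zero]
  refine Finset.sum_congr rfl fun j _ => ?_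
  rw [convPow_ι_mul hf.parity hx, smul_smul, LinearMap.smul_apply]
  congr 1
  rw [Nat.factorial_succ]
  push_cast
  have h₁ : (j.factorial : k) ≠ 0 := by exact_mod_cast j.factorial_ne_zero
  have h₂ : (j : k) + 1 ≠ 0 := by exact_mod_cast j.succ_ne_zero
  field_simp

theorem HasParity.expMap {f : GSym U →ₗ[k] GSym U'} (hf : IsCogen 0 f) :
    HasParity 0 (expMap f) := by
  intro i a
  induction a using induction_monomial with
  | mono n p a ha =>
    rw [signPow_of_isMonomial i ha, map_units_smul, expMap_of_isMonomial hf.map_one ha le_rfl,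
      map_sum, Finset.smul_sum, Finset.smul_sum]
    refine Finset.sum_congr rfl fun j _ => ?_
    rw [map_smul, hf.parity.convPow j, signPow_of_isMonomial i ha, map_units_smul]
    simp only [koszul_zero_left, one_smul]
    rw [smul_comm]
  | zero => simp
  | add b c hb hc => simp only [map_add, hb, hc, smul_add]
  | smul r b hb => simp only [map_smul, hb]; rw [smul_comm]

/-- Both sides satisfy the same differential equation: for the left side by `expMap_ι_mul` and
multiplicativity of `δ`, for the right side by `gconv_insertionHom` with `g = compMul f x`. The
right side of the equation involves the unknown only in lower weight. -/
theorem comul_expMap [CharZero k] {f : GSym U →ₗ[k] GSym U'} (hf : IsCogen 0 f) :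
    comul U' ∘ₗ expMap f = TensorProduct.map (expMap f) (expMap f) ∘ₗ comul U := by
  refine linearMap_ext fun n p a ha => ?_
  induction n using Nat.strong_induction_on generalizing p a with
  | _ n ih =>
    rw [map_comp_comul]
    cases ha with
    | one => simp [expMap_one, comul_one]
    | @cons n i p x a hx ha =>
      have h := gconv_insertionHom (hf.parity.compMul hx) (fun b => hf.mem_range _)
        (HasParity.expMap hf) (expMap f)
      rw [koszul_zero_right, one_smul, zero_add, compSign_zero, ← expMap_ι_mul hf hx] at h
      rw [gconv_ι_mul _ _ _ hx, ← LinearMap.add_apply, ← h, LinearMap.comp_apply,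
        ← compMul_apply, expMap_ι_mul hf hx, ← LinearMap.comp_apply, comul_comp_conv]
      refine gconv_congr ha ?_
      rintro n₁ n₂ p₁ p₂ b c hn - hb hc
      rw [ih n₂ (by omega) _ _ hc, map_comp_comul]

/-- A product of `j` values in `U'` has weight `j`. Hence the component of weight `j` of the
exponential is the single term `convPow f j / j!`, in particular `f` itself for `j = 1`. -/
theorem convPow_mem_symPow {f : GSym U →ₗ[k] GSym U'} (hf : IsCogen 0 f) (j : ℕ) (a : GSym U) :
    convPow f j a ∈ symPow U' j := by
  induction a using induction_monomial with
  | mono n p a ha =>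
    induction j generalizing n p a with
    | zero =>
      rw [convPow_zero_apply, symPow, pow_zero]
      exact Submodule.algebraMap_mem _
    | succ j ih =>
      rw [convPow, conv_eq_gconv]
      refine gconv_mem _ ha ?_
      rintro n₁ n₂ p₁ p₂ b c - - hb hc
      refine mul_mem_symPow (ih _ _ _ hb) ?_
      rw [symPow_one]
      exact hf.mem_range c
  | zero => simp
  | add b c hb hc => rw [map_add]; exact add_mem hb hc
  | smul r b hb => rw [map_smul]; exact Submodule.smul_mem _ _ hb

theorem proj_expMap_of_isMonomial {f : GSym U →ₗ[k] GSym U'} (hf : IsCogen 0 f) {n : ℕ} {p : ℤ}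
    {a : GSym U} (ha : IsMonomial U n p a) (i : ℕ) :
    proj U' i (expMap f a) = (i.factorial : k)⁻¹ • convPow f i a := by
  rw [expMap_of_isMonomial hf.map_one ha (le_max_left n i), map_sum]
  simp only [map_smul, proj_of_mem_symPow (convPow_mem_symPow hf _ a)]
  rw [Finset.sum_eq_single i]
  · simp
  · intro j _ hj
    rw [if_neg hj.symm, smul_zero]
  · intro h
    simp at h

theorem proj_one_expMap {f : GSym U →ₗ[k] GSym U'} (hf : IsCogen 0 f) :
    proj U' 1 ∘ₗ expMap f = f :=
  linearMap_ext fun n p a ha => by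
    rw [LinearMap.comp_apply, proj_expMap_of_isMonomial hf ha, convPow_one]
    simp

theorem counit_proj_zero (a : GSym U) : counit U (proj U 0 a) = counit U a := by
  rw [proj_zero_apply, AlgHom.commutes]
  rfl

theorem IsCogen.isCoalgHom_expMap [CharZero k] {f : GSym U →ₗ[k] GSym U'} (hf : IsCogen 0 f) :
    IsCoalgHom (expMap f) where
  comul := comul_expMap hf
  counit := linearMap_ext fun n p a ha => by
    rw [LinearMap.comp_apply, AlgHom.toLinearMap_apply, ← counit_proj_zero,
      proj_expMap_of_isMonomial hf ha, convPow_zero_apply]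
    simp
  map_one := expMap_one

/-- The Euler operator of `S(U)`, multiplication by `n` on `S^n(U)`. -/
theorem conv_proj_one_id {n : ℕ} {p : ℤ} {a : GSym U} (ha : IsMonomial U n p a) :
    conv (proj U 1) LinearMap.id a = (n : k) • a := by
  rw [conv_eq_gconv]
  induction ha with
  | one => simp [proj_of_isMonomial (IsMonomial.one (U := U))]
  | @cons n i p x a hx ha ih =>
    have h₁ : gconv (LinearMap.mul k _) (compMul (proj U 1) x) LinearMap.id a = ι U x * a := by
      have h := gconv_congr_map (β := LinearMap.mul k _) (f := compMul (proj U 1) x)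
        (g := LinearMap.id) (β' := LinearMap.mul k _) (f' := convPow (proj U 1) 0)
        (g' := LinearMap.id) (LinearMap.mulLeft k (ι U x)) ha (by
          rintro n₁ n₂ p₁ p₂ b c - - hb hc
          rw [compMul_apply, proj_of_isMonomial (.cons hx hb), convPow_zero_apply]
          cases hb with
          | one => simp
          | cons hy hb => simp [counit])
      rw [h, ← conv_eq_gconv, convPow_zero_conv]
      rfl
    have h₂ : gconv (LinearMap.mul k _) (compSign (proj U 1) i) (compMul LinearMap.id x) a =
        ι U x * gconv (LinearMap.mul k _) (proj U 1) LinearMap.id a := by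
      refine gconv_congr_map (LinearMap.mulLeft k (ι U x)) ha ?_
      rintro n₁ n₂ p₁ p₂ b c - - hb hc
      have hp : proj U 1 (signPow U i b) = signPow U i (proj U 1 b) := by
        rw [signPow_of_isMonomial i hb, map_units_smul, proj_of_isMonomial hb]
        split_ifs
        · rw [signPow_of_isMonomial i hb]
        · simp
      simp only [compSign_apply, hp, compMul_apply, LinearMap.id_apply, LinearMap.mul_apply',
        LinearMap.mulLeft_apply]
      rw [← mul_assoc, ← ι_mul_comm hx, mul_assoc]
    rw [gconv_ι_mul _ _ _ hx, h₁, h₂, ih]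
    push_cast
    rw [add_smul, one_smul, mul_smul_comm, add_comm]

theorem proj_conv_proj_one_id (j : ℕ) (a : GSym U) :
    proj U j (conv (proj U 1) LinearMap.id a) = (j : k) • proj U j a := by
  induction a using induction_monomial with
  | mono n p a ha =>
    rw [conv_proj_one_id ha, map_smul, proj_of_isMonomial ha]
    split_ifs with h
    · rw [h]
    · simp
  | zero => simp
  | add b c hb hc => simp only [map_add, hb, hc, smul_add]
  | smul r b hb => simp only [map_smul, hb]; rw [smul_comm]

/-- In characteristic zero the Euler operator is invertible on positive weights, and the counit
accounts for weight zero. -/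
theorem eq_of_conv_proj_one_id [CharZero k] {a b : GSym U} (h₀ : counit U a = counit U b)
    (h : conv (proj U 1) LinearMap.id a = conv (proj U 1) LinearMap.id b) : a = b := by
  refine eq_of_proj_eq fun j => ?_
  cases j with
  | zero => rw [proj_zero_apply, proj_zero_apply, h₀]
  | succ j =>
    have hj : ((j + 1 : ℕ) : k) ≠ 0 := by exact_mod_cast j.succ_ne_zero
    have h' := congrArg (proj U (j + 1)) h
    rw [proj_conv_proj_one_id, proj_conv_proj_one_id] at h'
    exact smul_right_injective _ hj h'

theorem IsCoalgHom.conv_comp {F : GSym U →ₗ[k] GSym U'} (hF : IsCoalgHom F) {B : Type*} [Ring B]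
    [Algebra k B] (f g : GSym U' →ₗ[k] B) : conv f g ∘ₗ F = conv (f ∘ₗ F) (g ∘ₗ F) := by
  rw [conv, conv, LinearMap.comp_assoc, LinearMap.comp_assoc, hF.comul, TensorProduct.map_comp,
    LinearMap.comp_assoc]

/-- The uniqueness half of cofreeness. The Euler operator composed with `F` is `(proj U' 1 ∘ F) *
F`, and the left factor vanishes at `1`. So the right factor is only evaluated in smaller weight,
where induction applies. -/
theorem IsCoalgHom.ext [CharZero k] {F G : GSym U →ₗ[k] GSym U'} (hF : IsCoalgHom F)
    (hG : IsCoalgHom G) (h : proj U' 1 ∘ₗ F = proj U' 1 ∘ₗ G) : F = G := by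
  refine linearMap_ext fun n p a ha => ?_
  induction n using Nat.strong_induction_on generalizing p a with
  | _ n ih =>
    refine eq_of_conv_proj_one_id ?_ ?_
    · exact DFunLike.congr_fun (hF.counit.trans hG.counit.symm) a
    · rw [← LinearMap.comp_apply, ← LinearMap.comp_apply, hF.conv_comp, hG.conv_comp, h,
        conv_eq_gconv, conv_eq_gconv]
      refine gconv_congr ha ?_
      rintro n₁ n₂ p₁ p₂ b c hn - hb hc
      cases hb with
      | one =>
        rw [LinearMap.comp_apply, hG.map_one, proj_of_isMonomial .one]
        simp
      | cons hx hb =>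
        rw [LinearMap.id_comp, LinearMap.id_comp, ih n₂ (by omega) _ _ hc]

theorem IsCoalgHom.eq_expMap [CharZero k] {F : GSym U →ₗ[k] GSym U'} (hF : IsCoalgHom F)
    (hp : IsCogen 0 (proj U' 1 ∘ₗ F)) : F = expMap (proj U' 1 ∘ₗ F) :=
  hF.ext hp.isCoalgHom_expMap (proj_one_expMap hp).symm

theorem IsOddCoder.conv_comp {D : GSym U →ₗ[k] GSym U} (hD : IsOddCoder D) {B : Type*} [Ring B]
    [Algebra k B] (f g : GSym U →ₗ[k] B) :
    conv f g ∘ₗ D = conv (f ∘ₗ D) g + conv (f ∘ₗ (sign U).toLinearMap) (g ∘ₗ D) := by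
  ext a
  have h := DFunLike.congr_fun hD.coderivation a
  rw [LinearMap.comp_apply] at h
  simp only [conv, LinearMap.comp_apply, LinearMap.add_apply, h]
  generalize comul U a = t
  induction t using TensorProduct.induction_on with
  | zero => simp
  | tmul b c => simp
  | add s t hs ht => 
    simp only [map_add] at hs ht ⊢
    rw [add_add_add_comm, hs, ht, add_add_add_comm]

/-- The counit `η` is an idempotent for convolution, so the Leibniz rule gives `η D = η D + η D`. -/
theorem IsOddCoder.counit [CharZero k] {D : GSym U →ₗ[k] GSym U} (hD : IsOddCoder D) (a : GSym U) :
    GSym.counit U (D a) = 0 := by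
  set η := convPow (0 : GSym U →ₗ[k] k) 0 with hη
  have h := hD.conv_comp η η
  have hs : η ∘ₗ (sign U).toLinearMap = η := by
    refine linearMap_ext fun n p b hb => ?_
    have h := HasParity.convPow (f := (0 : GSym U →ₗ[k] GSym U)) (fun _ _ => by simp) 0 1 b
    have h' := congrArg (GSym.counit U) h
    simpa [signPow, convPow_zero_apply, hη] using h'.symm
  rw [hs, conv_convPow_zero, convPow_zero_conv, conv_convPow_zero, left_eq_add] at h
  exact DFunLike.congr_fun h a

/-- As for coalgebra morphisms: the Leibniz rule for the Euler operator has one term that only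
involves the projection to `U`, and another in which the coderivation is applied in smaller weight.
-/
theorem IsOddCoder.ext [CharZero k] {D E : GSym U →ₗ[k] GSym U} (hD : IsOddCoder D)
    (hE : IsOddCoder E) (h : proj U 1 ∘ₗ D = proj U 1 ∘ₗ E) : D = E := by
  refine linearMap_ext fun n p a ha => ?_
  induction n using Nat.strong_induction_on generalizing p a with
  | _ n ih =>
    refine eq_of_conv_proj_one_id ?_ ?_
    · rw [hD.counit, hE.counit]
    · rw [← LinearMap.comp_apply, ← LinearMap.comp_apply, hD.conv_comp, hE.conv_comp, h,
        LinearMap.add_apply, LinearMap.add_apply]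
      congr 1
      rw [conv_eq_gconv, conv_eq_gconv]
      refine gconv_congr ha ?_
      rintro n₁ n₂ p₁ p₂ b c hn - hb hc
      cases hb with
      | one => simp [proj_of_isMonomial (IsMonomial.one (U := U))]
      | cons hx hb =>
        rw [LinearMap.id_comp, LinearMap.id_comp, ih n₂ (by omega) _ _ hc]

/-- The term `l(a') a''` has weight one more than `a''`, so only the terms with `a''` of weight zero
reach `U`. -/
theorem proj_one_conv_id {l : GSym U →ₗ[k] GSym U} (hl : ∀ a, l a ∈ LinearMap.range (ι U)) :
    proj U 1 ∘ₗ conv l LinearMap.id = l := by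
  refine linearMap_ext fun n p a ha => ?_
  have h := DFunLike.congr_fun (conv_convPow_zero l l) a
  rw [← h, LinearMap.comp_apply, conv_eq_gconv, conv_eq_gconv]
  refine (gconv_congr_map (proj U 1) ha ?_).symm
  rintro n₁ n₂ p₁ p₂ b c - - hb hc
  rw [← symPow_one (U := U)] at hl
  rw [LinearMap.mul_apply', LinearMap.mul_apply', LinearMap.id_apply,
    proj_of_mem_symPow (mul_mem_symPow (hl b) hc.mem_symPow), convPow_zero_apply]
  cases hc with
  | one => simp
  | cons hx hc => simp [counit]

theorem IsOddCoder.eq_conv [CharZero k] {D : GSym U →ₗ[k] GSym U} (hD : IsOddCoder D)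
    (hp : IsCogen 1 (proj U 1 ∘ₗ D)) : D = conv (proj U 1 ∘ₗ D) LinearMap.id :=
  hD.ext hp.isOddCoder (proj_one_conv_id hp.mem_range).symm

end Coalgebra

end GSym

/-! ### Power series of linear maps -/

section PowerSeries

variable {A B C : Type*} [Ring A] [Algebra k A] [Ring B] [Algebra k B] [Ring C] [Algebra k C]

theorem hcoeff_ext {f g : A →ₗ[k] B⟦X⟧} (h : ∀ m, hcoeff f m = hcoeff g m) : f = g := by
  ext a m
  exact DFunLike.congr_fun (h m) a

@[simp]
theorem hcoeff_hmk (f : ℕ → A →ₗ[k] B) (m : ℕ) : hcoeff (hmk f) m = f m := by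
  ext a
  simp [hcoeff, hmk]

theorem coeff_apply_eq_hcoeff (f : A →ₗ[k] B⟦X⟧) (m : ℕ) (a : A) :
    PowerSeries.coeff m (f a) = hcoeff f m a := rfl

theorem coeff_hExt (f : A →ₗ[k] B⟦X⟧) (a : A⟦X⟧) (n : ℕ) :
    PowerSeries.coeff n (hExt f a) =
      ∑ p ∈ Finset.HasAntidiagonal.antidiagonal n, hcoeff f p.1 (PowerSeries.coeff p.2 a) := by
  simp [hExt]

theorem hExt_comp (f : B →ₗ[k] C⟦X⟧) (g : A →ₗ[k] B⟦X⟧) :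
    hExt (hExt f ∘ₗ g) = hExt f ∘ₗ hExt g := by
  ext a n
  have h : ∀ (p : ℕ) (c : A), hcoeff (hExt f ∘ₗ g) p c =
      ∑ q ∈ Finset.HasAntidiagonal.antidiagonal p, hcoeff f q.1 (hcoeff g q.2 c) :=
    fun p c => coeff_hExt f (g c) p
  simp only [LinearMap.comp_apply, coeff_hExt, h, map_sum, Finset.sum_sigma']
  refine Finset.sum_nbij' (fun x => ⟨(x.2.1, x.2.2 + x.1.2), (x.2.2, x.1.2)⟩)
    (fun x => ⟨(x.1.1 + x.2.1, x.2.2), (x.1.1, x.2.1)⟩) ?_ ?_ ?_ ?_ ?_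
  · rintro ⟨⟨a, b⟩, c, d⟩ h
    simp only [Finset.mem_sigma, Finset.HasAntidiagonal.mem_antidiagonal, and_true] at h ⊢
    obtain ⟨rfl, rfl⟩ := h
    ring
  · rintro ⟨⟨a, b⟩, c, d⟩ h
    simp only [Finset.mem_sigma, Finset.HasAntidiagonal.mem_antidiagonal, and_true] at h ⊢
    obtain ⟨rfl, rfl⟩ := h
    ring
  · rintro ⟨⟨a, b⟩, c, d⟩ h
    simp only [Finset.mem_sigma, Finset.HasAntidiagonal.mem_antidiagonal] at h
    obtain ⟨-, rfl⟩ := h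
    rfl
  · rintro ⟨⟨a, b⟩, c, d⟩ h
    simp only [Finset.mem_sigma, Finset.HasAntidiagonal.mem_antidiagonal] at h
    obtain ⟨-, rfl⟩ := h
    rfl
  · rintro ⟨⟨a, b⟩, c, d⟩ -
    rfl

theorem coeff_hExt_monomial (f : A →ₗ[k] B⟦X⟧) (r : ℕ) (c : A) (n : ℕ) :
    PowerSeries.coeff n (hExt f (PowerSeries.monomial r c)) =
      if r ≤ n then hcoeff f (n - r) c else 0 := by
  rw [coeff_hExt]
  split_ifs with h
  · rw [Finset.sum_eq_single (n - r, r)]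
    · simp
    · rintro ⟨i, j⟩ hij hne
      rw [Finset.HasAntidiagonal.mem_antidiagonal] at hij
      rw [PowerSeries.coeff_monomial, if_neg, map_zero]
      rintro rfl
      exact hne (by simp [← hij])
    · intro h'
      simp [h] at h'
  · refine Finset.sum_eq_zero fun p hp => ?_
    rw [Finset.HasAntidiagonal.mem_antidiagonal] at hp
    rw [PowerSeries.coeff_monomial, if_neg (by omega), map_zero]

end PowerSeries

namespace GSym

/-! ### The weight filtration and the twist by powers of `ħ`. -/

section Twist

variable {U U' U'' : GradedSpace.{u, v} k}

/-- The sum of the `S^j(U)` with `j ≤ n`. -/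
def fil (U : GradedSpace.{u, v} k) (n : ℕ) : Submodule k (GSym U) :=
  Submodule.span k {a | ∃ j ≤ n, ∃ p, IsMonomial U j p a}

theorem symPow_le_fil {j n : ℕ} (h : j ≤ n) : symPow U j ≤ fil U n := by
  rw [symPow_eq_span]
  exact Submodule.span_mono fun a ⟨p, ha⟩ => ⟨j, h, p, ha⟩

theorem fil_mono {m n : ℕ} (h : m ≤ n) : fil U m ≤ fil U n :=
  Submodule.span_mono fun _ ⟨j, hj, p, ha⟩ => ⟨j, hj.trans h, p, ha⟩

theorem fil_induction {n : ℕ} {P : ∀ a, a ∈ fil U n → Prop}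
    (mono : ∀ (j : ℕ) (hj : j ≤ n) (p : ℤ) (b : GSym U) (hb : IsMonomial U j p b),
      P b (Submodule.subset_span ⟨j, hj, p, hb⟩))
    (zero : P 0 (zero_mem _))
    (add : ∀ b c hb hc, P b hb → P c hc → P (b + c) (add_mem hb hc))
    (smul : ∀ (r : k) b hb, P b hb → P (r • b) (Submodule.smul_mem _ r hb)) {a : GSym U}
    (ha : a ∈ fil U n) : P a ha := by
  refine Submodule.span_induction (p := P) ?_ zero add smul ha
  rintro b ⟨j, hj, p, hb⟩
  exact mono j hj p b hb

theorem proj_of_mem_fil {n j : ℕ} (h : n < j) {a : GSym U} (ha : a ∈ fil U n) :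
    proj U j a = 0 := by
  induction ha using fil_induction with
  | mono i hi p b hb => rw [proj_of_isMonomial hb, if_neg (by omega)]
  | zero => simp
  | add b c _ _ hb hc => rw [map_add, hb, hc, add_zero]
  | smul r b _ hb => rw [map_smul, hb, smul_zero]

theorem mul_mem_fil {m n : ℕ} {a b : GSym U} (ha : a ∈ fil U m) (hb : b ∈ fil U n) :
    a * b ∈ fil U (m + n) := by
  induction ha using fil_induction with
  | mono i hi p a ha =>
    induction hb using fil_induction with
    | mono j hj q b hb => exact Submodule.subset_span ⟨_, add_le_add hi hj, _, ha.mul hb⟩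
    | zero => simp
    | add b c _ _ hb hc => rw [mul_add]; exact add_mem hb hc
    | smul r b _ hb => rw [mul_smul_comm]; exact Submodule.smul_mem _ _ hb
  | zero => simp
  | add b c _ _ hb hc => rw [add_mul]; exact add_mem hb hc
  | smul r b _ hb => rw [smul_mul_assoc]; exact Submodule.smul_mem _ _ hb

/-- `T` does not increase the weight. -/
def IsFiltered (T : GSym U →ₗ[k] GSym U') : Prop :=
  ∀ n p a, IsMonomial U n p a → T a ∈ fil U' n

theorem IsFiltered.map_fil {T : GSym U →ₗ[k] GSym U'} (hT : IsFiltered T) {n : ℕ} {a : GSym U}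
    (ha : a ∈ fil U n) : T a ∈ fil U' n := by
  induction ha using fil_induction with
  | mono i hi p a ha => exact fil_mono hi (hT _ _ _ ha)
  | zero => simp
  | add b c _ _ hb hc => rw [map_add]; exact add_mem hb hc
  | smul r b _ hb => rw [map_smul]; exact Submodule.smul_mem _ _ hb

theorem IsFiltered.comp {T : GSym U' →ₗ[k] GSym U''} {S : GSym U →ₗ[k] GSym U'}
    (hT : IsFiltered T) (hS : IsFiltered S) : IsFiltered (T ∘ₗ S) :=
  fun n p a ha => hT.map_fil (hS n p a ha)

theorem IsFiltered.id : IsFiltered (LinearMap.id : GSym U →ₗ[k] GSym U) :=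
  fun _ _ _ ha => symPow_le_fil le_rfl ha.mem_symPow

theorem IsFiltered.conv {S T : GSym U →ₗ[k] GSym U'} (hS : IsFiltered S) (hT : IsFiltered T) :
    IsFiltered (conv S T) := by
  intro n p a ha
  rw [conv_eq_gconv]
  refine gconv_mem _ ha ?_
  rintro n₁ n₂ p₁ p₂ b c rfl - hb hc
  exact mul_mem_fil (hS _ _ _ hb) (hT _ _ _ hc)

theorem IsCogen.isFiltered {e : ℤ} {f : GSym U →ₗ[k] GSym U'} (hf : IsCogen e f) :
    IsFiltered f := by
  intro n p a ha
  cases ha with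
  | one => rw [hf.map_one]; exact zero_mem _
  | cons hx ha =>
    refine symPow_le_fil (j := 1) (by omega) ?_
    rw [symPow_one]
    exact hf.mem_range _

theorem IsCogen.isFiltered_convPow {f : GSym U →ₗ[k] GSym U'} (hf : IsCogen 0 f) (j : ℕ) :
    IsFiltered (convPow f j) := by
  intro n p a ha
  by_cases h : n < j
  · rw [convPow_apply_eq_zero hf.map_one ha h]; exact zero_mem _
  · exact symPow_le_fil (by omega) (convPow_mem_symPow hf j a)

theorem IsCogen.isFiltered_expMap {f : GSym U →ₗ[k] GSym U'} (hf : IsCogen 0 f) :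
    IsFiltered (expMap f) := by
  intro n p a ha
  rw [expMap_of_isMonomial hf.map_one ha le_rfl]
  exact Submodule.sum_mem _ fun j _ =>
    Submodule.smul_mem _ _ (hf.isFiltered_convPow j n p a ha)

/-- The map that multiplies the component of weight `j` by `ħ^(n-j)`. -/
def homogenize (U : GradedSpace.{u, v} k) (n : ℕ) : GSym U →ₗ[k] (GSym U)⟦X⟧ :=
  hmk fun m => if m ≤ n then proj U (n - m) else 0

theorem coeff_homogenize (n m : ℕ) (a : GSym U) :
    PowerSeries.coeff m (homogenize U n a) = if m ≤ n then proj U (n - m) a else 0 := by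
  rw [coeff_apply_eq_hcoeff, homogenize, hcoeff_hmk]
  split_ifs <;> simp

theorem homogenize_of_mem_symPow {j n : ℕ} (h : j ≤ n) {a : GSym U} (ha : a ∈ symPow U j) :
    homogenize U n a = PowerSeries.monomial (n - j) a := by
  ext m
  rw [coeff_homogenize, PowerSeries.coeff_monomial, proj_of_mem_symPow ha]
  split_ifs <;> first | rfl | omega

/-- The exponents `m - i` and `n - j` add up because the truncated subtractions are honest ones: `a`
and `b` have weights at most `m` and `n`. -/
theorem homogenize_mul {m n : ℕ} {a b : GSym U} (ha : a ∈ fil U m) (hb : b ∈ fil U n) :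
    homogenize U (m + n) (a * b) = homogenize U m a * homogenize U n b := by
  induction ha using fil_induction with
  | mono i hi p a ha =>
    induction hb using fil_induction with
    | mono j hj q b hb =>
      rw [homogenize_of_mem_symPow hi ha.mem_symPow, homogenize_of_mem_symPow hj hb.mem_symPow,
        homogenize_of_mem_symPow (add_le_add hi hj) (ha.mul hb).mem_symPow,
        PowerSeries.monomial_mul_monomial]
      congr 2
      omega
    | zero => simp
    | add b c _ _ hb hc => rw [mul_add, map_add, map_add, hb, hc, mul_add]
    | smul r b _ hb => rw [mul_smul_comm, map_smul, map_smul, hb, mul_smul_comm]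
  | zero => simp
  | add b c _ _ hb hc => rw [add_mul, map_add, map_add, hb, hc, add_mul]
  | smul r b _ hb => rw [smul_mul_assoc, map_smul, map_smul, hb, smul_mul_assoc]

/-- The map that multiplies the component `S^n(U) → S^j(U')` of `T` by `ħ^(n-j)`. -/
def twist (T : GSym U →ₗ[k] GSym U') : GSym U →ₗ[k] (GSym U')⟦X⟧ :=
  hmk fun m => ofWeights fun n => if m ≤ n then proj U' (n - m) ∘ₗ T else 0

theorem hcoeff_twist (T : GSym U →ₗ[k] GSym U') (m : ℕ) {n : ℕ} {p : ℤ} {a : GSym U}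
    (ha : IsMonomial U n p a) :
    hcoeff (twist T) m a = if m ≤ n then proj U' (n - m) (T a) else 0 := by
  rw [twist, hcoeff_hmk, ofWeights_of_isMonomial _ ha]
  split_ifs <;> simp

theorem twist_of_isMonomial (T : GSym U →ₗ[k] GSym U') {n : ℕ} {p : ℤ} {a : GSym U}
    (ha : IsMonomial U n p a) : twist T a = homogenize U' n (T a) := by
  ext m
  rw [coeff_apply_eq_hcoeff, hcoeff_twist T m ha, coeff_homogenize]

/-- Components that raise the weight are discarded by `twist`. If there are none, the component from
weight `n` to weight `j` is read off from the coefficient of `ħ^(n-j)`. -/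
theorem twist_injective {S T : GSym U →ₗ[k] GSym U'} (hS : IsFiltered S) (hT : IsFiltered T)
    (h : twist S = twist T) : S = T := by
  refine linearMap_ext fun n p a ha => eq_of_proj_eq fun j => ?_
  by_cases hj : n < j
  · rw [proj_of_mem_fil hj (hS n p a ha), proj_of_mem_fil hj (hT n p a ha)]
  · have h' := DFunLike.congr_fun (congrArg (fun f => hcoeff f (n - j)) h) a
    simp only [hcoeff_twist _ _ ha] at h'
    rwa [if_pos (by omega), if_pos (by omega), Nat.sub_sub_self (by omega)] at h'

theorem conv_twist {S T : GSym U →ₗ[k] GSym U'} (hS : IsFiltered S) (hT : IsFiltered T) :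
    conv (twist S) (twist T) = twist (conv S T) := by
  refine linearMap_ext fun n p a ha => ?_
  rw [twist_of_isMonomial _ ha, conv_eq_gconv, conv_eq_gconv]
  refine gconv_congr_map (homogenize U' n) ha ?_
  rintro n₁ n₂ p₁ p₂ b c rfl - hb hc
  rw [LinearMap.mul_apply', LinearMap.mul_apply', homogenize_mul (hS _ _ _ hb) (hT _ _ _ hc),
    twist_of_isMonomial _ hb, twist_of_isMonomial _ hc]

theorem convPow_twist {f : GSym U →ₗ[k] GSym U'} (hf : IsCogen 0 f) (j : ℕ) :
    convPow (twist f) j = twist (convPow f j) := by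
  induction j with
  | zero =>
    refine linearMap_ext fun n p a ha => ?_
    rw [twist_of_isMonomial _ ha, convPow_zero_apply, convPow_zero_apply]
    cases ha with
    | one =>
      rw [map_one, map_one, map_one, homogenize_of_mem_symPow le_rfl IsMonomial.one.mem_symPow]
      simp
    | cons hx ha => simp [counit]
  | succ j ih => rw [convPow, ih, conv_twist (hf.isFiltered_convPow j) hf.isFiltered, convPow]

theorem IsCogen.twist_one {e : ℤ} {f : GSym U →ₗ[k] GSym U'} (hf : IsCogen e f) :
    twist f 1 = 0 := by
  rw [twist_of_isMonomial f .one, hf.map_one, map_zero]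

/-- `twist` is linear and multiplicative for convolution, and the exponential is a series in
convolution powers. -/
theorem expMap_twist {f : GSym U →ₗ[k] GSym U'} (hf : IsCogen 0 f) :
    expMap (twist f) = twist (expMap f) := by
  refine linearMap_ext fun n p a ha => ?_
  rw [twist_of_isMonomial _ ha, expMap_of_isMonomial hf.twist_one ha le_rfl,
    expMap_of_isMonomial hf.map_one ha le_rfl, map_sum]
  simp only [convPow_twist hf, twist_of_isMonomial _ ha, map_smul]

theorem hExt_twist_homogenize {T : GSym U →ₗ[k] GSym U'} (hT : IsFiltered T) {n : ℕ} {a : GSym U}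
    (ha : a ∈ fil U n) : hExt (twist T) (homogenize U n a) = homogenize U' n (T a) := by
  induction ha using fil_induction with
  | mono j hj p a ha =>
    rw [homogenize_of_mem_symPow hj ha.mem_symPow]
    ext m
    rw [coeff_hExt_monomial, coeff_homogenize, hcoeff_twist T _ ha]
    by_cases h₁ : n - j ≤ m
    · rw [if_pos h₁]
      by_cases h₂ : m ≤ n
      · rw [if_pos (by omega), if_pos h₂]
        congr 2
        omega
      · rw [if_neg (by omega), if_neg h₂]
    -- For `m < n - j` the weight `n - m` exceeds `j`, and `T` cannot reach it from weight `j`.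
    · rw [if_neg h₁, proj_of_mem_fil (by omega) (hT _ _ _ ha)]
      simp
  | zero => simp
  | add b c _ _ hb hc => simp only [map_add, hb, hc]
  | smul r b _ hb => simp only [map_smul, hb]

/-- Along `S^n → S^i → S^j` the exponents telescope: `ħ^(n-i) ħ^(i-j) = ħ^(n-j)`. -/
theorem hExt_twist_comp_twist {T : GSym U' →ₗ[k] GSym U''} {S : GSym U →ₗ[k] GSym U'}
    (hT : IsFiltered T) (hS : IsFiltered S) :
    hExt (twist T) ∘ₗ twist S = twist (T ∘ₗ S) := by
  refine linearMap_ext fun n p a ha => ?_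
  rw [LinearMap.comp_apply, twist_of_isMonomial _ ha, twist_of_isMonomial _ ha,
    hExt_twist_homogenize hT (hS _ _ _ ha), LinearMap.comp_apply]

theorem hcoeff_twist_id (m : ℕ) :
    hcoeff (twist (LinearMap.id : GSym U →ₗ[k] GSym U)) m = if m = 0 then LinearMap.id else 0 := by
  refine linearMap_ext fun n p a ha => ?_
  rw [hcoeff_twist _ _ ha, LinearMap.id_apply, proj_of_isMonomial ha]
  split_ifs with h₁ h₂ h₃ h₃ h₃ <;> first | rfl | omega

theorem hExt_twist_id : hExt (twist (LinearMap.id : GSym U →ₗ[k] GSym U)) = LinearMap.id := by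
  ext a n
  rw [coeff_hExt, Finset.sum_eq_single (0, n)]
  · simp [hcoeff_twist_id]
  · rintro ⟨i, j⟩ hij hne
    rw [Finset.HasAntidiagonal.mem_antidiagonal] at hij
    rw [hcoeff_twist_id, if_neg, LinearMap.zero_apply]
    rintro rfl
    exact hne (by simp [← hij])
  · intro h
    simp at h

/-- The twist of the identity is the inclusion of `S(U)` as constant power series. -/
theorem hExt_comp_twist_id {B : Type*} [Ring B] [Algebra k B] (f : GSym U →ₗ[k] B⟦X⟧) :
    hExt f ∘ₗ twist LinearMap.id = f := by
  ext a n
  rw [LinearMap.comp_apply, coeff_hExt, Finset.sum_eq_single (n, 0)]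
  · simp [coeff_apply_eq_hcoeff, hcoeff_twist_id]
  · rintro ⟨i, j⟩ hij hne
    rw [Finset.HasAntidiagonal.mem_antidiagonal] at hij
    rw [coeff_apply_eq_hcoeff, hcoeff_twist_id, if_neg, LinearMap.zero_apply, map_zero]
    rintro rfl
    exact hne (by simp [← hij])
  · intro h
    simp at h

/-! ### Degrees -/

/-- The component of degree `q` of `S(U)` if `U` is given the degrees of `U[2]`. -/
def shiftedDeg (U : GradedSpace.{u, v} k) (q : ℤ) : Submodule k (GSym U) :=
  Submodule.span k {a | ∃ n p, IsMonomial U n p a ∧ p - 2 * n = q}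

theorem IsMonomial.mem_shiftedDeg {n : ℕ} {p : ℤ} {a : GSym U} (ha : IsMonomial U n p a) :
    a ∈ shiftedDeg U (p - 2 * n) :=
  Submodule.subset_span ⟨n, p, ha, rfl⟩

theorem proj_mem_shiftedDeg_of_mem_deg {p : ℤ} {a : GSym U} (ha : a ∈ deg U p) (j : ℕ) :
    proj U j a ∈ shiftedDeg U (p - 2 * j) := by
  rw [deg_eq_span] at ha
  induction ha using Submodule.span_induction with
  | mem a ha =>
    obtain ⟨n, ha⟩ := ha
    rw [proj_of_isMonomial ha]
    split_ifs with h
    · exact h ▸ ha.mem_shiftedDeg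
    · exact zero_mem _
  | zero => simp
  | add a b _ _ ha hb => rw [map_add]; exact add_mem ha hb
  | smul c a _ ha => rw [map_smul]; exact Submodule.smul_mem _ _ ha

theorem proj_mem_deg_of_mem_shiftedDeg {q : ℤ} {a : GSym U} (ha : a ∈ shiftedDeg U q) (j : ℕ) :
    proj U j a ∈ deg U (q + 2 * j) := by
  rw [shiftedDeg] at ha
  induction ha using Submodule.span_induction with
  | mem a ha =>
    obtain ⟨n, p, ha, rfl⟩ := ha
    rw [proj_of_isMonomial ha]
    split_ifs with h
    · rw [h, sub_add_cancel]; exact ha.mem_deg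
    · exact zero_mem _
  | zero => simp
  | add a b _ _ ha hb => rw [map_add]; exact add_mem ha hb
  | smul c a _ ha => rw [map_smul]; exact Submodule.smul_mem _ _ ha

theorem proj_mem_shiftedDeg {q : ℤ} {a : GSym U} (ha : a ∈ shiftedDeg U q) (j : ℕ) :
    proj U j a ∈ shiftedDeg U q := by
  have h := proj_mem_shiftedDeg_of_mem_deg (proj_mem_deg_of_mem_shiftedDeg ha j) j
  rwa [proj_proj, if_pos rfl, add_sub_cancel_right] at h

theorem one_mem_shiftedDeg : (1 : GSym U) ∈ shiftedDeg U 0 := by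
  simpa using (IsMonomial.one (U := U)).mem_shiftedDeg

theorem mul_mem_shiftedDeg {q r : ℤ} {a b : GSym U} (ha : a ∈ shiftedDeg U q)
    (hb : b ∈ shiftedDeg U r) : a * b ∈ shiftedDeg U (q + r) := by
  have h := Submodule.mul_mem_mul ha hb
  rw [shiftedDeg, shiftedDeg, Submodule.span_mul_span] at h
  refine Submodule.span_mono ?_ h
  rintro _ ⟨c, ⟨n, p, hc, rfl⟩, d, ⟨n', p', hd, rfl⟩, rfl⟩
  exact ⟨_, _, hc.mul hd, by push_cast; ring⟩

theorem signPow_of_mem_shiftedDeg (j : ℤ) {q : ℤ} {a : GSym U} (ha : a ∈ shiftedDeg U q) :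
    signPow U j a = koszul j q • a := by
  rw [shiftedDeg] at ha
  induction ha using Submodule.span_induction with
  | mem a ha =>
    obtain ⟨n, p, ha, rfl⟩ := ha
    rw [signPow_of_isMonomial j ha]
    congr 1
    rw [sub_eq_add_neg, koszul_add_right, koszul_symm (-(2 * (n : ℤ))) j,
      koszul_of_even_left (even_two_mul (n : ℤ)).neg, mul_one]
  | zero => simp
  | add a b _ _ ha hb => rw [map_add, ha, hb, smul_add]
  | smul c a _ ha => rw [map_smul, ha, smul_comm]

theorem hasDegree_of_isMonomial {d : ℤ} {T : GSym U →ₗ[k] GSym U'}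
    (h : ∀ n p a, IsMonomial U n p a → T a ∈ shiftedDeg U' (p - 2 * n + d)) :
    HasDegree (shiftedDeg U) (shiftedDeg U') d T := by
  intro q a ha
  rw [shiftedDeg] at ha
  induction ha using Submodule.span_induction with
  | mem a ha =>
    obtain ⟨n, p, ha, rfl⟩ := ha
    exact h n p a ha
  | zero => simp
  | add a b _ _ ha hb => rw [map_add]; exact add_mem ha hb
  | smul c a _ ha => rw [map_smul]; exact Submodule.smul_mem _ _ ha

theorem _root_.HomotopyBV.HasDegree.hasParity {d : ℤ} {T : GSym U →ₗ[k] GSym U'}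
    (hT : HasDegree (shiftedDeg U) (shiftedDeg U') d T) : HasParity d T := by
  intro j a
  induction a using induction_monomial with
  | mono n p a ha =>
    rw [signPow_of_mem_shiftedDeg j (hT _ _ ha.mem_shiftedDeg),
      signPow_of_mem_shiftedDeg j ha.mem_shiftedDeg, map_units_smul, smul_smul, koszul_add_right,
      koszul_symm d j, mul_comm]
  | zero => simp
  | add b c hb hc => simp only [map_add, hb, hc, smul_add]
  | smul r b hb => simp only [map_smul, hb]; rw [smul_comm]

theorem _root_.HomotopyBV.HasDegree.conv {d e : ℤ} {S T : GSym U →ₗ[k] GSym U'}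
    (hS : HasDegree (shiftedDeg U) (shiftedDeg U') d S)
    (hT : HasDegree (shiftedDeg U) (shiftedDeg U') e T) :
    HasDegree (shiftedDeg U) (shiftedDeg U') (d + e) (conv S T) := by
  refine hasDegree_of_isMonomial fun n p a ha => ?_
  rw [conv_eq_gconv]
  refine gconv_mem _ ha ?_
  rintro n₁ n₂ p₁ p₂ b c rfl rfl hb hc
  have h := mul_mem_shiftedDeg (hS _ _ hb.mem_shiftedDeg) (hT _ _ hc.mem_shiftedDeg)
  rw [LinearMap.mul_apply']
  convert h using 2
  push_cast
  ring

theorem hasDegree_id : HasDegree (shiftedDeg U) (shiftedDeg U) 0 LinearMap.id :=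
  fun p a ha => by simpa using ha

theorem hasDegree_convPow {f : GSym U →ₗ[k] GSym U'}
    (hf : HasDegree (shiftedDeg U) (shiftedDeg U') 0 f) (j : ℕ) :
    HasDegree (shiftedDeg U) (shiftedDeg U') 0 (convPow f j) := by
  induction j with
  | zero =>
    refine hasDegree_of_isMonomial fun n p a ha => ?_
    rw [convPow_zero_apply]
    cases ha with
    | one => simpa using one_mem_shiftedDeg
    | cons hx ha => simp [counit]
  | succ j ih =>
    have h := HasDegree.conv ih hf
    rwa [add_zero] at h

theorem hasDegree_expMap {f : GSym U →ₗ[k] GSym U'} (hf₁ : f 1 = 0)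
    (hf : HasDegree (shiftedDeg U) (shiftedDeg U') 0 f) :
    HasDegree (shiftedDeg U) (shiftedDeg U') 0 (expMap f) := by
  refine hasDegree_of_isMonomial fun n p a ha => ?_
  rw [expMap_of_isMonomial hf₁ ha le_rfl]
  exact Submodule.sum_mem _ fun j _ =>
    Submodule.smul_mem _ _ (hasDegree_convPow hf j _ _ ha.mem_shiftedDeg)

/-- The coefficient of `ħ^m` lowers the weight by `m`, and passing from the degrees of `U[2]` to
those of `U` adds `2` per unit of weight. This accounts for the `-2 m`. -/
theorem hasDegree_hcoeff_twist {d : ℤ} {T : GSym U →ₗ[k] GSym U'}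
    (hT : HasDegree (shiftedDeg U) (shiftedDeg U') d T) (m : ℕ) :
    HasDegree (deg U) (deg U') (d - 2 * m) (hcoeff (twist T) m) := by
  intro p a ha
  rw [deg_eq_span] at ha
  induction ha using Submodule.span_induction with
  | mem a ha =>
    obtain ⟨n, ha⟩ := ha
    rw [hcoeff_twist T m ha]
    split_ifs with h
    · have h' := proj_mem_deg_of_mem_shiftedDeg (hT _ _ ha.mem_shiftedDeg) (n - m)
      convert h' using 2
      push_cast [h]
      ring
    · exact zero_mem _
  | zero => simp
  | add a b _ _ ha hb => rw [map_add]; exact add_mem ha hb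
  | smul c a _ ha => rw [map_smul]; exact Submodule.smul_mem _ _ ha

theorem mem_shiftedDeg_of_proj {q : ℤ} {a : GSym U} (h : ∀ j, proj U j a ∈ shiftedDeg U q) :
    a ∈ shiftedDeg U q := by
  obtain ⟨N, hN⟩ := exists_sum_proj a
  rw [hN N le_rfl]
  exact Submodule.sum_mem _ fun j _ => h j

/-- The converse needs `T` to be filtered, since the twist forgets components that raise the weight.
-/
theorem hasDegree_of_hcoeff_twist {d : ℤ} {T : GSym U →ₗ[k] GSym U'} (hT : IsFiltered T)
    (h : ∀ m : ℕ, HasDegree (deg U) (deg U') (d - 2 * m) (hcoeff (twist T) m)) :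
    HasDegree (shiftedDeg U) (shiftedDeg U') d T := by
  refine hasDegree_of_isMonomial fun n p a ha => mem_shiftedDeg_of_proj fun j => ?_
  by_cases hj : n < j
  · rw [proj_of_mem_fil hj (hT n p a ha)]; exact zero_mem _
  · have h' := proj_mem_shiftedDeg_of_mem_deg (h (n - j) p a ha.mem_deg) j
    rw [hcoeff_twist T _ ha, if_pos (by omega), Nat.sub_sub_self (by omega), proj_proj,
      if_pos rfl] at h'
    convert h' using 2
    push_cast [not_lt.1 hj]
    ring

end Twist

end GSym

/-! ### Iterated commutators -/

section Commutators

variable {A B : Type*} [Ring A] [Algebra k A] [Ring B] [Algebra k B]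

/-- All `N`-fold commutators of `D` with homogeneous elements vanish. -/
def CommVanish (𝒜 : ℤ → Submodule k A) (f : A →ₐ[k] B) (d : ℤ) (N : ℕ) (D : A →ₗ[k] B) : Prop :=
  ∀ l : List (ℤ × A), l.length = N → (∀ e ∈ l, e.2 ∈ 𝒜 e.1) → iterComm f d D l = 0

variable {𝒜 : ℤ → Submodule k A} {f : A →ₐ[k] B} {d : ℤ} {N : ℕ} {D E : A →ₗ[k] B}

theorem commVanish_zero_iff : CommVanish 𝒜 f d 0 D ↔ D = 0 := by
  constructor
  · intro h
    exact h [] rfl (by simp)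
  · rintro rfl l hl -
    rw [List.length_eq_zero_iff.1 hl]
    rfl

/-- The recursive form of the order condition; order `≤ n` is the case `N = n + 1`. -/
theorem commVanish_succ_iff : CommVanish 𝒜 f d (N + 1) D ↔
    ∀ i, ∀ a ∈ 𝒜 i, CommVanish 𝒜 f (d + i) N (comm f d D i a) := by
  constructor
  · intro h i a ha l hl hl'
    exact h ((i, a) :: l) (by simp [hl]) (by
      intro e he
      rcases List.mem_cons.1 he with rfl | he
      · exact ha
      · exact hl' e he)
  · rintro h (_ | ⟨⟨i, a⟩, l⟩) hl hl'
    · simp at hl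
    · exact h i a (hl' (i, a) List.mem_cons_self) l (by simpa using hl)
        fun e he => hl' e (List.mem_cons_of_mem _ he)

theorem comm_add (i : ℤ) (a : A) : comm f d (D + E) i a = comm f d D i a + comm f d E i a := by
  rw [comm, comm, comm, LinearMap.add_comp, LinearMap.comp_add, smul_add]
  abel

theorem comm_smul (r : k) (i : ℤ) (a : A) : comm f d (r • D) i a = r • comm f d D i a := by
  rw [comm, comm, LinearMap.smul_comp, LinearMap.comp_smul, smul_sub, smul_comm]

@[simp]
theorem comm_zero (i : ℤ) (a : A) : comm f d (0 : A →ₗ[k] B) i a = 0 := by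
  simp [comm]

theorem CommVanish.zero : CommVanish 𝒜 f d N (0 : A →ₗ[k] B) := by
  induction N generalizing d with
  | zero => exact commVanish_zero_iff.2 rfl
  | succ N ih =>
    rw [commVanish_succ_iff]
    intro i a _
    rw [comm_zero]
    exact ih

theorem CommVanish.add (hD : CommVanish 𝒜 f d N D) (hE : CommVanish 𝒜 f d N E) :
    CommVanish 𝒜 f d N (D + E) := by
  induction N generalizing d D E with
  | zero =>
    rw [commVanish_zero_iff] at *
    rw [hD, hE, add_zero]
  | succ N ih =>
    rw [commVanish_succ_iff] at *
    intro i a ha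
    rw [comm_add]
    exact ih (hD i a ha) (hE i a ha)

theorem CommVanish.smul (r : k) (hD : CommVanish 𝒜 f d N D) : CommVanish 𝒜 f d N (r • D) := by
  induction N generalizing d D with
  | zero =>
    rw [commVanish_zero_iff] at *
    rw [hD, smul_zero]
  | succ N ih =>
    rw [commVanish_succ_iff] at *
    intro i a ha
    rw [comm_smul]
    exact ih (hD i a ha)

theorem CommVanish.sub (hD : CommVanish 𝒜 f d N D) (hE : CommVanish 𝒜 f d N E) :
    CommVanish 𝒜 f d N (D - E) := by
  rw [sub_eq_add_neg, ← neg_one_smul k E]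
  exact hD.add (hE.smul _)

theorem CommVanish.units_smul (e : ℤˣ) (hD : CommVanish 𝒜 f d N D) :
    CommVanish 𝒜 f d N (e • D) := by
  rcases Int.units_eq_one_or e with rfl | rfl
  · simpa using hD
  · rw [Units.neg_smul, one_smul, ← neg_one_smul k]
    exact hD.smul _

end Commutators

namespace GSym

/-! ### Differential operators on `S(U)` and extensions of maps to cogenerators. -/

section DiffOp

variable {U U' : GradedSpace.{u, v} k}

theorem signPow_of_mem_deg (j : ℤ) {p : ℤ} {a : GSym U} (ha : a ∈ deg U p) :
    signPow U j a = koszul p j • a := by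
  rw [deg_eq_span] at ha
  induction ha using Submodule.span_induction with
  | mem a ha =>
    obtain ⟨n, ha⟩ := ha
    rw [signPow_of_isMonomial j ha, koszul_symm]
  | zero => simp
  | add a b _ _ ha hb => rw [map_add, ha, hb, smul_add]
  | smul c a _ ha => rw [map_smul, ha, smul_comm]

theorem mul_comm_of_mem_deg {p q : ℤ} {a b : GSym U} (ha : a ∈ deg U p) (hb : b ∈ deg U q) :
    a * b = koszul p q • (b * a) :=
  mul_comm_of_sign (fun j => signPow_of_mem_deg j ha) fun j => signPow_of_mem_deg j hb

theorem comm_id_apply (d i : ℤ) (D : GSym U →ₗ[k] GSym U) (a b : GSym U) :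
    comm (AlgHom.id k _) d D i a b = D (a * b) - koszul d i • (a * D b) := rfl

/-- Multiplication operators commute up to sign, so `[D L_c, L_a] = ± [D, L_a] L_c` and the order
does not grow. Together with `commVanish_mulLeft_comp` this reduces commutators with arbitrary
elements to those with generators. -/
theorem commVanish_comp_mulLeft {d q : ℤ} {N : ℕ} {D : GSym U →ₗ[k] GSym U}
    (hD : CommVanish (deg U) (AlgHom.id k _) d N D) {c : GSym U} (hc : c ∈ deg U q) :
    CommVanish (deg U) (AlgHom.id k _) (d + q) N (D ∘ₗ LinearMap.mulLeft k c) := by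
  induction N generalizing d D with
  | zero =>
    rw [commVanish_zero_iff] at *
    rw [hD, LinearMap.zero_comp]
  | succ N ih =>
    rw [commVanish_succ_iff] at *
    intro i a ha
    have h : comm (AlgHom.id k _) (d + q) (D ∘ₗ LinearMap.mulLeft k c) i a =
        koszul q i • (comm (AlgHom.id k _) d D i a ∘ₗ LinearMap.mulLeft k c) := by
      ext b
      simp only [comm_id_apply, LinearMap.comp_apply, LinearMap.smul_apply,
        LinearMap.mulLeft_apply, koszul_add_left]
      rw [← mul_assoc c a, mul_comm_of_mem_deg hc ha, smul_mul_assoc, map_units_smul, smul_sub,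
        smul_smul, mul_assoc, mul_comm (koszul d i)]
    rw [h, add_right_comm]
    exact (ih (hD i a ha)).units_smul _

theorem commVanish_mulLeft_comp {d q : ℤ} {N : ℕ} {D : GSym U →ₗ[k] GSym U}
    (hD : CommVanish (deg U) (AlgHom.id k _) d N D) {c : GSym U} (hc : c ∈ deg U q) :
    CommVanish (deg U) (AlgHom.id k _) (d + q) N (LinearMap.mulLeft k c ∘ₗ D) := by
  induction N generalizing d D with
  | zero =>
    rw [commVanish_zero_iff] at *
    rw [hD, LinearMap.comp_zero]
  | succ N ih =>
    rw [commVanish_succ_iff] at *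
    intro i a ha
    have h : comm (AlgHom.id k _) (d + q) (LinearMap.mulLeft k c ∘ₗ D) i a =
        LinearMap.mulLeft k c ∘ₗ comm (AlgHom.id k _) d D i a := by
      ext b
      simp only [comm_id_apply, LinearMap.comp_apply, LinearMap.mulLeft_apply, koszul_add_left,
        mul_sub, mul_smul_comm]
      rw [← mul_assoc a c, mul_comm_of_mem_deg ha hc, koszul_symm q i, smul_mul_assoc, smul_smul,
        mul_assoc (koszul d i), mul_assoc c a]
      rcases Int.units_eq_one_or (koszul q i) with h | h <;> simp [h]
    rw [h, add_right_comm]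
    exact ih (hD i a ha)

/-- Of the two terms of the Leibniz rule for `x a`, the one where `x` goes to the identity factor is
`± x D(a)`, which the commutator cancels. -/
theorem comm_conv_id {d : ℤ} {l : GSym U →ₗ[k] GSym U} (hl : HasParity d l) {i : ℤ}
    {x : U.carrier} (hx : x ∈ U.grading i) :
    comm (AlgHom.id k _) d (conv l LinearMap.id) i (ι U x) =
      conv (compMul l x) LinearMap.id := by
  refine linearMap_ext fun n p a ha => ?_
  have h : gconv (LinearMap.mul k _) (compSign l i) (compMul LinearMap.id x) a =
      (koszul d i • LinearMap.mulLeft k (ι U x))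
        (gconv (LinearMap.mul k _) l LinearMap.id a) := by
    refine gconv_congr_map _ ha ?_
    rintro n₁ n₂ p₁ p₂ b c - - hb hc
    have hs : l (signPow U i b) = koszul d i • signPow U i (l b) := by
      rw [hl, smul_smul, Int.units_mul_self, one_smul]
    simp only [compSign_apply, compMul_apply, LinearMap.id_apply, LinearMap.mul_apply',
      LinearMap.smul_apply, LinearMap.mulLeft_apply]
    rw [hs, smul_mul_assoc, ← mul_assoc, ← ι_mul_comm hx, mul_assoc]
  rw [comm_id_apply, conv_eq_gconv, conv_eq_gconv, gconv_ι_mul _ _ _ hx, h, LinearMap.smul_apply,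
    LinearMap.mulLeft_apply, add_sub_cancel_right]

/-- The extension of a map that vanishes on the weights `≥ N` is a differential operator of
order `< N`. -/
theorem commVanish_conv_id {d : ℤ} {N : ℕ} {l : GSym U →ₗ[k] GSym U} (hl : HasParity d l)
    (hN : ∀ n p a, IsMonomial U n p a → N ≤ n → l a = 0) :
    CommVanish (deg U) (AlgHom.id k _) d N (conv l LinearMap.id) := by
  induction N generalizing d l with
  | zero =>
    rw [commVanish_zero_iff]
    have h : l = 0 := linearMap_ext fun n p a ha => hN n p a ha (Nat.zero_le n)
    ext a
    rw [h, conv_eq_gconv, gconv_zero_left]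
  | succ N ih =>
    rw [commVanish_succ_iff]
    set D := conv l LinearMap.id with hD
    -- The derivation rule `[D, L_{xa}] = [D, L_x] L_a ± L_x [D, L_a]` reduces to generators, where
    -- `[D, L_x]` is the extension of a map that vanishes on the weights `≥ N`.
    have key : ∀ n i a, IsMonomial U n i a →
        CommVanish (deg U) (AlgHom.id k _) (d + i) N (comm (AlgHom.id k _) d D i a) := by
      intro n i a ha
      induction ha with
      | one =>
        have h : comm (AlgHom.id k _) d D 0 1 = 0 := by
          ext b; simp [comm_id_apply]
        rw [h]
        exact CommVanish.zero
      | @cons n i p x a hx ha ih' =>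
        have h : comm (AlgHom.id k _) d D (i + p) (ι U x * a) =
            comm (AlgHom.id k _) d D i (ι U x) ∘ₗ LinearMap.mulLeft k a +
              koszul d i • (LinearMap.mulLeft k (ι U x) ∘ₗ comm (AlgHom.id k _) d D p a) := by
          ext b
          simp only [comm_id_apply, LinearMap.add_apply, LinearMap.comp_apply,
            LinearMap.smul_apply, LinearMap.mulLeft_apply, mul_assoc, koszul_add_right, mul_sub,
            smul_sub, mul_smul_comm, smul_smul]
          abel
        rw [h]
        refine CommVanish.add ?_ (CommVanish.units_smul _ ?_)
        · rw [← add_assoc]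
          refine commVanish_comp_mulLeft ?_ ha.mem_deg
          rw [hD, comm_conv_id hl hx]
          exact ih (hl.compMul hx) fun n p a ha hn => hN _ _ _ (.cons hx ha) (by omega)
        · rw [add_comm i p, ← add_assoc]
          exact commVanish_mulLeft_comp ih' (IsMonomial.ι hx).mem_deg
    intro i a ha
    rw [deg_eq_span] at ha
    induction ha using Submodule.span_induction with
    | mem a ha =>
      obtain ⟨n, ha⟩ := ha
      exact key n i a ha
    | zero =>
      have h : comm (AlgHom.id k _) d D i 0 = 0 := by
        ext b; simp [comm_id_apply]
      rw [h]
      exact CommVanish.zero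
    | add a b _ _ ha hb =>
      have h : comm (AlgHom.id k _) d D i (a + b) =
          comm (AlgHom.id k _) d D i a + comm (AlgHom.id k _) d D i b := by
        ext c
        simp only [comm_id_apply, LinearMap.add_apply, add_mul, map_add, smul_add]
        abel
      rw [h]
      exact ha.add hb
    | smul r a _ ha =>
      have h : comm (AlgHom.id k _) d D i (r • a) = r • comm (AlgHom.id k _) d D i a := by
        ext c
        simp only [comm_id_apply, LinearMap.smul_apply, smul_mul_assoc, map_smul, smul_sub]
        rw [smul_comm r]
      rw [h]
      exact ha.smul r

/-- A differential operator of order `< N` is determined by its values on the weights `< N`. -/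
theorem eq_zero_of_commVanish {d : ℤ} {N : ℕ} {D : GSym U →ₗ[k] GSym U}
    (hD : CommVanish (deg U) (AlgHom.id k _) d N D)
    (h₀ : ∀ n p a, IsMonomial U n p a → n < N → D a = 0) : D = 0 := by
  induction N generalizing d D with
  | zero => exact commVanish_zero_iff.1 hD
  | succ N ih =>
    rw [commVanish_succ_iff] at hD
    refine linearMap_ext fun n p a ha => ?_
    induction ha with
    | one => exact h₀ _ _ _ .one (Nat.succ_pos N)
    | @cons n i p x a hx ha ih' =>
      -- The operator `[D, L_x]` satisfies the hypotheses with `N` in place of `N + 1`, hence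
      -- vanishes; so `D(x a) = ± x D(a)`.
      have h := ih (hD i _ (IsMonomial.ι hx).mem_deg) (by
        intro n p a ha hn
        rw [comm_id_apply, h₀ _ _ _ (.cons hx ha) (by omega), h₀ _ _ _ ha (by omega)]
        simp)
      have h' := DFunLike.congr_fun h a
      rw [comm_id_apply, ih'] at h'
      simpa using h'

/-- Over the algebra morphism induced by `0`, a map that vanishes on the weights `≥ N` is a
differential operator of order `< N`. -/
theorem commVanish_lift_zero {d : ℤ} {N : ℕ} {D : GSym U →ₗ[k] GSym U'}
    (hN : ∀ n p a, IsMonomial U n p a → N ≤ n → D a = 0) :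
    CommVanish (deg U) (lift (0 : U.carrier →ₗ[k] GSym U') (by simp)) d N D := by
  induction N generalizing d D with
  | zero =>
    rw [commVanish_zero_iff]
    exact linearMap_ext fun n p a ha => hN n p a ha (Nat.zero_le n)
  | succ N ih =>
    rw [commVanish_succ_iff]
    set f : GSym U →ₐ[k] GSym U' := lift (0 : U.carrier →ₗ[k] GSym U') (by simp) with hf
    intro i a ha
    rw [deg_eq_span] at ha
    induction ha using Submodule.span_induction with
    | mem a ha =>
      obtain ⟨n, ha⟩ := ha
      cases ha with
      | one =>
        have h : comm f d D 0 1 = 0 := by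
          ext b; simp [comm]
        rw [h]
        exact CommVanish.zero
      | @cons n i p x a hx ha =>
        -- The algebra morphism kills elements of positive weight, so the commutator is just `b ↦
        -- D(a b)`, whose argument has weight larger than that of `b`.
        refine ih fun n' p' b hb hn => ?_
        have h : f (ι U x * a) = 0 := by simp [hf]
        simp only [comm, h, LinearMap.sub_apply, LinearMap.comp_apply, LinearMap.mulLeft_apply,
          LinearMap.smul_apply, zero_mul, smul_zero, sub_zero]
        exact hN _ _ _ ((IsMonomial.cons hx ha).mul hb) (by omega)
    | zero =>
      have h : comm f d D i 0 = 0 := by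
        ext b; simp [comm]
      rw [h]
      exact CommVanish.zero
    | add a b _ _ ha hb =>
      have h : comm f d D i (a + b) = comm f d D i a + comm f d D i b := by
        ext c
        simp only [comm, LinearMap.sub_apply, LinearMap.comp_apply, LinearMap.mulLeft_apply,
          LinearMap.smul_apply, LinearMap.add_apply, add_mul, map_add, smul_add]
        abel
      rw [h]
      exact ha.add hb
    | smul r a _ ha =>
      have h : comm f d D i (r • a) = r • comm f d D i a := by
        ext c
        simp only [comm, LinearMap.sub_apply, LinearMap.comp_apply, LinearMap.mulLeft_apply,
          LinearMap.smul_apply, smul_mul_assoc, map_smul, smul_sub]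
        rw [smul_comm r]
      rw [h]
      exact ha.smul r

/-- The derived brackets of the extension of `l` are the values of `l`. -/
theorem iterComm_conv_id {n : ℕ} (x : Fin n → U.carrier) (d : Fin n → ℤ)
    (hx : ∀ i, x i ∈ U.grading (d i)) {e : ℤ} {l : GSym U →ₗ[k] GSym U} (hl : HasParity e l) :
    iterComm (AlgHom.id k _) e (conv l LinearMap.id) (List.ofFn fun i => (d i, ι U (x i))) 1 =
      l (List.ofFn fun i => ι U (x i)).prod := by
  induction n generalizing e l with
  | zero => simp [iterComm, conv_eq_gconv]
  | succ n ih =>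
    rw [List.ofFn_succ, List.ofFn_succ, iterComm, comm_conv_id hl (hx 0),
      ih _ _ (fun i => hx i.succ) (hl.compMul (hx 0)), compMul_apply, List.prod_cons]

/-- The components of the extension of `l`. -/
theorem hcoeff_twist_conv_id {e : ℤ} {l : GSym U →ₗ[k] GSym U} (hl : IsCogen e l) (m : ℕ) :
    hcoeff (twist (conv l LinearMap.id)) m = conv (l ∘ₗ proj U (m + 1)) LinearMap.id := by
  refine linearMap_ext fun n p a ha => ?_
  rw [hcoeff_twist _ _ ha, conv_eq_gconv, conv_eq_gconv]
  split_ifs with h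
  -- The term `l(b) c` has weight `1 + n₂`. It contributes to `ħ^m`, that is to weight `n₁ + n₂ -
  -- m`, exactly when `n₁ = m + 1`.
  · refine (gconv_congr_map (proj U (n - m)) ha ?_).symm
    rintro n₁ n₂ p₁ p₂ b c rfl - hb hc
    have hlb := hl.mem_range b
    rw [← symPow_one] at hlb
    simp only [LinearMap.mul_apply', LinearMap.id_apply, LinearMap.comp_apply]
    rw [proj_of_isMonomial hb, proj_of_mem_symPow (mul_mem_symPow hlb hc.mem_symPow)]
    split_ifs with h₁ h₂ h₂
    · rfl
    · omega
    · cases hb with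
      | one => simp [hl.map_one]
      | cons => omega
    · simp
  · symm
    rw [← Submodule.mem_bot k]
    refine gconv_mem _ ha ?_
    rintro n₁ n₂ p₁ p₂ b c hn - hb hc
    rw [LinearMap.comp_apply, proj_of_isMonomial hb, if_neg (by omega)]
    simp

end DiffOp

/-! ### Pure maps -/

section Pure

variable {U U' U'' : GradedSpace.{u, v} k}

theorem isFiltered_of_mem_range {f : GSym U →ₗ[k] GSym U'}
    (h : ∀ a, f a ∈ LinearMap.range (ι U')) (h₁ : f 1 = 0) : IsFiltered f := by
  intro n p a ha
  cases ha with
  | one => rw [h₁]; exact zero_mem _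
  | cons hx ha =>
    refine symPow_le_fil (j := 1) (by omega) ?_
    rw [symPow_one]
    exact h _

/-- A map into the cogenerators of degree `d` for the shifted degrees that vanishes on `1`. -/
structure IsPureCogen (d : ℤ) (f : GSym U →ₗ[k] GSym U') : Prop where
  mem_range : ∀ a, f a ∈ LinearMap.range (ι U')
  degree : HasDegree (shiftedDeg U) (shiftedDeg U') d f
  map_one : f 1 = 0

theorem IsPureCogen.isCogen {d : ℤ} {f : GSym U →ₗ[k] GSym U'} (hf : IsPureCogen d f) :
    IsCogen d f :=
  ⟨hf.mem_range, hf.degree.hasParity, hf.map_one⟩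

theorem hcoeff_twist_of_mem_range {f : GSym U →ₗ[k] GSym U'}
    (hf : ∀ a, f a ∈ LinearMap.range (ι U')) (m : ℕ) :
    hcoeff (twist f) m = f ∘ₗ proj U (m + 1) := by
  refine linearMap_ext fun n p a ha => ?_
  have h := hf a
  rw [← symPow_one] at h
  rw [hcoeff_twist _ _ ha, proj_of_mem_symPow h, LinearMap.comp_apply, proj_of_isMonomial ha]
  split_ifs with h₁ h₂ h₃ h₃ h₃ <;> first | rfl | omega | simp

theorem isPureCogen_proj_one_comp {d : ℤ} {F : GSym U →ₗ[k] GSym U'} (h₁ : proj U' 1 (F 1) = 0)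
    (hF : HasDegree (shiftedDeg U) (shiftedDeg U') d F) : IsPureCogen d (proj U' 1 ∘ₗ F) where
  mem_range a := by
    rw [← symPow_one]
    exact proj_mem_symPow 1 _
  degree q a ha := proj_mem_shiftedDeg (hF q a ha) 1
  map_one := h₁

theorem isPureCogen_proj_one_comp_of_map_one {F : GSym U →ₗ[k] GSym U'} (h₁ : F 1 = 1)
    (hF : HasDegree (shiftedDeg U) (shiftedDeg U') 0 F) : IsPureCogen 0 (proj U' 1 ∘ₗ F) :=
  isPureCogen_proj_one_comp (by rw [h₁, proj_of_isMonomial .one]; simp) hF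

theorem expMap_proj_one_comp [CharZero k] {F : GSym U →ₗ[k] GSym U'} (hF : IsCoalgHom F)
    (hd : HasDegree (shiftedDeg U) (shiftedDeg U') 0 F) : expMap (proj U' 1 ∘ₗ F) = F :=
  (hF.eq_expMap (isPureCogen_proj_one_comp_of_map_one hF.map_one hd).isCogen).symm

theorem hasDegree_expMap_comp_expMap {f : GSym U →ₗ[k] GSym U'} {g : GSym U' →ₗ[k] GSym U''}
    (hf : IsPureCogen 0 f) (hg : IsPureCogen 0 g) :
    HasDegree (shiftedDeg U) (shiftedDeg U'') 0 (expMap g ∘ₗ expMap f) := fun q a ha => by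
  have h := hasDegree_expMap hg.map_one hg.degree _ _
    (hasDegree_expMap hf.map_one hf.degree q a ha)
  rwa [add_zero] at h

/-- After exponentiation everything is a twist, and the composite of two coalgebra morphisms is
again the exponential of its projection to the cogenerators; the logarithm undoes that exponential.
-/
theorem diamond_twist [CharZero k] {f : GSym U →ₗ[k] GSym U'} {g : GSym U' →ₗ[k] GSym U''}
    (hf : IsPureCogen 0 f) (hg : IsPureCogen 0 g) :
    FreeBV.diamond (twist g) (twist f) = twist (proj U'' 1 ∘ₗ expMap g ∘ₗ expMap f) := by
  have hF := hf.isCogen.isCoalgHom_expMap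
  have hG := hg.isCogen.isCoalgHom_expMap
  have hd := hasDegree_expMap_comp_expMap hf hg
  have hh := isPureCogen_proj_one_comp_of_map_one (hG.comp hF).map_one hd
  rw [FreeBV.diamond, expMap_twist hf.isCogen, expMap_twist hg.isCogen,
    hExt_twist_comp_twist hg.isCogen.isFiltered_expMap hf.isCogen.isFiltered_expMap,
    ← logMap_expMap hh.isCogen.twist_one, expMap_twist hh.isCogen,
    expMap_proj_one_comp (hG.comp hF) hd]

end Pure

end GSym

/-! ### The category of pure morphisms -/

namespace GSym

section Pure

variable {U U' U'' : GradedSpace.{u, v} k}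

theorem twist_apply_one {T : GSym U →ₗ[k] GSym U'} (h : T 1 = 0) : twist T 1 = 0 := by
  rw [twist_of_isMonomial T .one, h, map_zero]

theorem hcoeff_twist_apply {f : GSym U →ₗ[k] GSym U'} (hf : ∀ a, f a ∈ LinearMap.range (ι U'))
    (m : ℕ) {j : ℕ} {a : GSym U} (ha : a ∈ symPow U j) :
    hcoeff (twist f) m a = if j = m + 1 then f a else 0 := by
  rw [hcoeff_twist_of_mem_range hf, LinearMap.comp_apply, proj_of_mem_symPow ha]
  simp only [eq_comm]
  split_ifs <;> simp

theorem proj_mem_deg {p : ℤ} {a : GSym U} (ha : a ∈ deg U p) (j : ℕ) : proj U j a ∈ deg U p := by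
  have h := proj_mem_deg_of_mem_shiftedDeg (proj_mem_shiftedDeg_of_mem_deg ha j) j
  rwa [proj_proj, if_pos rfl, sub_add_cancel] at h

/-- A family of maps of the appropriate degrees with values in the cogenerators is the twist of a
single map. -/
theorem exists_isPureCogen {d : ℤ} {φ : ℕ → GSym U →ₗ[k] GSym U'}
    (hd : ∀ m : ℕ, HasDegree (deg U) (deg U') (d - 2 * m) (φ m))
    (h : ∀ m : ℕ, ∀ a ∈ symPow U (m + 1), φ m a ∈ LinearMap.range (ι U')) :
    ∃ f : GSym U →ₗ[k] GSym U', IsPureCogen d f ∧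
      ∀ m : ℕ, ∀ a ∈ symPow U (m + 1), f a = φ m a := by
  -- The index is shifted because `φ m` stands for the component on `S^(m+1)`; on weight zero the
  -- value is `0`.
  set f : GSym U →ₗ[k] GSym U' := ofWeights fun n => if n = 0 then 0 else φ (n - 1) with hf
  have h₀ : f 1 = 0 := by rw [hf, ofWeights_of_isMonomial _ .one]; simp
  have h₁ : ∀ m : ℕ, ∀ a ∈ symPow U (m + 1), f a = φ m a := by
    intro m a ha
    rw [symPow_eq_span] at ha
    induction ha using Submodule.span_induction with
    | mem a ha => obtain ⟨p, ha⟩ := ha; rw [hf, ofWeights_of_isMonomial _ ha]; simp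
    | zero => simp
    | add a b _ _ ha hb => rw [map_add, map_add, ha, hb]
    | smul c a _ ha => rw [map_smul, map_smul, ha]
  have h₂ : ∀ a, f a ∈ LinearMap.range (ι U') := by
    intro a
    induction a using induction_monomial with
    | mono n p a ha =>
      cases n with
      | zero => cases ha; rw [h₀]; exact zero_mem _
      | succ n => rw [h₁ n a ha.mem_symPow]; exact h n a ha.mem_symPow
    | zero => simp
    | add b c hb hc => rw [map_add]; exact add_mem hb hc
    | smul r b hb => rw [map_smul]; exact Submodule.smul_mem _ _ hb
  refine ⟨f, ⟨h₂, ?_, h₀⟩, h₁⟩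
  refine hasDegree_of_hcoeff_twist (isFiltered_of_mem_range h₂ h₀) fun m p a ha => ?_
  rw [hcoeff_twist_of_mem_range h₂, LinearMap.comp_apply, h₁ m _ (proj_mem_symPow _ a)]
  exact hd m p _ (proj_mem_deg ha _)

theorem isPureBVMorphism_twist {V W : FreeBV.{u, v} k} {f : V.Alg →ₗ[k] W.Alg}
    (hf : IsPureCogen 0 f)
    (hc : hExt (twist (expMap f)) ∘ₗ V.op = hExt W.op ∘ₗ twist (expMap f)) :
    IsPureBVMorphism V W (twist f) where
  degree m := by
    have h := hasDegree_hcoeff_twist hf.degree m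
    rwa [zero_sub] at h
  map_one := hf.isCogen.twist_one
  comm := by rw [expMap_twist hf.isCogen, hc]
  order m := by
    refine commVanish_lift_zero fun n p a ha hn => ?_
    rw [hcoeff_twist_apply hf.mem_range m ha.mem_symPow, if_neg (by omega)]
  map_symPow m a ha := by
    rw [hcoeff_twist_apply hf.mem_range m ha, if_pos rfl]
    exact hf.mem_range a
  map_symPow_of_ne m j hj a ha := by
    rw [hcoeff_twist_apply hf.mem_range m ha, if_neg hj]

/-- The components of a pure morphism are supported on different symmetric powers, so their sum `f`
loses no information. -/
theorem _root_.HomotopyBV.IsPureBVMorphism.exists_twist {V W : FreeBV.{u, v} k}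
    {φ : V.Alg →ₗ[k] W.Alg⟦X⟧} (hφ : IsPureBVMorphism V W φ) :
    ∃ f : V.Alg →ₗ[k] W.Alg, IsPureCogen 0 f ∧ twist f = φ := by
  obtain ⟨f, hf, h⟩ := exists_isPureCogen (d := 0) (φ := hcoeff φ)
    (fun m => by rw [zero_sub]; exact hφ.degree m) hφ.map_symPow
  refine ⟨f, hf, hcoeff_ext fun m => linearMap_ext fun n p a ha => ?_⟩
  rw [hcoeff_twist_apply hf.mem_range m ha.mem_symPow]
  split_ifs with hn
  · subst hn
    exact h m a ha.mem_symPow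
  · exact (hφ.map_symPow_of_ne m n hn a ha.mem_symPow).symm

theorem comm_expMap {V W : FreeBV.{u, v} k} {f : V.Alg →ₗ[k] W.Alg} (hf : IsPureCogen 0 f)
    (h : IsPureBVMorphism V W (twist f)) :
    hExt (twist (expMap f)) ∘ₗ V.op = hExt W.op ∘ₗ twist (expMap f) := by
  rw [← expMap_twist hf.isCogen]
  exact h.comm

theorem idMap_eq_twist : FreeBV.idMap U = twist (proj U 1) := by
  refine hcoeff_ext fun m => LinearMap.ext fun a => ?_
  have h : ∀ a, proj U 1 a ∈ LinearMap.range (ι U) := fun a => by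
    rw [← symPow_one]; exact proj_mem_symPow 1 a
  rw [hcoeff_twist_of_mem_range h, FreeBV.idMap, hcoeff_hmk, LinearMap.comp_apply, proj_proj]
  split_ifs with h₁ h₂ h₂
  · subst h₁; rfl
  · omega
  · omega
  · rfl

theorem isPureCogen_proj_one : IsPureCogen 0 (proj U 1) :=
  isPureCogen_proj_one_comp_of_map_one (F := LinearMap.id) rfl hasDegree_id

/-- The identity is the coalgebra morphism with this projection, which is why `id_U` is the identity
for `◇`. -/
theorem expMap_proj_one [CharZero k] : expMap (proj U 1) = LinearMap.id :=
  expMap_proj_one_comp (F := LinearMap.id) IsCoalgHom.id hasDegree_id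

theorem isPureBVMorphism_twist_comp [CharZero k] {V W Z : FreeBV.{u, v} k}
    {f : V.Alg →ₗ[k] W.Alg} {g : W.Alg →ₗ[k] Z.Alg} (hf : IsPureCogen 0 f) (hg : IsPureCogen 0 g)
    (hφ : IsPureBVMorphism V W (twist f)) (hψ : IsPureBVMorphism W Z (twist g)) :
    IsPureBVMorphism V Z (twist (proj Z.space 1 ∘ₗ expMap g ∘ₗ expMap f)) := by
  have hF := hf.isCogen.isCoalgHom_expMap
  have hG := hg.isCogen.isCoalgHom_expMap
  have hd := hasDegree_expMap_comp_expMap hf hg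
  refine isPureBVMorphism_twist (isPureCogen_proj_one_comp_of_map_one (hG.comp hF).map_one hd) ?_
  rw [expMap_proj_one_comp (hG.comp hF) hd,
    ← hExt_twist_comp_twist hg.isCogen.isFiltered_expMap hf.isCogen.isFiltered_expMap, hExt_comp,
    LinearMap.comp_assoc, comm_expMap hf hφ, ← LinearMap.comp_assoc, ← hExt_comp,
    comm_expMap hg hψ, hExt_comp, LinearMap.comp_assoc]

end Pure

end GSym

/-- Through `diamond_twist` the axioms become those of composition of linear maps. The objects need
not be pure: only the morphisms are twists, and their compatibility with arbitrary `Δ` composes by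
`hExt_comp`. -/
theorem pureBVFormCategory [CharZero k] : PureBVFormCategory.{u, v} k where
  id_mem V := by
    rw [GSym.idMap_eq_twist]
    refine GSym.isPureBVMorphism_twist GSym.isPureCogen_proj_one ?_
    rw [GSym.expMap_proj_one, GSym.hExt_twist_id, GSym.hExt_comp_twist_id, LinearMap.id_comp]
  comp_mem φ ψ := by
    obtain ⟨f, hf, hφ⟩ := φ.isPure.exists_twist
    obtain ⟨g, hg, hψ⟩ := ψ.isPure.exists_twist
    rw [← hφ, ← hψ, GSym.diamond_twist hf hg]
    exact GSym.isPureBVMorphism_twist_comp hf hg (hφ ▸ φ.isPure) (hψ ▸ ψ.isPure)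
  id_comp φ := by
    obtain ⟨f, hf, hφ⟩ := φ.isPure.exists_twist
    rw [← hφ, GSym.idMap_eq_twist, GSym.diamond_twist GSym.isPureCogen_proj_one hf,
      GSym.expMap_proj_one, LinearMap.comp_id, GSym.proj_one_expMap hf.isCogen]
  comp_id φ := by
    obtain ⟨f, hf, hφ⟩ := φ.isPure.exists_twist
    rw [← hφ, GSym.idMap_eq_twist, GSym.diamond_twist hf GSym.isPureCogen_proj_one,
      GSym.expMap_proj_one, LinearMap.id_comp, GSym.proj_one_expMap hf.isCogen]
  assoc φ ψ χ := by
    obtain ⟨f, hf, hφ⟩ := φ.isPure.exists_twist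
    obtain ⟨g, hg, hψ⟩ := ψ.isPure.exists_twist
    obtain ⟨h, hh, hχ⟩ := χ.isPure.exists_twist
    have hF := hf.isCogen.isCoalgHom_expMap
    have hG := hg.isCogen.isCoalgHom_expMap
    have hH := hh.isCogen.isCoalgHom_expMap
    have h₁ := GSym.hasDegree_expMap_comp_expMap hf hg
    have h₂ := GSym.hasDegree_expMap_comp_expMap hg hh
    rw [← hφ, ← hψ, ← hχ, GSym.diamond_twist hf hg, GSym.diamond_twist hg hh,
      GSym.diamond_twist (GSym.isPureCogen_proj_one_comp_of_map_one (hG.comp hF).map_one h₁) hh,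
      GSym.diamond_twist hf (GSym.isPureCogen_proj_one_comp_of_map_one (hH.comp hG).map_one h₂),
      GSym.expMap_proj_one_comp (hG.comp hF) h₁, GSym.expMap_proj_one_comp (hH.comp hG) h₂,
      LinearMap.comp_assoc]

/-! ### Operators induced by codifferentials -/

namespace GSym

section Codifferential

variable {U : GradedSpace.{u, v} k}

theorem HasParity.sub_two_mul {f : GSym U →ₗ[k] GSym U} {d : ℤ} (hf : HasParity d f) (m : ℤ) :
    HasParity (d - 2 * m) f := by
  intro j a
  rw [hf, sub_eq_add_neg, koszul_add_left, koszul_of_even_left (even_two_mul m).neg, mul_one]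

theorem IsPureCogen.comp_proj {d : ℤ} {f : GSym U →ₗ[k] GSym U} (hf : IsPureCogen d f) (j : ℕ) :
    HasParity d (f ∘ₗ proj U j) :=
  HasDegree.hasParity fun _ _ ha => hf.degree _ _ (proj_mem_shiftedDeg ha j)

theorem commVanish_conv_comp_proj {d : ℤ} {l : GSym U →ₗ[k] GSym U} (hl : IsPureCogen d l)
    (m : ℕ) : CommVanish (deg U) (AlgHom.id k _) (d - 2 * m) (m + 2)
      (conv (l ∘ₗ proj U (m + 1)) LinearMap.id) := by
  refine commVanish_conv_id ((hl.comp_proj _).sub_two_mul _) fun n p a ha hn => ?_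
  rw [LinearMap.comp_apply, proj_of_isMonomial ha, if_neg (by omega), map_zero]

theorem conv_comp_proj_apply {d : ℤ} {l : GSym U →ₗ[k] GSym U} (hl : IsPureCogen d l) (m : ℕ)
    {j : ℕ} (hj : j ≤ m + 1) {a : GSym U} (ha : a ∈ symPow U j) :
    conv (l ∘ₗ proj U (m + 1)) LinearMap.id a = if j = m + 1 then l a else 0 := by
  rw [symPow_eq_span] at ha
  induction ha using Submodule.span_induction with
  | mem a ha =>
    obtain ⟨p, ha⟩ := ha
    split_ifs with h
    · subst h
      rw [← hcoeff_twist_conv_id hl.isCogen, hcoeff_twist _ _ ha, if_pos (by omega),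
        Nat.add_sub_cancel_left, ← LinearMap.comp_apply, proj_one_conv_id hl.mem_range]
    · rw [conv_eq_gconv, ← Submodule.mem_bot k]
      refine gconv_mem _ ha ?_
      rintro n₁ n₂ p₁ p₂ b c hn - hb hc
      rw [LinearMap.comp_apply, proj_of_isMonomial hb, if_neg (by omega)]
      simp
  | zero => simp
  | add a b _ _ ha hb => rw [map_add, ha, hb]; split_ifs <;> simp
  | smul c a _ ha => rw [map_smul, ha]; split_ifs <;> simp

theorem isBVOperator_twist {l : GSym U →ₗ[k] GSym U} (hl : IsPureCogen 1 l)
    (hsq : conv l LinearMap.id ∘ₗ conv l LinearMap.id = 0) :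
    IsBVOperator (deg U) (twist (conv l LinearMap.id)) where
  degree m := by
    have h := hasDegree_hcoeff_twist (hl.degree.conv hasDegree_id) m
    rwa [add_zero] at h
  order m := by
    rw [hcoeff_twist_conv_id hl.isCogen]
    exact commVanish_conv_comp_proj hl m
  square := by
    have hf := hl.isCogen.isFiltered.conv IsFiltered.id
    rw [hExt_twist_comp_twist hf hf, hsq]
    refine linearMap_ext fun n p a ha => ?_
    rw [twist_of_isMonomial _ ha]
    simp
  map_one := by
    refine twist_apply_one ?_
    rw [conv_eq_gconv, gconv_one, hl.map_one]
    simp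

theorem isPure_of_op_eq_twist {V : FreeBV.{u, v} k} {l : V.Alg →ₗ[k] V.Alg} (hl : IsPureCogen 1 l)
    (hV : V.op = twist (conv l LinearMap.id)) : V.IsPure := by
  intro m
  rw [hV, hcoeff_twist_conv_id hl.isCogen]
  constructor
  · intro a ha
    rw [conv_comp_proj_apply hl m le_rfl ha, if_pos rfl]
    exact hl.mem_range a
  · intro j hj a ha
    rw [conv_comp_proj_apply hl m hj.le ha, if_neg hj.ne]

/-- The coefficient of `ħ^m` in `Δ` and the extension of its restriction `S^(m+1)(U) → U` are
differential operators of order `≤ m + 1` that agree on the weights `≤ m + 1`, so they are equal.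
Then `Δ²` is the twist of the square of the coderivation, and injectivity applies. -/
theorem _root_.HomotopyBV.FreeBV.IsPure.exists_twist {V : FreeBV.{u, v} k} (hV : V.IsPure) :
    ∃ l : V.Alg →ₗ[k] V.Alg, IsPureCogen 1 l ∧ V.op = twist (conv l LinearMap.id) ∧
      conv l LinearMap.id ∘ₗ conv l LinearMap.id = 0 := by
  obtain ⟨l, hl, h⟩ := exists_isPureCogen (d := 1) (φ := hcoeff V.op) V.isBV.degree
    fun m => (hV m).1
  have hop : V.op = twist (conv l LinearMap.id) := by
    refine hcoeff_ext fun m => ?_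
    rw [hcoeff_twist_conv_id hl.isCogen, ← sub_eq_zero]
    have ho : CommVanish (deg V.space) (AlgHom.id k _) (1 - 2 * m) (m + 2) (hcoeff V.op m) :=
      V.isBV.order m
    refine eq_zero_of_commVanish (ho.sub (commVanish_conv_comp_proj hl m)) fun n p a ha hn => ?_
    rw [LinearMap.sub_apply, conv_comp_proj_apply hl m (by omega) ha.mem_symPow]
    split_ifs with hm
    · subst hm
      rw [h m a ha.mem_symPow, sub_self]
    · rw [(hV m).2 n (by omega) a ha.mem_symPow, sub_zero]
  refine ⟨l, hl, hop, ?_⟩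
  have hf := hl.isCogen.isFiltered.conv IsFiltered.id
  have hsq := V.isBV.square
  rw [hop, hExt_twist_comp_twist hf hf] at hsq
  refine twist_injective (hf.comp hf) (fun n p a _ => zero_mem _) (hsq.trans ?_)
  refine linearMap_ext fun n p a ha => ?_
  rw [twist_of_isMonomial _ ha]
  simp

end Codifferential

/-! ### Even regradings -/

section Regrade

variable {A A' U U' U'' : GradedSpace.{u, v} k}

/-- An isomorphism `S(A) ≅ S(U)` induced by an isomorphism `A ≅ U` of even degree `c`. -/
structure RegradeEquiv (A U : GradedSpace.{u, v} k) (c : ℤ) where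
  toAlgEquiv : GSym A ≃ₐ[k] GSym U
  even : Even c
  map_ι : ∀ i, ∀ x ∈ A.grading i, ∃ y ∈ U.grading (i + c), toAlgEquiv (ι A x) = ι U y
  symm_map_ι : ∀ i, ∀ y ∈ U.grading i, ∃ x ∈ A.grading (i - c), toAlgEquiv.symm (ι U y) = ι A x

namespace RegradeEquiv

variable {c : ℤ}

/-- The inverse regrading. -/
def symm (ρ : RegradeEquiv A U c) : RegradeEquiv U A (-c) where
  toAlgEquiv := ρ.toAlgEquiv.symm
  even := ρ.even.neg
  map_ι := ρ.symm_map_ι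
  symm_map_ι i x hx := by
    rw [sub_neg_eq_add]
    exact ρ.map_ι i x hx

/-- The underlying linear map. -/
def toLin (ρ : RegradeEquiv A U c) : GSym A →ₗ[k] GSym U := ρ.toAlgEquiv.toLinearMap

theorem toLin_apply (ρ : RegradeEquiv A U c) (a : GSym A) : ρ.toLin a = ρ.toAlgEquiv a := rfl

@[simp]
theorem symm_toLin_toLin (ρ : RegradeEquiv A U c) (a : GSym A) : ρ.symm.toLin (ρ.toLin a) = a :=
  ρ.toAlgEquiv.symm_apply_apply a

@[simp]
theorem toLin_symm_toLin (ρ : RegradeEquiv A U c) (a : GSym U) : ρ.toLin (ρ.symm.toLin a) = a :=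
  ρ.toAlgEquiv.apply_symm_apply a

@[simp]
theorem comp_symm (ρ : RegradeEquiv A U c) : ρ.toLin ∘ₗ ρ.symm.toLin = LinearMap.id :=
  LinearMap.ext ρ.toLin_symm_toLin

theorem isMonomial (ρ : RegradeEquiv A U c) {n : ℕ} {p : ℤ} {a : GSym A}
    (ha : IsMonomial A n p a) : IsMonomial U n (p + n * c) (ρ.toLin a) := by
  induction ha with
  | one => simpa [toLin_apply] using IsMonomial.one
  | @cons n i p x a hx ha ih =>
    obtain ⟨y, hy, h⟩ := ρ.map_ι i x hx
    rw [toLin_apply, map_mul, h]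
    have h' := IsMonomial.cons hy ih
    rw [toLin_apply] at h'
    convert h' using 1
    push_cast
    ring

theorem proj_comp (ρ : RegradeEquiv A U c) (j : ℕ) :
    proj U j ∘ₗ ρ.toLin = ρ.toLin ∘ₗ proj A j :=
  linearMap_ext fun n p a ha => by
    rw [LinearMap.comp_apply, LinearMap.comp_apply, proj_of_isMonomial ha,
      proj_of_isMonomial (ρ.isMonomial ha)]
    split_ifs <;> simp

theorem signPow_toLin (ρ : RegradeEquiv A U c) (j : ℤ) (a : GSym A) :
    signPow U j (ρ.toLin a) = ρ.toLin (signPow A j a) := by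
  induction a using induction_monomial with
  | mono n p a ha =>
    rw [signPow_of_isMonomial j ha, signPow_of_isMonomial j (ρ.isMonomial ha), map_units_smul,
      koszul_add_right, koszul_symm (n * c) j, koszul_of_even_left (ρ.even.mul_left _), mul_one]
  | zero => simp
  | add b c hb hc => simp only [map_add, hb, hc]
  | smul r b hb => simp only [map_smul, hb]

theorem sign_comp (ρ : RegradeEquiv A U c) :
    (sign U).toLinearMap ∘ₗ ρ.toLin = ρ.toLin ∘ₗ (sign A).toLinearMap := by
  ext a
  simpa [signPow] using ρ.signPow_toLin 1 a

/-- The coproduct depends on the degrees only through Koszul signs, and these do not change under a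
shift by the even number `c`. -/
theorem isCoalgHom (ρ : RegradeEquiv A U c) : IsCoalgHom ρ.toLin where
  comul := by
    refine linearMap_ext fun n p a ha => ?_
    rw [map_comp_comul]
    induction ha with
    | one => simp [toLin_apply, comul_one]
    | @cons n i p x a hx ha ih =>
      obtain ⟨y, hy, h⟩ := ρ.map_ι i x hx
      rw [← map_comp_comul] at ih ⊢
      simp only [LinearMap.comp_apply] at ih ⊢
      rw [comul_ι_mul, toLin_apply, map_mul, h, comul_ι_mul, ← toLin_apply, ih]
      generalize comul A a = t
      induction t using TensorProduct.induction_on with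
      | zero => simp
      | tmul b c =>
        rw [TensorProduct.map_tmul, insertion_tmul hy, insertion_tmul hx, map_add,
          TensorProduct.map_tmul, TensorProduct.map_tmul, toLin_apply ρ (ι A x * b),
          toLin_apply ρ (ι A x * c), map_mul, map_mul, h, signPow_add, signPow_toLin,
          signPow_toLin]
        congr 3
        simp [signPow, ρ.even]
      | add s t hs ht => simp only [map_add, hs, ht]
  counit := by
    refine linearMap_ext fun n p a ha => ?_
    rw [LinearMap.comp_apply]
    simp only [AlgHom.toLinearMap_apply]
    cases n with
    | zero => cases ha; simp [toLin_apply]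
    | succ n => rw [counit_of_isMonomial ha, counit_of_isMonomial (ρ.isMonomial ha)]
  map_one := map_one ρ.toAlgEquiv

theorem mem_symPow (ρ : RegradeEquiv A U c) {n : ℕ} {a : GSym A} (ha : a ∈ symPow A n) :
    ρ.toLin a ∈ symPow U n := by
  have h := DFunLike.congr_fun (ρ.proj_comp n) a
  rw [LinearMap.comp_apply, LinearMap.comp_apply, proj_of_mem_symPow ha, if_pos rfl] at h
  rw [← h]
  exact proj_mem_symPow n _

/-- The regrading adds `2` to the degree of each factor, and `shiftedDeg` subtracts it again. -/
theorem mem_shiftedDeg (ρ : RegradeEquiv A U 2) {p : ℤ} {a : GSym A} (ha : a ∈ deg A p) :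
    ρ.toLin a ∈ shiftedDeg U p := by
  rw [deg_eq_span] at ha
  induction ha using Submodule.span_induction with
  | mem a ha =>
    obtain ⟨n, ha⟩ := ha
    convert (ρ.isMonomial ha).mem_shiftedDeg using 2
    ring
  | zero => simp
  | add a b _ _ ha hb => rw [map_add]; exact add_mem ha hb
  | smul c a _ ha => rw [map_smul]; exact Submodule.smul_mem _ _ ha

theorem symm_mem_deg (ρ : RegradeEquiv A U 2) {p : ℤ} {a : GSym U} (ha : a ∈ shiftedDeg U p) :
    ρ.symm.toLin a ∈ deg A p := by
  rw [shiftedDeg] at ha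
  induction ha using Submodule.span_induction with
  | mem a ha =>
    obtain ⟨n, p, ha, rfl⟩ := ha
    convert (ρ.symm.isMonomial ha).mem_deg using 2
    ring
  | zero => simp
  | add a b _ _ ha hb => rw [map_add]; exact add_mem ha hb
  | smul c a _ ha => rw [map_smul]; exact Submodule.smul_mem _ _ ha

/-- The transport of a linear map along two regradings. -/
def conj (ρ : RegradeEquiv A U c) (ρ' : RegradeEquiv A' U' c) (T : GSym A →ₗ[k] GSym A') :
    GSym U →ₗ[k] GSym U' := ρ'.toLin ∘ₗ T ∘ₗ ρ.symm.toLin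

theorem conj_apply (ρ : RegradeEquiv A U c) (ρ' : RegradeEquiv A' U' c)
    (T : GSym A →ₗ[k] GSym A') (a : GSym U) :
    conj ρ ρ' T a = ρ'.toLin (T (ρ.symm.toLin a)) := rfl

@[simp]
theorem symm_symm (ρ : RegradeEquiv A U c) (a : GSym A) :
    ρ.symm.symm.toLin a = ρ.toLin a := rfl

theorem conj_comp {A'' : GradedSpace.{u, v} k} (ρ : RegradeEquiv A U c)
    (ρ' : RegradeEquiv A' U' c) (ρ'' : RegradeEquiv A'' U'' c) (S : GSym A' →ₗ[k] GSym A'')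
    (T : GSym A →ₗ[k] GSym A') : conj ρ ρ'' (S ∘ₗ T) = conj ρ' ρ'' S ∘ₗ conj ρ ρ' T := by
  ext a; simp [conj_apply]

theorem conj_id (ρ : RegradeEquiv A U c) : conj ρ ρ LinearMap.id = LinearMap.id := by
  ext a; simp [conj_apply]

theorem conj_symm_conj (ρ : RegradeEquiv A U c) (ρ' : RegradeEquiv A' U' c)
    (T : GSym A →ₗ[k] GSym A') : conj ρ.symm ρ'.symm (conj ρ ρ' T) = T := by
  ext a; simp [conj_apply]

theorem conj_conj_symm (ρ : RegradeEquiv A U c) (ρ' : RegradeEquiv A' U' c)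
    (T : GSym U →ₗ[k] GSym U') : conj ρ ρ' (conj ρ.symm ρ'.symm T) = T := by
  ext a; simp [conj_apply]

theorem proj_comp_conj (ρ : RegradeEquiv A U c) (ρ' : RegradeEquiv A' U' c) (j : ℕ)
    (T : GSym A →ₗ[k] GSym A') : proj U' j ∘ₗ conj ρ ρ' T = conj ρ ρ' (proj A' j ∘ₗ T) := by
  rw [conj, ← LinearMap.comp_assoc, ρ'.proj_comp]
  rfl

theorem conj_comp_proj (ρ : RegradeEquiv A U c) (ρ' : RegradeEquiv A' U' c) (j : ℕ)
    (T : GSym A →ₗ[k] GSym A') : conj ρ ρ' T ∘ₗ proj U j = conj ρ ρ' (T ∘ₗ proj A j) := by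
  rw [conj, conj, LinearMap.comp_assoc, LinearMap.comp_assoc, ← ρ.symm.proj_comp,
    LinearMap.comp_assoc]

/-- The regrading on the source respects the coproduct, and the one on the target respects the
product. -/
theorem conj_conv (ρ : RegradeEquiv A U c) (ρ' : RegradeEquiv A' U' c)
    (f g : GSym A →ₗ[k] GSym A') : conj ρ ρ' (conv f g) = conv (conj ρ ρ' f) (conj ρ ρ' g) := by
  rw [conj, ρ.symm.isCoalgHom.conv_comp]
  refine linearMap_ext fun n p a ha => ?_
  rw [LinearMap.comp_apply, conv_eq_gconv, conv_eq_gconv]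
  refine (gconv_congr_map ρ'.toLin ha fun _ _ _ _ b c _ _ _ _ => ?_).symm
  simp only [LinearMap.mul_apply', conj_apply, LinearMap.comp_apply, toLin_apply ρ', map_mul]

theorem isCoalgHom_conj (ρ : RegradeEquiv A U c) (ρ' : RegradeEquiv A' U' c)
    {T : GSym A →ₗ[k] GSym A'} (hT : IsCoalgHom T) : IsCoalgHom (conj ρ ρ' T) :=
  ρ'.isCoalgHom.comp (hT.comp ρ.symm.isCoalgHom)

theorem isOddCoder_conj (ρ : RegradeEquiv A U c) {D : GSym A →ₗ[k] GSym A} (hD : IsOddCoder D) :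
    IsOddCoder (conj ρ ρ D) where
  coderivation := by
    have h₁ : conj ρ ρ (sign A).toLinearMap = (sign U).toLinearMap := by
      rw [conj, ρ.symm.sign_comp, ← LinearMap.comp_assoc, ρ.comp_symm, LinearMap.id_comp]
    have h₂ : ∀ S T : GSym A →ₗ[k] GSym A, TensorProduct.map (conj ρ ρ S) (conj ρ ρ T) =
        TensorProduct.map ρ.toLin ρ.toLin ∘ₗ TensorProduct.map S T ∘ₗ
          TensorProduct.map ρ.symm.toLin ρ.symm.toLin := by
      intro S T
      rw [← TensorProduct.map_comp, ← TensorProduct.map_comp]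
      rfl
    rw [← h₁, ← ρ.conj_id, h₂, h₂]
    ext a
    have e₁ := fun a => DFunLike.congr_fun ρ.isCoalgHom.comul a
    have e₂ := fun a => DFunLike.congr_fun ρ.symm.isCoalgHom.comul a
    have e₃ := fun a => DFunLike.congr_fun hD.coderivation a
    simp only [LinearMap.comp_apply, LinearMap.add_apply] at e₁ e₂ e₃ ⊢
    rw [conj_apply, e₁, e₃, e₂, map_add]
  map_one := by
    rw [conj_apply, ρ.symm.isCoalgHom.map_one, hD.map_one, map_zero]

theorem hasDegree_conj (ρ : RegradeEquiv A U 2) (ρ' : RegradeEquiv A' U' 2) {d : ℤ}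
    {T : GSym A →ₗ[k] GSym A'} (hT : HasDegree (deg A) (deg A') d T) :
    HasDegree (shiftedDeg U) (shiftedDeg U') d (conj ρ ρ' T) :=
  fun p _ ha => ρ'.mem_shiftedDeg (hT p _ (ρ.symm_mem_deg ha))

theorem hasDegree_conj_symm (ρ : RegradeEquiv A U 2) (ρ' : RegradeEquiv A' U' 2) {d : ℤ}
    {T : GSym U →ₗ[k] GSym U'} (hT : HasDegree (shiftedDeg U) (shiftedDeg U') d T) :
    HasDegree (deg A) (deg A') d (conj ρ.symm ρ'.symm T) :=
  fun p _ ha => ρ'.symm_mem_deg (hT p _ (ρ.mem_shiftedDeg ha))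

end RegradeEquiv

/-- The double suspension `S(𝔤[1]) ≅ S(𝔤[-1])`. -/
def minusEquiv (𝔤 : GradedSpace.{u, v} k) : RegradeEquiv (𝔤.shift 1) (𝔤.shift (-1)) 2 where
  toAlgEquiv := AlgEquiv.ofAlgHom (toMinus 𝔤) (toPlus 𝔤) (AlgHom.ext (toMinus_toPlus 𝔤))
    (AlgHom.ext (toPlus_toMinus 𝔤))
  even := even_two
  map_ι i x hx := ⟨𝔤.susp (-1) ((𝔤.susp 1).symm x),
    𝔤.susp_mem (𝔤.susp_symm_mem hx) (by ring), by simp [toMinus, regrade]⟩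
  symm_map_ι i x hx := ⟨𝔤.susp 1 ((𝔤.susp (-1)).symm x),
    𝔤.susp_mem (𝔤.susp_symm_mem hx) (by ring), by simp [toPlus, regrade]⟩

/-- The inverse `S(U) → S(U[2])` of the double suspension. -/
def toShiftTwo (U : GradedSpace.{u, v} k) : GSym U →ₐ[k] GSym ((U.shift 1).shift 1) :=
  regrade (((U.shift 1).susp 1).toLinearMap ∘ₗ (U.susp 1).toLinearMap) fun i _ hx =>
    ⟨i - 2, ⟨1, by ring⟩,
      (U.shift 1).susp_mem (U.susp_mem (p := i - 1) hx (by ring)) (by ring)⟩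

/-- The double suspension `S(U[2]) ≅ S(U)`. -/
def shiftTwoEquiv (U : GradedSpace.{u, v} k) : RegradeEquiv ((U.shift 1).shift 1) U 2 where
  toAlgEquiv := AlgEquiv.ofAlgHom (ofShiftTwo U) (toShiftTwo U)
    (algHom_ext fun x => by simp [ofShiftTwo, toShiftTwo, regrade])
    (algHom_ext fun x => by simp [ofShiftTwo, toShiftTwo, regrade])
  even := even_two
  map_ι i x hx := ⟨(U.susp 1).symm (((U.shift 1).susp 1).symm x), by
    have h := U.susp_symm_mem ((U.shift 1).susp_symm_mem hx)
    convert h using 2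
    ring, by simp [ofShiftTwo, regrade]⟩
  symm_map_ι i x hx := ⟨(U.shift 1).susp 1 (U.susp 1 x),
    (U.shift 1).susp_mem (U.susp_mem (p := i - 1) hx (by ring)) (by ring),
    by simp [toShiftTwo, regrade]⟩

end Regrade

/-! ### Graded coalgebra morphisms -/

section GradedCoalgHom

variable {U U' U'' : GradedSpace.{u, v} k}

/-- A coalgebra morphism of degree zero for the shifted degrees. -/
structure IsGradedCoalgHom (F : GSym U →ₗ[k] GSym U') : Prop extends IsCoalgHom F where
  degree : HasDegree (shiftedDeg U) (shiftedDeg U') 0 F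

theorem IsGradedCoalgHom.id : IsGradedCoalgHom (LinearMap.id : GSym U →ₗ[k] GSym U) :=
  ⟨IsCoalgHom.id, hasDegree_id⟩

theorem IsGradedCoalgHom.comp {F : GSym U →ₗ[k] GSym U'} {G : GSym U' →ₗ[k] GSym U''}
    (hG : IsGradedCoalgHom G) (hF : IsGradedCoalgHom F) : IsGradedCoalgHom (G ∘ₗ F) :=
  ⟨hG.toIsCoalgHom.comp hF.toIsCoalgHom, fun p a ha => by
    have h := hG.degree _ _ (hF.degree p a ha)
    rwa [add_zero] at h⟩

/-- The twist of the projection of `F` to the cogenerators. -/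
def cotwist (F : GSym U →ₗ[k] GSym U') : GSym U →ₗ[k] (GSym U')⟦X⟧ := twist (proj U' 1 ∘ₗ F)

theorem IsGradedCoalgHom.isPureCogen {F : GSym U →ₗ[k] GSym U'} (hF : IsGradedCoalgHom F) :
    IsPureCogen 0 (proj U' 1 ∘ₗ F) :=
  isPureCogen_proj_one_comp_of_map_one hF.map_one hF.degree

theorem IsGradedCoalgHom.isFiltered [CharZero k] {F : GSym U →ₗ[k] GSym U'}
    (hF : IsGradedCoalgHom F) : IsFiltered F := by
  rw [← expMap_proj_one_comp hF.toIsCoalgHom hF.degree]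
  exact hF.isPureCogen.isCogen.isFiltered_expMap

theorem hcoeff_cotwist (F : GSym U →ₗ[k] GSym U') (m : ℕ) :
    hcoeff (cotwist F) m = proj U' 1 ∘ₗ F ∘ₗ proj U (m + 1) :=
  hcoeff_twist_of_mem_range (fun a => by rw [← symPow_one]; exact proj_mem_symPow 1 _) m

theorem cotwist_id : cotwist LinearMap.id = FreeBV.idMap U := idMap_eq_twist.symm

theorem diamond_cotwist [CharZero k] {F : GSym U →ₗ[k] GSym U'} {G : GSym U' →ₗ[k] GSym U''}
    (hF : IsGradedCoalgHom F) (hG : IsGradedCoalgHom G) :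
    FreeBV.diamond (cotwist G) (cotwist F) = cotwist (G ∘ₗ F) := by
  rw [cotwist, cotwist, diamond_twist hF.isPureCogen hG.isPureCogen,
    expMap_proj_one_comp hF.toIsCoalgHom hF.degree,
    expMap_proj_one_comp hG.toIsCoalgHom hG.degree, cotwist]

/-- The twist recovers the projection to the cogenerators, and the projection determines the
coalgebra morphism. -/
theorem cotwist_injective [CharZero k] {F G : GSym U →ₗ[k] GSym U'} (hF : IsGradedCoalgHom F)
    (hG : IsGradedCoalgHom G) (h : cotwist F = cotwist G) : F = G :=
  hF.toIsCoalgHom.ext hG.toIsCoalgHom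
    (twist_injective hF.isPureCogen.isCogen.isFiltered hG.isPureCogen.isCogen.isFiltered h)

theorem isPureBVMorphism_cotwist [CharZero k] {V W : FreeBV.{u, v} k}
    {D : V.Alg →ₗ[k] V.Alg} {E : W.Alg →ₗ[k] W.Alg} (hD : IsFiltered D) (hE : IsFiltered E)
    (hV : V.op = twist D) (hW : W.op = twist E) {F : V.Alg →ₗ[k] W.Alg}
    (hF : IsGradedCoalgHom F) (h : F ∘ₗ D = E ∘ₗ F) : IsPureBVMorphism V W (cotwist F) := by
  refine isPureBVMorphism_twist hF.isPureCogen ?_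
  rw [expMap_proj_one_comp hF.toIsCoalgHom hF.degree, hV, hW,
    hExt_twist_comp_twist hF.isFiltered hD, hExt_twist_comp_twist hE hF.isFiltered, h]

/-- If both operators are twists, then the intertwining relation is an equation of twists of
filtered maps, so it already holds before twisting. -/
theorem _root_.HomotopyBV.IsPureBVMorphism.exists_cotwist [CharZero k] {V W : FreeBV.{u, v} k}
    {D : V.Alg →ₗ[k] V.Alg} {E : W.Alg →ₗ[k] W.Alg} (hD : IsFiltered D) (hE : IsFiltered E)
    (hV : V.op = twist D) (hW : W.op = twist E) {φ : V.Alg →ₗ[k] W.Alg⟦X⟧}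
    (hφ : IsPureBVMorphism V W φ) :
    ∃ F : V.Alg →ₗ[k] W.Alg, IsGradedCoalgHom F ∧ cotwist F = φ ∧ F ∘ₗ D = E ∘ₗ F := by
  obtain ⟨f, hf, rfl⟩ := hφ.exists_twist
  have hF : IsGradedCoalgHom (expMap f) :=
    ⟨hf.isCogen.isCoalgHom_expMap, hasDegree_expMap hf.map_one hf.degree⟩
  refine ⟨expMap f, hF, by rw [cotwist, proj_one_expMap hf.isCogen], ?_⟩
  have h := comm_expMap hf hφ
  rw [hV, hW, hExt_twist_comp_twist hF.isFiltered hD,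
    hExt_twist_comp_twist hE hF.isFiltered] at h
  exact twist_injective (hF.isFiltered.comp hD) (hE.comp hF.isFiltered) h

end GradedCoalgHom

/-! ### Codifferentials -/

section Codifferential

variable {A A' U U' : GradedSpace.{u, v} k}

/-- A coderivation of degree one, for the shifted degrees, with square zero. -/
structure IsCodifferential (D : GSym U →ₗ[k] GSym U) : Prop extends IsOddCoder D where
  degree : HasDegree (shiftedDeg U) (shiftedDeg U) 1 D
  square : D ∘ₗ D = 0

namespace IsCodifferential

variable {D : GSym U →ₗ[k] GSym U}

theorem isPureCogen (hD : IsCodifferential D) : IsPureCogen 1 (proj U 1 ∘ₗ D) :=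
  isPureCogen_proj_one_comp (by rw [hD.map_one, map_zero]) hD.degree

theorem conv_id [CharZero k] (hD : IsCodifferential D) :
    conv (proj U 1 ∘ₗ D) LinearMap.id = D :=
  (hD.toIsOddCoder.eq_conv hD.isPureCogen.isCogen).symm

theorem isFiltered [CharZero k] (hD : IsCodifferential D) : IsFiltered D := by
  rw [← hD.conv_id]
  exact hD.isPureCogen.isCogen.isFiltered.conv IsFiltered.id

theorem hcoeff_twist [CharZero k] (hD : IsCodifferential D) (m : ℕ) :
    hcoeff (twist D) m = conv (proj U 1 ∘ₗ D ∘ₗ proj U (m + 1)) LinearMap.id := by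
  conv_lhs => rw [← hD.conv_id]
  rw [hcoeff_twist_conv_id hD.isPureCogen.isCogen, LinearMap.comp_assoc]

theorem isBVOperator_twist [CharZero k] (hD : IsCodifferential D) :
    IsBVOperator (deg U) (twist D) := by
  have h := GSym.isBVOperator_twist hD.isPureCogen (by rw [hD.conv_id, hD.square])
  rwa [hD.conv_id] at h

theorem isPure [CharZero k] {V : FreeBV.{u, v} k} {D : V.Alg →ₗ[k] V.Alg}
    (hD : IsCodifferential D) (hV : V.op = twist D) : V.IsPure :=
  isPure_of_op_eq_twist hD.isPureCogen (by rw [hV, hD.conv_id])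

end IsCodifferential

theorem _root_.HomotopyBV.LInftyStr.isCodifferential_conj {𝔤 : GradedSpace.{u, v} k}
    (L : LInftyStr 𝔤) (ρ : RegradeEquiv (𝔤.shift 1) U 2) :
    IsCodifferential (RegradeEquiv.conj ρ ρ L.D) where
  toIsOddCoder := ρ.isOddCoder_conj ⟨L.coderivation, L.map_one⟩
  degree := ρ.hasDegree_conj ρ L.degree
  square := by
    rw [← RegradeEquiv.conj_comp, L.square, RegradeEquiv.conj, LinearMap.zero_comp,
      LinearMap.comp_zero]

/-- The `L∞`-structure that corresponds to a codifferential under a regrading. -/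
def _root_.HomotopyBV.LInftyStr.ofCodifferential {𝔤 : GradedSpace.{u, v} k}
    (ρ : RegradeEquiv (𝔤.shift 1) U 2) {D : GSym U →ₗ[k] GSym U} (hD : IsCodifferential D) :
    LInftyStr 𝔤 where
  D := RegradeEquiv.conj ρ.symm ρ.symm D
  degree := ρ.hasDegree_conj_symm ρ hD.degree
  coderivation := (ρ.symm.isOddCoder_conj hD.toIsOddCoder).coderivation
  square := by
    rw [← RegradeEquiv.conj_comp, hD.square, RegradeEquiv.conj, LinearMap.zero_comp,
      LinearMap.comp_zero]
  map_one := (ρ.symm.isOddCoder_conj hD.toIsOddCoder).map_one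

theorem _root_.HomotopyBV.LInftyStr.conj_ofCodifferential {𝔤 : GradedSpace.{u, v} k}
    (ρ : RegradeEquiv (𝔤.shift 1) U 2) {D : GSym U →ₗ[k] GSym U} (hD : IsCodifferential D) :
    RegradeEquiv.conj ρ ρ (LInftyStr.ofCodifferential ρ hD).D = D :=
  ρ.conj_conj_symm ρ D

theorem RegradeEquiv.isGradedCoalgHom_conj (ρ : RegradeEquiv A U 2) (ρ' : RegradeEquiv A' U' 2)
    {T : GSym A →ₗ[k] GSym A'} (hT : IsCoalgHom T) (h : HasDegree (deg A) (deg A') 0 T) :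
    IsGradedCoalgHom (RegradeEquiv.conj ρ ρ' T) :=
  ⟨ρ.isCoalgHom_conj ρ' hT, ρ.hasDegree_conj ρ' h⟩

theorem RegradeEquiv.isGradedCoalgHom_conj_id (ρ : RegradeEquiv A U 2)
    (σ : RegradeEquiv A U' 2) : IsGradedCoalgHom (RegradeEquiv.conj ρ σ LinearMap.id) :=
  ρ.isGradedCoalgHom_conj σ IsCoalgHom.id fun _ _ ha => by simpa using ha

theorem _root_.HomotopyBV.LInfty.Hom.isGradedCoalgHom_conj {𝔤 𝔥 : LInfty.{u, v} k}
    (Φ : LInfty.Hom 𝔤 𝔥) (ρ : RegradeEquiv (𝔤.space.shift 1) U 2)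
    (ρ' : RegradeEquiv (𝔥.space.shift 1) U' 2) :
    IsGradedCoalgHom (RegradeEquiv.conj ρ ρ' Φ.toLin) :=
  ρ.isGradedCoalgHom_conj ρ' ⟨Φ.comul, Φ.counit, Φ.map_one⟩ Φ.degree

theorem _root_.HomotopyBV.LInfty.Hom.conj_comm {𝔤 𝔥 : LInfty.{u, v} k}
    (Φ : LInfty.Hom 𝔤 𝔥) (ρ : RegradeEquiv (𝔤.space.shift 1) U 2)
    (ρ' : RegradeEquiv (𝔥.space.shift 1) U' 2) :
    RegradeEquiv.conj ρ ρ' Φ.toLin ∘ₗ RegradeEquiv.conj ρ ρ 𝔤.str.D =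
      RegradeEquiv.conj ρ' ρ' 𝔥.str.D ∘ₗ RegradeEquiv.conj ρ ρ' Φ.toLin := by
  rw [← RegradeEquiv.conj_comp, ← RegradeEquiv.conj_comp, Φ.comm]

/-- The `L∞`-morphism that corresponds to a coalgebra morphism under regradings. -/
def _root_.HomotopyBV.LInfty.Hom.ofCoalgHom {𝔤 𝔥 : LInfty.{u, v} k}
    (ρ : RegradeEquiv (𝔤.space.shift 1) U 2) (ρ' : RegradeEquiv (𝔥.space.shift 1) U' 2)
    {F : GSym U →ₗ[k] GSym U'} (hF : IsGradedCoalgHom F)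
    (h : F ∘ₗ RegradeEquiv.conj ρ ρ 𝔤.str.D = RegradeEquiv.conj ρ' ρ' 𝔥.str.D ∘ₗ F) :
    LInfty.Hom 𝔤 𝔥 where
  toLin := RegradeEquiv.conj ρ.symm ρ'.symm F
  degree := ρ.hasDegree_conj_symm ρ' hF.degree
  comul := (ρ.symm.isCoalgHom_conj ρ'.symm hF.toIsCoalgHom).comul
  counit := (ρ.symm.isCoalgHom_conj ρ'.symm hF.toIsCoalgHom).counit
  map_one := (ρ.symm.isCoalgHom_conj ρ'.symm hF.toIsCoalgHom).map_one
  comm := by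
    have h' := congrArg (RegradeEquiv.conj ρ.symm ρ'.symm) h
    rwa [RegradeEquiv.conj_comp _ ρ.symm, RegradeEquiv.conj_comp _ ρ'.symm,
      RegradeEquiv.conj_symm_conj, RegradeEquiv.conj_symm_conj] at h'

end Codifferential

/-! ### The functor from `L∞`-algebras -/

section Functor

variable (𝔤 : LInfty.{u, v} k)

/-- The codifferential of an `L∞`-algebra, transported to `S(𝔤[-1])`. -/
def minusCodiff : GSym (𝔤.space.shift (-1)) →ₗ[k] GSym (𝔤.space.shift (-1)) :=
  RegradeEquiv.conj (minusEquiv 𝔤.space) (minusEquiv 𝔤.space) 𝔤.str.D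

theorem isCodifferential_minusCodiff : IsCodifferential (minusCodiff 𝔤) :=
  𝔤.str.isCodifferential_conj _

/-- A codifferential is the extension of its projection to the cogenerators, and the coefficient of
`ħ^m` in its twist is the extension of the component on `S^(m+1)`. That is `Dₙ` with `n = m + 1`. -/
theorem bvOp_eq_twist [CharZero k] : 𝔤.bvOp = twist (minusCodiff 𝔤) :=
  hcoeff_ext fun m => by
    rw [(isCodifferential_minusCodiff 𝔤).hcoeff_twist, LInfty.bvOp, hcoeff_hmk, minusCodiff,
      RegradeEquiv.conj_comp_proj, RegradeEquiv.proj_comp_conj]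
    nth_rw 1 [← (minusEquiv 𝔤.space).conj_id]
    rw [← RegradeEquiv.conj_conv]
    rfl

theorem bvMap_eq_cotwist {𝔤 𝔥 : LInfty.{u, v} k} (Φ : 𝔤 ⟶ 𝔥) :
    LInfty.bvMap Φ = cotwist (RegradeEquiv.conj (minusEquiv 𝔤.space) (minusEquiv 𝔥.space)
      (LInfty.Hom.toLin Φ)) :=
  hcoeff_ext fun m => by
    rw [hcoeff_cotwist, LInfty.bvMap, hcoeff_hmk, RegradeEquiv.conj_comp_proj,
      RegradeEquiv.proj_comp_conj]
    rfl

theorem bvIsFunctorial [CharZero k] : BVIsFunctorial.{u, v} k where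
  isBV 𝔤 := by
    rw [bvOp_eq_twist]
    exact (isCodifferential_minusCodiff 𝔤).isBVOperator_twist
  isPure_map {𝔤 𝔥} Φ := by
    rw [bvMap_eq_cotwist]
    exact isPureBVMorphism_cotwist (isCodifferential_minusCodiff 𝔤).isFiltered
      (isCodifferential_minusCodiff 𝔥).isFiltered (bvOp_eq_twist 𝔤) (bvOp_eq_twist 𝔥)
      (LInfty.Hom.isGradedCoalgHom_conj Φ _ _) (LInfty.Hom.conj_comm Φ _ _)
  map_id 𝔤 := by
    rw [bvMap_eq_cotwist, ← cotwist_id]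
    exact congrArg cotwist (minusEquiv 𝔤.space).conj_id
  map_comp Φ Ψ := by
    rw [bvMap_eq_cotwist, bvMap_eq_cotwist, bvMap_eq_cotwist,
      diamond_cotwist (LInfty.Hom.isGradedCoalgHom_conj Φ _ _)
        (LInfty.Hom.isGradedCoalgHom_conj Ψ _ _), ← RegradeEquiv.conj_comp]
    rfl

end Functor

/-! ### The codifferential of a pure `BV∞`-algebra -/

section Pure

theorem ofShiftTwo_apply (U : GradedSpace.{u, v} k) (a : GSym ((U.shift 1).shift 1)) :
    ofShiftTwo U a = (shiftTwoEquiv U).toLin a := rfl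

theorem ofShiftTwo_proj_one (U : GradedSpace.{u, v} k) (a : GSym ((U.shift 1).shift 1)) :
    ofShiftTwo U (proj _ 1 a) = proj U 1 ((shiftTwoEquiv U).toLin a) :=
  (DFunLike.congr_fun ((shiftTwoEquiv U).proj_comp 1) a).symm

variable [CharZero k] {V W Z : FreeBV.{u, v} k}

theorem _root_.HomotopyBV.FreeBV.IsPure.exists_codifferential (hV : V.IsPure) :
    ∃ D : V.Alg →ₗ[k] V.Alg, IsCodifferential D ∧ V.op = twist D := by
  obtain ⟨l, hl, hop, hsq⟩ := hV.exists_twist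
  refine ⟨_, ⟨hl.isCogen.isOddCoder, ?_, hsq⟩, hop⟩
  have h := hl.degree.conv hasDegree_id
  rwa [add_zero] at h

/-- The codifferential on `S(U)` whose twist is the operator of a pure `BV∞`-algebra. -/
def codiff (hV : V.IsPure) : V.Alg →ₗ[k] V.Alg := hV.exists_codifferential.choose

theorem isCodifferential_codiff (hV : V.IsPure) : IsCodifferential (codiff hV) :=
  hV.exists_codifferential.choose_spec.1

theorem op_eq_twist (hV : V.IsPure) : V.op = twist (codiff hV) :=
  hV.exists_codifferential.choose_spec.2

/-- The `L∞`-structure on `U[1]` of a pure `BV∞`-algebra. -/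
def derivedStr (hV : V.IsPure) : LInftyStr (V.space.shift 1) :=
  LInftyStr.ofCodifferential (shiftTwoEquiv V.space) (isCodifferential_codiff hV)

theorem conj_derivedStr (hV : V.IsPure) :
    RegradeEquiv.conj (shiftTwoEquiv V.space) (shiftTwoEquiv V.space) (derivedStr hV).D =
      codiff hV :=
  LInftyStr.conj_ofCodifferential _ _

/-- The operator `Δₙ` is the extension of the component of `codiff` on `S^n(U)`, so
`iterComm_conv_id` evaluates the iterated commutator to this component; the rest is transport along
`S(U[2]) ≅ S(U)`. -/
theorem isDerived_derivedStr (hV : V.IsPure) : IsDerived V (derivedStr hV) := by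
  intro m x d hx
  have hD := isCodifferential_codiff hV
  have h : (shiftTwoEquiv V.space).toLin (List.ofFn fun i =>
      ι _ ((V.space.shift 1).susp 1 (V.space.susp 1 (x i)))).prod =
        (List.ofFn fun i => ι V.space (x i)).prod := by
    rw [← ofShiftTwo_apply, map_list_prod, List.map_ofFn]
    congr 2
    ext i
    simp [ofShiftTwo, regrade]
  have hm : IsMonomial V.space (m + 1) (∑ i, d i) (List.ofFn fun i => ι V.space (x i)).prod :=
    isMonomial_prod_ofFn hx
  rw [op_eq_twist hV, hD.hcoeff_twist, ← LinearMap.comp_assoc,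
    iterComm_conv_id x d hx ((hD.isPureCogen.comp_proj _).sub_two_mul _), ofShiftTwo_proj_one,
    LinearMap.comp_apply, proj_of_isMonomial hm, if_pos rfl, LinearMap.comp_apply, ← h,
    ← conj_derivedStr hV, RegradeEquiv.conj_apply, RegradeEquiv.symm_toLin_toLin]

/-- The coalgebra morphism `S(U) → S(U')` of a pure `BV∞`-morphism. -/
theorem exists_coalgHom (hV : V.IsPure) (hW : W.IsPure) (φ : FreeBV.Hom V W) :
    ∃ F : V.Alg →ₗ[k] W.Alg, IsGradedCoalgHom F ∧ cotwist F = φ.toLin ∧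
      F ∘ₗ codiff hV = codiff hW ∘ₗ F :=
  φ.isPure.exists_cotwist (isCodifferential_codiff hV).isFiltered
    (isCodifferential_codiff hW).isFiltered (op_eq_twist hV) (op_eq_twist hW)

/-- The coalgebra morphism `S(U) → S(U')` of a pure `BV∞`-morphism. -/
def coalgHom (hV : V.IsPure) (hW : W.IsPure) (φ : FreeBV.Hom V W) : V.Alg →ₗ[k] W.Alg :=
  (exists_coalgHom hV hW φ).choose

theorem isGradedCoalgHom_coalgHom (hV : V.IsPure) (hW : W.IsPure) (φ : FreeBV.Hom V W) :
    IsGradedCoalgHom (coalgHom hV hW φ) :=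
  (exists_coalgHom hV hW φ).choose_spec.1

theorem cotwist_coalgHom (hV : V.IsPure) (hW : W.IsPure) (φ : FreeBV.Hom V W) :
    cotwist (coalgHom hV hW φ) = φ.toLin :=
  (exists_coalgHom hV hW φ).choose_spec.2.1

theorem coalgHom_comm (hV : V.IsPure) (hW : W.IsPure) (φ : FreeBV.Hom V W) :
    coalgHom hV hW φ ∘ₗ codiff hV = codiff hW ∘ₗ coalgHom hV hW φ :=
  (exists_coalgHom hV hW φ).choose_spec.2.2

/-- The chosen coalgebra morphism is the only one with the given cotwist. Functoriality of the
derived construction rests on this. -/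
theorem coalgHom_eq (hV : V.IsPure) (hW : W.IsPure) {φ : FreeBV.Hom V W}
    {F : V.Alg →ₗ[k] W.Alg} (hF : IsGradedCoalgHom F) (h : cotwist F = φ.toLin) :
    coalgHom hV hW φ = F :=
  cotwist_injective (isGradedCoalgHom_coalgHom hV hW φ) hF (by rw [cotwist_coalgHom, h])

/-- The `L∞`-morphism of a pure `BV∞`-morphism of pure `BV∞`-algebras. -/
def derivedHom (hV : V.IsPure) (hW : W.IsPure) (φ : FreeBV.Hom V W) :
    LInfty.Hom ⟨V.space.shift 1, derivedStr hV⟩ ⟨W.space.shift 1, derivedStr hW⟩ :=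
  LInfty.Hom.ofCoalgHom (𝔤 := ⟨V.space.shift 1, derivedStr hV⟩)
    (𝔥 := ⟨W.space.shift 1, derivedStr hW⟩) (shiftTwoEquiv V.space) (shiftTwoEquiv W.space)
    (isGradedCoalgHom_coalgHom hV hW φ) (by
      rw [conj_derivedStr, conj_derivedStr, coalgHom_comm])

theorem isInducedBy_derivedHom (hV : V.IsPure) (hW : W.IsPure) (φ : FreeBV.Hom V W) :
    IsInducedBy φ (derivedHom hV hW φ) := by
  intro m a ha
  rw [ofShiftTwo_proj_one, ← cotwist_coalgHom hV hW φ, hcoeff_cotwist, LinearMap.comp_apply,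
    LinearMap.comp_apply, ofShiftTwo_apply,
    proj_of_mem_symPow ((shiftTwoEquiv V.space).mem_symPow ha), if_pos rfl]
  exact congrArg (proj W.space 1) ((shiftTwoEquiv W.space).toLin_symm_toLin _)

end Pure

end GSym

/-! ### The equivalence -/

section Equivalence

open GSym

variable [CharZero k]

/-- The category of free `BV∞`-algebras and pure `BV∞`-morphisms. -/
abbrev freeBVCategory : Category (FreeBV.{u, v} k) := pureBVFormCategory.category

attribute [local instance] freeBVCategory

/-- The functor from `L∞`-algebras to free `BV∞`-algebras. -/
abbrev bvFunctor : LInfty.{u, v} k ⥤ FreeBV.{u, v} k := bvIsFunctorial.functor pureBVFormCategory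

theorem bvFunctor_isPure (𝔤 : LInfty.{u, v} k) : (bvFunctor.obj 𝔤).IsPure :=
  (isCodifferential_minusCodiff 𝔤).isPure (bvOp_eq_twist 𝔤)

/-- The transported coalgebra morphism is determined by its cotwist, and the transport is
invertible. -/
instance : (bvFunctor (k := k)).Faithful where
  map_injective {𝔤 𝔥 Φ Ψ} h := by
    have h' : LInfty.bvMap Φ = LInfty.bvMap Ψ := congrArg FreeBV.Hom.toLin h
    rw [bvMap_eq_cotwist, bvMap_eq_cotwist] at h'
    have h'' := cotwist_injective (LInfty.Hom.isGradedCoalgHom_conj Φ _ _)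
      (LInfty.Hom.isGradedCoalgHom_conj Ψ _ _) h'
    refine LInfty.Hom.ext ?_
    rw [← RegradeEquiv.conj_symm_conj (minusEquiv 𝔤.space) (minusEquiv 𝔥.space)
      (LInfty.Hom.toLin Φ), h'', RegradeEquiv.conj_symm_conj]

/-- A pure morphism between these objects is the cotwist of a coalgebra morphism that commutes with
the codifferentials; transporting it back to `S(𝔤[1])` gives the preimage. -/
instance : (bvFunctor (k := k)).Full where
  map_surjective {𝔤 𝔥} φ := by
    obtain ⟨F, hF, h, hc⟩ := (FreeBV.Hom.isPure φ).exists_cotwist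
      (isCodifferential_minusCodiff 𝔤).isFiltered (isCodifferential_minusCodiff 𝔥).isFiltered
      (bvOp_eq_twist 𝔤) (bvOp_eq_twist 𝔥)
    refine ⟨LInfty.Hom.ofCoalgHom (minusEquiv 𝔤.space) (minusEquiv 𝔥.space) hF hc,
      FreeBV.Hom.ext ?_⟩
    change LInfty.bvMap _ = φ.toLin
    rw [bvMap_eq_cotwist, ← h]
    exact congrArg cotwist (RegradeEquiv.conj_conj_symm _ _ F)

/-- The property of being a pure `BV∞`-algebra. -/
abbrev isPureProperty : ObjectProperty (FreeBV.{u, v} k) := FreeBV.IsPure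

/-- The functor from `L∞`-algebras to pure `BV∞`-algebras. -/
abbrev pureFunctor : LInfty.{u, v} k ⥤ (isPureProperty (k := k)).FullSubcategory :=
  isPureProperty.lift bvFunctor bvFunctor_isPure

theorem derivedHom_id {V : FreeBV.{u, v} k} (hV : V.IsPure) :
    derivedHom hV hV (𝟙 V) = LInfty.Hom.id _ := by
  refine LInfty.Hom.ext ?_
  change RegradeEquiv.conj _ _ (coalgHom hV hV (𝟙 V)) = LinearMap.id
  rw [coalgHom_eq hV hV IsGradedCoalgHom.id cotwist_id, RegradeEquiv.conj_id]

theorem derivedHom_comp {V W Z : FreeBV.{u, v} k} (hV : V.IsPure) (hW : W.IsPure) (hZ : Z.IsPure)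
    (φ : V ⟶ W) (ψ : W ⟶ Z) :
    derivedHom hV hZ (φ ≫ ψ) = (derivedHom hV hW φ).comp (derivedHom hW hZ ψ) := by
  refine LInfty.Hom.ext ?_
  change RegradeEquiv.conj _ _ (coalgHom hV hZ (φ ≫ ψ)) =
    RegradeEquiv.conj _ _ (coalgHom hW hZ ψ) ∘ₗ RegradeEquiv.conj _ _ (coalgHom hV hW φ)
  have hφ := isGradedCoalgHom_coalgHom hV hW φ
  have hψ := isGradedCoalgHom_coalgHom hW hZ ψ
  rw [← RegradeEquiv.conj_comp, coalgHom_eq hV hZ (hψ.comp hφ)]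
  rw [← diamond_cotwist hφ hψ, cotwist_coalgHom, cotwist_coalgHom]
  rfl

/-- The functor from pure `BV∞`-algebras to `L∞`-algebras given by the derived brackets. -/
abbrev derivedFunctor : (isPureProperty (k := k)).FullSubcategory ⥤ LInfty.{u, v} k where
  obj V := ⟨V.obj.space.shift 1, derivedStr V.property⟩
  map {V W} φ := derivedHom V.property W.property φ.hom
  map_id V := derivedHom_id V.property
  map_comp {V W Z} φ ψ := derivedHom_comp V.property W.property Z.property φ.hom ψ.hom

/-- An isomorphism of free `BV∞`-algebras from two regradings of an `L∞`-algebra. -/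
def FreeBV.isoOfConj {V W : FreeBV.{u, v} k} {𝔤 : GradedSpace.{u, v} k} (L : LInftyStr 𝔤)
    (ρ : RegradeEquiv (𝔤.shift 1) V.space 2) (σ : RegradeEquiv (𝔤.shift 1) W.space 2)
    (hV : V.op = twist (RegradeEquiv.conj ρ ρ L.D))
    (hW : W.op = twist (RegradeEquiv.conj σ σ L.D)) : V ≅ W where
  hom := ⟨cotwist (RegradeEquiv.conj ρ σ LinearMap.id), isPureBVMorphism_cotwist
    (L.isCodifferential_conj ρ).isFiltered (L.isCodifferential_conj σ).isFiltered hV hW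
    (ρ.isGradedCoalgHom_conj_id σ) (LInfty.Hom.conj_comm (.id ⟨𝔤, L⟩) ρ σ)⟩
  inv := ⟨cotwist (RegradeEquiv.conj σ ρ LinearMap.id), isPureBVMorphism_cotwist
    (L.isCodifferential_conj σ).isFiltered (L.isCodifferential_conj ρ).isFiltered hW hV
    (σ.isGradedCoalgHom_conj_id ρ) (LInfty.Hom.conj_comm (.id ⟨𝔤, L⟩) σ ρ)⟩
  hom_inv_id := FreeBV.Hom.ext <| by
    change FreeBV.diamond (cotwist _) (cotwist _) = FreeBV.idMap _
    rw [diamond_cotwist (ρ.isGradedCoalgHom_conj_id σ)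
      (σ.isGradedCoalgHom_conj_id ρ), ← RegradeEquiv.conj_comp,
      LinearMap.comp_id, RegradeEquiv.conj_id, cotwist_id]
  inv_hom_id := FreeBV.Hom.ext <| by
    change FreeBV.diamond (cotwist _) (cotwist _) = FreeBV.idMap _
    rw [diamond_cotwist (σ.isGradedCoalgHom_conj_id ρ)
      (ρ.isGradedCoalgHom_conj_id σ), ← RegradeEquiv.conj_comp,
      LinearMap.comp_id, RegradeEquiv.conj_id, cotwist_id]

/-- The pure `BV∞`-algebra of the derived `L∞`-algebra of `V` is isomorphic to `V`. -/
def derivedCounit (V : (isPureProperty (k := k)).FullSubcategory) :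
    (bvFunctor.obj (derivedFunctor.obj V) : FreeBV.{u, v} k) ≅ V.obj :=
  FreeBV.isoOfConj (derivedStr V.property) (minusEquiv _) (shiftTwoEquiv _)
    (bvOp_eq_twist (derivedFunctor.obj V)) (by
      rw [conj_derivedStr]
      exact op_eq_twist V.property)

/-- The functor given by the derived brackets is a right inverse up to isomorphism. -/
def derivedCounitIso : derivedFunctor (k := k) ⋙ pureFunctor.{u, v} ≅ 𝟭 _ :=
  NatIso.ofComponents (fun V => isPureProperty.isoMk (derivedCounit V)) fun {V W} φ => by
    refine ObjectProperty.hom_ext _ (FreeBV.Hom.ext ?_)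
    have hφ := isGradedCoalgHom_coalgHom V.property W.property φ.hom
    let Φ := derivedHom V.property W.property φ.hom
    change FreeBV.diamond (cotwist (RegradeEquiv.conj (minusEquiv _) (shiftTwoEquiv _) LinearMap.id))
      (LInfty.bvMap (𝔤 := derivedFunctor.obj V) (𝔥 := derivedFunctor.obj W) Φ) =
        FreeBV.diamond φ.hom.toLin
          (cotwist (RegradeEquiv.conj (minusEquiv _) (shiftTwoEquiv _) LinearMap.id))
    -- Both sides of the naturality square become the cotwist of one map: the derived `L∞`-morphism,
    -- transported by `minusEquiv` on the source and by `shiftTwoEquiv` on the target.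
    rw [bvMap_eq_cotwist, ← cotwist_coalgHom V.property W.property φ.hom,
      diamond_cotwist (LInfty.Hom.isGradedCoalgHom_conj Φ _ _)
        (RegradeEquiv.isGradedCoalgHom_conj_id _ _),
      diamond_cotwist (RegradeEquiv.isGradedCoalgHom_conj_id _ _) hφ,
      ← RegradeEquiv.conj_comp,
      ← RegradeEquiv.conj_conj_symm (shiftTwoEquiv V.obj.space) (shiftTwoEquiv W.obj.space)
        (coalgHom _ _ φ.hom),
      ← RegradeEquiv.conj_comp]
    rfl

instance : (pureFunctor (k := k)).EssSurj where
  mem_essImage V := ⟨_, ⟨derivedCounitIso.app V⟩⟩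

instance : (pureFunctor (k := k)).IsEquivalence where

/-- The equivalence between `L∞`-algebras and pure `BV∞`-algebras. -/
def pureEquivalence : LInfty.{u, v} k ≌ (isPureProperty (k := k)).FullSubcategory :=
  -- The isomorphism `derivedCounitIso` identifies the abstract inverse of the fully faithful,
  -- essentially surjective functor with `derivedFunctor`. The inverse can then be replaced by
  -- `derivedFunctor` itself, so that both functors of the equivalence are the prescribed ones by
  -- definition.
  (pureFunctor (k := k)).asEquivalence.changeInverse
    (Iso.isoCompInverse (H := (pureFunctor (k := k)).asEquivalence) derivedCounitIso ≪≫
      Functor.leftUnitor _).symm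

end Equivalence

end HomotopyBV

end

theorem mainTheorem1 (k : Type u) [Field k] [CharZero k] :
    ∃ hcat : PureBVFormCategory.{u, v} k,
    letI : Category (FreeBV.{u, v} k) := hcat.category
    ∃ hF : BVIsFunctorial.{u, v} k,
    ∃ hpure : ∀ 𝔤 : LInfty.{u, v} k, ((hF.functor hcat).obj 𝔤).IsPure,
    letI P : ObjectProperty (FreeBV.{u, v} k) := FreeBV.IsPure
    ∃ der : ∀ V : P.FullSubcategory, LInftyStr (V.obj.space.shift 1),
      (∀ V : P.FullSubcategory, IsDerived V.obj (der V)) ∧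
    ∃ (Gmap : ∀ {V W : P.FullSubcategory}, (V ⟶ W) →
        ((⟨V.obj.space.shift 1, der V⟩ : LInfty.{u, v} k) ⟶ ⟨W.obj.space.shift 1, der W⟩))
      (map_id : ∀ V : P.FullSubcategory, Gmap (𝟙 V) = 𝟙 _)
      (map_comp : ∀ {V W Z : P.FullSubcategory} (φ : V ⟶ W) (ψ : W ⟶ Z),
        Gmap (φ ≫ ψ) = Gmap φ ≫ Gmap ψ),
      (∀ {V W : P.FullSubcategory} (φ : V ⟶ W), IsInducedBy φ.hom (Gmap φ)) ∧
    ∃ e : LInfty.{u, v} k ≌ P.FullSubcategory,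
      e.functor = P.lift (hF.functor hcat) hpure ∧
      e.inverse =
        { obj := fun V => ⟨V.obj.space.shift 1, der V⟩
          map := fun φ => Gmap φ
          map_id := map_id
          map_comp := map_comp } := by
  let := freeBVCategory (k := k)
  exact ⟨pureBVFormCategory, GSym.bvIsFunctorial, bvFunctor_isPure,
    fun V => GSym.derivedStr V.property, fun V => GSym.isDerived_derivedStr V.property,
    fun {V W} φ => GSym.derivedHom V.property W.property φ.hom,
    fun V => derivedHom_id V.property,
    fun {V W Z} φ ψ => derivedHom_comp V.property W.property Z.property φ.hom ψ.hom,
    fun {V W} φ => GSym.isInducedBy_derivedHom V.property W.property φ.hom,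
    pureEquivalence, rfl, rfl⟩
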